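/- Let $S$ be the smooth oriented $2$-sphere, $D\subset S$ a subset of $12$ points and $o\in S\smallsetminus D$. Let $\mathrm{Mod}(S,D)$ be the group of orientation preserving diffeomorphisms of $S$ that preserve $D$, modulo isotopy through such diffeomorphisms (the mapping class group of the pair, that is, the spherical braid group on $12$ strands modulo its full twist). If $\delta$ is a smooth arc in $S$ that connects two distinct points of $D$ and has no points of $D$ in its interior, then the simple braid $T_\delta\in \mathrm{Mod}(S,D)$ is the class of a diffeomorphism supported in a regular neighbourhood of $\delta$ that lets $\delta$ make a counterclockwise half-turn. A simple loop is an element of $\pi_1(S\smallsetminus D,o)$ that is represented by going from $o$ along a path to a small circle around a point of $D$, following this circle once counterclockwise and going back along the path. Let $\mathrm{Epi}'(\pi_1(S\smallsetminus D,o),\mathfrak S_3)$ be the set of surjective homomorphisms $\pi_1(S\smallsetminus D,o)\to\mathfrak S_3$ that take simple loops to transpositions, and put $R(S,D):=\mathfrak S_3\backslash \mathrm{Epi}'(\pi_1(S\smallsetminus D,o),\mathfrak S_3)$, where $\mathfrak S_3$ acts by conjugation. A diffeomorphism $f$ as above and a path from $o$ to $f(o)$ induce an automorphism $f_*$ of $\pi_1(S\smallsetminus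 D,o)$ that preserves the simple loops, and $[f]\cdot[\rho]:=[\rho\circ f_*^{-1}]$ is a well-defined action of $\mathrm{Mod}(S,D)$ on $R(S,D)$. Let $\Sigma\to S$ be the $\boldsymbol\mu_6$-cover, totally ramified over $D$ and unramified elsewhere, for which all simple loops have the same monodromy, a generator of $\boldsymbol\mu_6$; let $\chi$ be the tautological character $\boldsymbol\mu_6\subset\mathbb C^\times$, and let $\mathbb P(S,D)$ be the projective space of the $\chi$-eigenspace $H^1(\Sigma;\mathbb C)_\chi$. Diffeomorphisms of $S$ that preserve $D$ and the orientation lift to $\Sigma$ up to covering transformations, and so $\mathrm{Mod}(S,D)$ acts on $\mathbb P(S,D)$. Let $\Gamma$ be the group of transformations of $\mathbb P(S,D)$ that is the image of this action. Then: 1. The action of $\mathrm{Mod}(S,D)$ on $\mathbb P(S,D)$ is well-defined, and the action of $\mathrm{Mod}(S,D)$ on $R(S,D)$ factors through the resulting surjection $\mathrm{Mod}(S,D)\to\Gamma$. Moreover, $T_\delta^3$ acts trivially on $R(S,D)$ for every simple braid $T_\delta$. 2. The action of $\mathrm{Mod}(S,D)$ on $R(S,D)$ is transitive. 3. $\# R(S,D)=(3^{11}-3)/6=(3^{10}-1)/2$.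 -/

import Mathlib

open scoped Manifold ContDiff LinearAlgebra.Projectivization

noncomputable section

/-! ### The oriented smooth sphere -/

/-- Euclidean 3-space. -/
abbrev E3 : Type := EuclideanSpace ℝ (Fin 3)

/-- The smooth 2-sphere `S`, as the unit sphere of Euclidean 3-space. -/
abbrev S2 : Type := Metric.sphere (0 : E3) 1

/-- The area form of the sphere (outward normal first): `det (x, u, v)` for two tangent vectors
`u`, `v` at `x`, regarded as vectors of Euclidean 3-space. A pair `u`, `v` of tangent vectors is
positively oriented (counterclockwise) if and only if this number is positive. -/
def areaForm (x : S2) (u v : TangentSpace (𝓡 2) x) : ℝ :=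
  Matrix.det ![(x : E3).ofLp,
    (show E3 from mfderiv (𝓡 2) 𝓘(ℝ, E3) (Subtype.val : S2 → E3) x u).ofLp,
    (show E3 from mfderiv (𝓡 2) 𝓘(ℝ, E3) (Subtype.val : S2 → E3) x v).ofLp]

/-- The derivative of `f` takes positively oriented pairs of tangent vectors, and no others, to
positively oriented pairs. -/
def OrientationPreserving (f : S2 → S2) : Prop :=
  ∀ (x : S2) (u v : TangentSpace (𝓡 2) x),
    0 < areaForm (f x) (mfderiv (𝓡 2) (𝓡 2) f x u) (mfderiv (𝓡 2) (𝓡 2) f x v) ↔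
      0 < areaForm x u v

/-- The orientation preserving diffeomorphisms of `S` that preserve `D`. -/
def DiffPlus (D : Finset S2) : Subgroup (Equiv.Perm S2) where
  carrier := {f | ContMDiff (𝓡 2) (𝓡 2) ∞ f ∧ ContMDiff (𝓡 2) (𝓡 2) ∞ f.symm ∧
    OrientationPreserving f ∧ ∀ x, f x ∈ D ↔ x ∈ D}
  one_mem' := by
    refine ⟨contMDiff_id, contMDiff_id, fun x u v => ?_, fun x => Iff.rfl⟩
    have h : mfderiv (𝓡 2) (𝓡 2) ((1 : Equiv.Perm S2) : S2 → S2) x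
        = ContinuousLinearMap.id ℝ (TangentSpace (𝓡 2) x) := mfderiv_id
    rw [h]
    rfl
  mul_mem' := by
    rintro f g ⟨hf, hf', hfo, hfD⟩ ⟨hg, hg', hgo, hgD⟩
    refine ⟨hf.comp hg, hg'.comp hf', fun x u v => ?_, fun x => (hfD (g x)).trans (hgD x)⟩
    have h : mfderiv (𝓡 2) (𝓡 2) ((f * g : Equiv.Perm S2) : S2 → S2) x
        = (mfderiv (𝓡 2) (𝓡 2) f (g x)).comp (mfderiv (𝓡 2) (𝓡 2) g x) :=
      mfderiv_comp x (hf.mdifferentiableAt (by simp)) (hg.mdifferentiableAt (by simp))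
    rw [h]
    exact (hfo (g x) _ _).trans (hgo x u v)
  inv_mem' := by
    rintro f ⟨hf, hf', hfo, hfD⟩
    refine ⟨hf', hf, fun x u v => ?_, fun x => ?_⟩
    · have h : (mfderiv (𝓡 2) (𝓡 2) f (f.symm x)).comp (mfderiv (𝓡 2) (𝓡 2) f.symm x)
          = mfderiv (𝓡 2) (𝓡 2) (f ∘ f.symm) x :=
        (mfderiv_comp x (hf.mdifferentiableAt (by simp)) (hf'.mdifferentiableAt (by simp))).symm
      have key := hfo (f.symm x) (mfderiv (𝓡 2) (𝓡 2) f.symm x u)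
        (mfderiv (𝓡 2) (𝓡 2) f.symm x v)
      have e : ∀ w, HEq (mfderiv (𝓡 2) (𝓡 2) f (f.symm x) (mfderiv (𝓡 2) (𝓡 2) f.symm x w)) w := by
        intro w
        have h2 : mfderiv (𝓡 2) (𝓡 2) (f ∘ f.symm) x w = w := by
          have : (f ∘ f.symm : S2 → S2) = id := by ext1 y; simp
          rw [this, mfderiv_id]
          rfl
        rw [← h] at h2
        exact heq_of_eq h2
      have e2 : ∀ (y : S2), y = x → ∀ (u' v' : TangentSpace (𝓡 2) y), HEq u' u → HEq v' v →
          areaForm y u' v' = areaForm x u v := by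
        rintro y rfl u' v' hu hv
        rw [eq_of_heq hu, eq_of_heq hv]
      rw [e2 _ (f.apply_symm_apply x) _ _ (e u) (e v)] at key
      exact key.symm
    · have := hfD (f.symm x)
      rw [Equiv.apply_symm_apply] at this
      exact this.symm

/-- The elements of `DiffPlus D` that are smoothly isotopic to the identity through elements of
`DiffPlus D`. -/
def isotopicToOne (D : Finset S2) : Subgroup (DiffPlus D) where
  carrier := {f | ∃ H : ℝ → DiffPlus D,
    ContMDiff (𝓘(ℝ, ℝ).prod (𝓡 2)) (𝓡 2) ∞ (fun q : ℝ × S2 => (H q.1 : Equiv.Perm S2) q.2) ∧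
      H 0 = 1 ∧ H 1 = f}
  one_mem' := ⟨fun _ => 1, contMDiff_snd, rfl, rfl⟩
  mul_mem' := by
    rintro f g ⟨H, hH, h0, h1⟩ ⟨G, hG, g0, g1⟩
    refine ⟨fun t => H t * G t, ?_, by simp [h0, g0], by simp [h1, g1]⟩
    exact hH.comp (contMDiff_fst.prodMk hG)
  inv_mem' := by
    rintro f ⟨H, hH, h0, h1⟩
    refine ⟨fun t => f⁻¹ * H (1 - t), ?_, by simp [h1], by simp [h0]⟩
    have h2 : ContMDiff (𝓘(ℝ, ℝ).prod (𝓡 2)) (𝓘(ℝ, ℝ).prod (𝓡 2)) ∞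
        (fun q : ℝ × S2 => ((1 - q.1, q.2) : ℝ × S2)) := by
      refine ContMDiff.prodMk ?_ contMDiff_snd
      have : ContMDiff 𝓘(ℝ, ℝ) 𝓘(ℝ, ℝ) ∞ (fun t : ℝ => 1 - t) :=
        (contDiff_const.sub contDiff_id).contMDiff
      exact this.comp contMDiff_fst
    exact (f⁻¹).2.1.comp (hH.comp h2)

instance isotopicToOne_normal (D : Finset S2) : (isotopicToOne D).Normal where
  conj_mem := by
    rintro f ⟨H, hH, h0, h1⟩ g
    refine ⟨fun t => g * H t * g⁻¹, ?_, by simp [h0], by simp [h1]⟩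
    have h2 : ContMDiff (𝓘(ℝ, ℝ).prod (𝓡 2)) (𝓘(ℝ, ℝ).prod (𝓡 2)) ∞
        (fun q : ℝ × S2 => ((q.1, ((g⁻¹ : DiffPlus D) : Equiv.Perm S2) q.2) : ℝ × S2)) :=
      contMDiff_fst.prodMk ((g⁻¹).2.1.comp contMDiff_snd)
    exact g.2.1.comp (hH.comp h2)

/-- The mapping class group `Mod(S,D)`: orientation preserving diffeomorphisms of `S` that preserve
`D`, modulo isotopy. -/
abbrev ModGroup (D : Finset S2) : Type := DiffPlus D ⧸ isotopicToOne D

/-! ### Embedded discs, simple loops and simple braids -/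

/-- An orientation preserving smooth embedding of the plane in the sphere. -/
structure OrientedDisc where
  toFun : ℂ → S2
  smooth : ContMDiff 𝓘(ℝ, ℂ) (𝓡 2) ∞ toFun
  injective : Function.Injective toFun
  oriented : ∀ z : ℂ,
    0 < areaForm (toFun z)
      (mfderiv 𝓘(ℝ, ℂ) (𝓡 2) toFun z (show TangentSpace 𝓘(ℝ, ℂ) z from (1 : ℂ)))
      (mfderiv 𝓘(ℝ, ℂ) (𝓡 2) toFun z (show TangentSpace 𝓘(ℝ, ℂ) z from Complex.I))

/-- The punctured sphere `S ∖ D`. -/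
abbrev Punctured (D : Finset S2) : Type := {x : S2 // x ∉ D}

/-- The fundamental group `π₁(S ∖ D, o)`. -/
abbrev PiOne (D : Finset S2) (o : Punctured D) : Type := FundamentalGroup (Punctured D) o

/-- For an embedded disc that meets `D` at most in its centre: the image of the unit circle,
traversed once counterclockwise. -/
def circlePath {D : Finset S2} (j : OrientedDisc) (hj : ∀ z, z ≠ 0 → j.toFun z ∉ D) :
    Path (⟨j.toFun 1, hj 1 one_ne_zero⟩ : Punctured D) ⟨j.toFun 1, hj 1 one_ne_zero⟩ where
  toFun t := ⟨j.toFun (Complex.exp (2 * Real.pi * (t : ℝ) * Complex.I)),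
    hj _ (Complex.exp_ne_zero _)⟩
  continuous_toFun := by
    refine Continuous.subtype_mk (j.smooth.continuous.comp ?_) _
    fun_prop
  source' := by simp
  target' := by simp [Complex.exp_two_pi_mul_I]

/-- The (counterclockwise) simple loops around the points of `D`: go from `o` along a path to a
small circle around a point of `D`, follow this circle once counterclockwise and go back. -/
def IsSimpleLoop {D : Finset S2} {o : Punctured D} (c : PiOne D o) : Prop :=
  ∃ (j : OrientedDisc) (hj : ∀ z, z ≠ 0 → j.toFun z ∉ D), j.toFun 0 ∈ D ∧
    ∃ q : Path.Homotopic.Quotient o ⟨j.toFun 1, hj 1 one_ne_zero⟩,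
      c = q.trans ((Path.Homotopic.Quotient.mk (circlePath j hj)).trans q.symm)

/-- `f` is the counterclockwise half-turn along the arc `j([-1,1])`: it rotates the circle of
radius `r` of the embedded disc `j` over the angle `π β(r)`, where `β = 1` on `[0,1]` and
`β = 0` on `[2,∞)`, and it is the identity outside this disc. -/
def IsHalfTwist (j : OrientedDisc) (f : S2 → S2) : Prop :=
  (∀ z : ℂ, f (j.toFun z) =
    j.toFun (z * Complex.exp (Real.pi * Real.smoothTransition (2 - ‖z‖) * Complex.I))) ∧
  ∀ x, x ∉ Set.range j.toFun → f x = x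

/-- `T` is the simple braid `T_δ`, for some smooth arc `δ = j([-1,1])` that connects two points
of `D` and has no points of `D` in its interior. -/
def IsSimpleBraid {D : Finset S2} (T : ModGroup D) : Prop :=
  ∃ (j : OrientedDisc) (f : DiffPlus D), (∀ z, j.toFun z ∈ D ↔ z = 1 ∨ z = -1) ∧
    IsHalfTwist j (f : Equiv.Perm S2) ∧ T = QuotientGroup.mk f

/-! ### The outer action on the fundamental group -/

/-- A diffeomorphism that preserves `D`, as a self-map of `S ∖ D`. -/
def restr {D : Finset S2} (f : DiffPlus D) : C(Punctured D, Punctured D) where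
  toFun x := ⟨(f : Equiv.Perm S2) x, fun h => x.2 ((f.2.2.2.2 x).1 h)⟩
  continuous_toFun :=
    Continuous.subtype_mk (f.2.1.continuous.comp continuous_subtype_val) _

namespace PathClass

variable {X Y : Type} [TopologicalSpace X] [TopologicalSpace Y]

theorem map_trans {x y z : X} (p : Path.Homotopic.Quotient x y)
    (q : Path.Homotopic.Quotient y z) (f : C(X, Y)) :
    (p.trans q).map f = (p.map f).trans (q.map f) := by
  induction p using Path.Homotopic.Quotient.ind with | _ p =>
  induction q using Path.Homotopic.Quotient.ind with | _ q =>
  rw [← Path.Homotopic.Quotient.mk_trans, ← Path.Homotopic.Quotient.mk_map,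
    ← Path.Homotopic.Quotient.mk_map, ← Path.Homotopic.Quotient.mk_map,
    ← Path.Homotopic.Quotient.mk_trans, Path.map_trans]

theorem map_symm {x y : X} (p : Path.Homotopic.Quotient x y) (f : C(X, Y)) :
    p.symm.map f = (p.map f).symm := by
  induction p using Path.Homotopic.Quotient.ind with | _ p => rfl

theorem map_refl (x : X) (f : C(X, Y)) :
    (Path.Homotopic.Quotient.refl x).map f = Path.Homotopic.Quotient.refl (f x) := rfl

theorem symm_trans_cancel {x y z : X} (p : Path.Homotopic.Quotient x y)
    (q : Path.Homotopic.Quotient y z) : p.symm.trans (p.trans q) = q := by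
  rw [← Path.Homotopic.Quotient.trans_assoc, Path.Homotopic.Quotient.symm_trans,
    Path.Homotopic.Quotient.refl_trans]

theorem trans_symm_cancel {x y z : X} (p : Path.Homotopic.Quotient x y)
    (q : Path.Homotopic.Quotient x z) : p.trans (p.symm.trans q) = q := by
  rw [← Path.Homotopic.Quotient.trans_assoc, Path.Homotopic.Quotient.trans_symm,
    Path.Homotopic.Quotient.refl_trans]

theorem symm_trans_rev {x y z : X} (p : Path.Homotopic.Quotient x y)
    (q : Path.Homotopic.Quotient y z) : (p.trans q).symm = q.symm.trans p.symm := by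
  induction p using Path.Homotopic.Quotient.ind with | _ p =>
  induction q using Path.Homotopic.Quotient.ind with | _ q =>
  rw [← Path.Homotopic.Quotient.mk_trans, ← Path.Homotopic.Quotient.mk_symm, Path.trans_symm]
  rfl

theorem conj_conj {x y z : X} (p : Path.Homotopic.Quotient x y)
    (q : Path.Homotopic.Quotient y z) (l : Path.Homotopic.Quotient z z) :
    (p.trans q).trans (l.trans (p.trans q).symm) =
      p.trans ((q.trans (l.trans q.symm)).trans p.symm) := by
  simp only [symm_trans_rev, Path.Homotopic.Quotient.trans_assoc]

theorem symm_symm {x y : X} (p : Path.Homotopic.Quotient x y) : p.symm.symm = p := by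
  induction p using Path.Homotopic.Quotient.ind with | _ p =>
  rw [← Path.Homotopic.Quotient.mk_symm, ← Path.Homotopic.Quotient.mk_symm, Path.symm_symm]

end PathClass

/-- The endomorphism of `π₁(S ∖ D, o)` induced by `f` and (the homotopy class of) a path `p` from
`o` to `f(o)`: it takes a loop `g` to `p`, followed by `f(g)`, followed by the inverse of `p`. -/
def pushHom {D : Finset S2} {o : Punctured D} (f : DiffPlus D)
    (p : Path.Homotopic.Quotient o (restr f o)) : PiOne D o →* PiOne D o where
  toFun g := p.trans ((Path.Homotopic.Quotient.map g (restr f)).trans p.symm)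
  map_one' := by
    change p.trans (((Path.Homotopic.Quotient.refl o).map (restr f)).trans p.symm) =
      Path.Homotopic.Quotient.refl o
    rw [PathClass.map_refl, Path.Homotopic.Quotient.refl_trans,
      Path.Homotopic.Quotient.trans_symm]
  map_mul' a b := by
    change p.trans ((Path.Homotopic.Quotient.map (Path.Homotopic.Quotient.trans b a)
      (restr f)).trans p.symm) =
      (p.trans ((Path.Homotopic.Quotient.map b (restr f)).trans p.symm)).trans
        (p.trans ((Path.Homotopic.Quotient.map a (restr f)).trans p.symm))
    simp only [PathClass.map_trans, Path.Homotopic.Quotient.trans_assoc,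
      PathClass.symm_trans_cancel]

theorem pushHom_apply {D : Finset S2} {o : Punctured D} (f : DiffPlus D)
    (p : Path.Homotopic.Quotient o (restr f o)) (g : PiOne D o) :
    pushHom f p g = p.trans ((Path.Homotopic.Quotient.map g (restr f)).trans p.symm) := rfl

theorem pushHom_mul {D : Finset S2} {o : Punctured D} (f g : DiffPlus D)
    (p : Path.Homotopic.Quotient o (restr f o)) (q : Path.Homotopic.Quotient o (restr g o))
    (a : PiOne D o) :
    pushHom (f * g) (p.trans (q.map (restr f))) a = pushHom f p (pushHom g q a) := by
  have h : Path.Homotopic.Quotient.map a (restr (f * g)) =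
    (Path.Homotopic.Quotient.map (Path.Homotopic.Quotient.map a (restr g)) (restr f)) := by
    induction a using Path.Homotopic.Quotient.ind with | _ a => rfl
  simp only [pushHom_apply, PathClass.map_trans, PathClass.map_symm, h]
  exact PathClass.conj_conj _ _ _

theorem pushHom_eq_conj {D : Finset S2} {o : Punctured D} (f : DiffPlus D)
    (p q : Path.Homotopic.Quotient o (restr f o)) (a : PiOne D o) :
    pushHom f q a = (FundamentalGroup.fromPath (p.trans q.symm)) * pushHom f p a *
      (FundamentalGroup.fromPath (p.trans q.symm))⁻¹ := by
  change _ = ((p.trans q.symm).symm).trans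
    ((p.trans ((Path.Homotopic.Quotient.map a (restr f)).trans p.symm)).trans (p.trans q.symm))
  simp only [PathClass.symm_trans_rev, PathClass.symm_symm, Path.Homotopic.Quotient.trans_assoc,
    PathClass.symm_trans_cancel, pushHom_apply]

/-- A loop conjugate to a simple loop is a simple loop. -/
theorem IsSimpleLoop.conj {D : Finset S2} {o : Punctured D} {c : PiOne D o}
    (hc : IsSimpleLoop c) (b : PiOne D o) : IsSimpleLoop (b * c * b⁻¹) := by
  obtain ⟨j, hj, h0, q, rfl⟩ := hc
  refine ⟨j, hj, h0, Path.Homotopic.Quotient.trans (Path.Homotopic.Quotient.symm b) q, ?_⟩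
  refine Eq.trans ?_
    (PathClass.conj_conj (X := Punctured D) (Path.Homotopic.Quotient.symm b) q
      (Path.Homotopic.Quotient.mk (circlePath j hj))).symm
  rw [PathClass.symm_symm]
  rfl

/-- The image of an embedded disc under a diffeomorphism. -/
def OrientedDisc.push {D : Finset S2} (j : OrientedDisc) (f : DiffPlus D) : OrientedDisc where
  toFun := (f : Equiv.Perm S2) ∘ j.toFun
  smooth := f.2.1.comp j.smooth
  injective := (f : Equiv.Perm S2).injective.comp j.injective
  oriented z := by
    rw [mfderiv_comp z (f.2.1.mdifferentiableAt (by simp)) (j.smooth.mdifferentiableAt (by simp))]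
    exact (f.2.2.2.1 (j.toFun z) _ _).2 (j.oriented z)

theorem IsSimpleLoop.push {D : Finset S2} {o : Punctured D} {c : PiOne D o}
    (hc : IsSimpleLoop c) (f : DiffPlus D) (p : Path.Homotopic.Quotient o (restr f o)) :
    IsSimpleLoop (pushHom f p c) := by
  obtain ⟨j, hj, h0, q, rfl⟩ := hc
  refine ⟨j.push f, fun z hz h => hj z hz ((f.2.2.2.2 _).1 h), (f.2.2.2.2 _).2 h0,
    p.trans (q.map (restr f)), ?_⟩
  simp only [pushHom_apply, PathClass.map_trans, PathClass.map_symm]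
  exact (PathClass.conj_conj _ _ _).symm

theorem pushHom_one_exists {D : Finset S2} {o : Punctured D} (h : DiffPlus D) (hh : h = 1)
    {x : Punctured D} (r : Path.Homotopic.Quotient x (restr h o)) :
    ∃ q : Path.Homotopic.Quotient o x, ∀ a : PiOne D o, pushHom h (q.trans r) a = a := by
  subst hh
  refine ⟨r.symm, fun a => ?_⟩
  suffices H : ∀ w : Path.Homotopic.Quotient o (restr (1 : DiffPlus D) o),
      w = Path.Homotopic.Quotient.refl o → pushHom 1 w a = a from
    H _ (Path.Homotopic.Quotient.symm_trans r)
  rintro w rfl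
  have h : Path.Homotopic.Quotient.map a (restr (1 : DiffPlus D)) = a := by
    induction a using Path.Homotopic.Quotient.ind with | _ a => rfl
  change (Path.Homotopic.Quotient.refl o).trans ((Path.Homotopic.Quotient.map a
    (restr (1 : DiffPlus D))).trans (Path.Homotopic.Quotient.refl o)) = a
  rw [h]
  change (Path.Homotopic.Quotient.refl o).trans
    (Path.Homotopic.Quotient.trans a (Path.Homotopic.Quotient.refl o)) = a
  rw [Path.Homotopic.Quotient.refl_trans]
  exact Path.Homotopic.Quotient.trans_refl _

theorem pushHom_leftInverse {D : Finset S2} {o : Punctured D} (f : DiffPlus D)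
    (p : Path.Homotopic.Quotient o (restr f o)) :
    ∃ q : Path.Homotopic.Quotient o (restr f⁻¹ o), ∀ a, pushHom f⁻¹ q (pushHom f p a) = a := by
  obtain ⟨q, hq⟩ := pushHom_one_exists (f⁻¹ * f) (by simp) (p.map (restr f⁻¹))
  exact ⟨q, fun a => by rw [← pushHom_mul, hq]⟩

theorem pushHom_bijective {D : Finset S2} {o : Punctured D} (f : DiffPlus D)
    (p : Path.Homotopic.Quotient o (restr f o)) : Function.Bijective (pushHom f p) := by
  obtain ⟨q, hq⟩ := pushHom_leftInverse f p
  obtain ⟨r, hr⟩ := pushHom_leftInverse f⁻¹ q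
  refine ⟨Function.LeftInverse.injective hq, fun a => ⟨pushHom f⁻¹ q a, ?_⟩⟩
  apply Function.LeftInverse.injective hr
  rw [hq]

/-- The automorphisms of `π₁(S ∖ D, o)` that preserve the simple loops. -/
def simpleAut (D : Finset S2) (o : Punctured D) : Subgroup (MulAut (PiOne D o)) where
  carrier := {a | ∀ c, IsSimpleLoop (a c) ↔ IsSimpleLoop c}
  one_mem' _ := Iff.rfl
  mul_mem' ha hb c := (ha _).trans (hb c)
  inv_mem' {a} ha c := by
    rw [← ha, MulAut.apply_inv_self]

/-- The automorphism of `π₁(S ∖ D, o)` induced by a diffeomorphism `f` and a path from `o` to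
`f(o)`. -/
def pushAut {D : Finset S2} {o : Punctured D} (f : DiffPlus D)
    (p : Path.Homotopic.Quotient o (restr f o)) : simpleAut D o :=
  ⟨MulEquiv.ofBijective (pushHom f p) (pushHom_bijective f p), fun c => by
    refine ⟨fun h => ?_, fun h => h.push f p⟩
    obtain ⟨q, hq⟩ := pushHom_leftInverse f p
    rw [← hq c]
    exact IsSimpleLoop.push h f⁻¹ q⟩

theorem pushAut_apply {D : Finset S2} {o : Punctured D} (f : DiffPlus D)
    (p : Path.Homotopic.Quotient o (restr f o)) (a : PiOne D o) :
    (pushAut f p : MulAut (PiOne D o)) a = pushHom f p a := rfl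

theorem pushAut_mul {D : Finset S2} {o : Punctured D} (f g : DiffPlus D)
    (p : Path.Homotopic.Quotient o (restr f o)) (q : Path.Homotopic.Quotient o (restr g o)) :
    pushAut (f * g) (p.trans (q.map (restr f))) = pushAut f p * pushAut g q :=
  Subtype.ext (MulEquiv.ext fun a => pushHom_mul f g p q a)

theorem pushAut_inv {D : Finset S2} {o : Punctured D} (f : DiffPlus D)
    (p : Path.Homotopic.Quotient o (restr f o)) :
    ∃ q : Path.Homotopic.Quotient o (restr f⁻¹ o), (pushAut f p)⁻¹ = pushAut f⁻¹ q := by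
  obtain ⟨q, hq⟩ := pushHom_leftInverse f p
  exact ⟨q, inv_eq_of_mul_eq_one_left (Subtype.ext (MulEquiv.ext hq))⟩

theorem pushAut_eq_conj {D : Finset S2} {o : Punctured D} (f : DiffPlus D)
    (p q : Path.Homotopic.Quotient o (restr f o)) :
    ∃ b : PiOne D o,
      (pushAut f q : MulAut (PiOne D o)) = MulAut.conj b * (pushAut f p : MulAut (PiOne D o)) :=
  ⟨FundamentalGroup.fromPath (p.trans q.symm), MulEquiv.ext fun a => pushHom_eq_conj f p q a⟩

/-- A diffeomorphism that is isotopic to the identity induces the identity of `π₁(S ∖ D, o)`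
if one takes for the path from `o` to `f(o)` the track of `o` under the isotopy. -/
theorem pushAut_of_isotopicToOne {D : Finset S2} {o : Punctured D} (f : DiffPlus D)
    (hf : f ∈ isotopicToOne D) :
    ∃ p : Path.Homotopic.Quotient o (restr f o), pushAut f p = 1 := by
  obtain ⟨H, hH, h0, rfl⟩ := hf
  let F : (ContinuousMap.id (Punctured D)).Homotopy (restr (H 1)) :=
    { toFun := fun q => restr (H q.1) q.2
      continuous_toFun := by
        have h : Continuous (fun q : unitInterval × Punctured D => (((q.1 : ℝ), q.2.1) : ℝ × S2)) := by
          fun_prop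
        exact Continuous.subtype_mk (hH.continuous.comp h) _
      map_zero_left := fun x => by
        change restr (H (0 : ℝ)) x = x
        rw [h0]
        rfl
      map_one_left := fun x => rfl }
  refine ⟨Path.Homotopic.Quotient.mk (F.evalAt o), Subtype.ext (MulEquiv.ext fun a => ?_)⟩
  rw [pushAut_apply]
  change pushHom _ _ a = a
  rw [pushHom_apply]
  obtain ⟨a, rfl⟩ := Path.Homotopic.Quotient.mk_surjective a
  have h : (Path.Homotopic.Quotient.mk (a.map (map_continuous (ContinuousMap.id _)))).trans
        (Path.Homotopic.Quotient.mk (F.evalAt o)) =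
      (Path.Homotopic.Quotient.mk (F.evalAt o)).trans
        (Path.Homotopic.Quotient.mk (a.map (map_continuous (restr (H 1))))) :=
    Path.Homotopic.Quotient.eq.2 (Path.Homotopic.map_trans_evalAt F a)
  rw [← Path.Homotopic.Quotient.trans_assoc]
  change ((Path.Homotopic.Quotient.mk (F.evalAt o)).trans
    (Path.Homotopic.Quotient.mk (a.map (map_continuous (restr (H 1)))))).trans
      (Path.Homotopic.Quotient.mk (F.evalAt o)).symm = _
  rw [← h, Path.Homotopic.Quotient.trans_assoc, Path.Homotopic.Quotient.trans_symm,
    Path.Homotopic.Quotient.trans_refl]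
  rfl

instance punctured_pathConnected (D : Finset S2) : PathConnectedSpace (Punctured D) := by
  change PathConnectedSpace ((D : Set S2)ᶜ : Set S2)
  rw [← isPathConnected_iff_pathConnectedSpace]
  have hrank : ∀ n : ℕ, 1 < n → 1 < Module.rank ℝ (EuclideanSpace ℝ (Fin n)) := by
    intro n hn
    rw [← Module.finrank_eq_rank, finrank_euclideanSpace_fin]
    exact_mod_cast hn
  rcases D.eq_empty_or_nonempty with rfl | ⟨v, hv⟩
  · have h := isPathConnected_sphere (hrank 3 (by norm_num)) (0 : E3) zero_le_one
    rw [isPathConnected_iff_pathConnectedSpace] at h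
    have : ((∅ : Finset S2) : Set S2)ᶜ = Set.univ := by simp
    rw [this]
    exact pathConnectedSpace_iff_univ.1 h
  · have : Fact (Module.finrank ℝ E3 = 2 + 1) := ⟨finrank_euclideanSpace_fin⟩
    let φ := stereographic' 2 v
    have ht : φ.target = Set.univ := stereographic'_target v
    have hs : φ.source = {v}ᶜ := stereographic'_source v
    have hcont : Continuous φ.symm := by
      rw [← continuousOn_univ, ← ht]
      exact φ.continuousOn_symm
    have hinj : Function.Injective φ.symm := by
      intro a b hab
      rw [← φ.right_inv (x := a) (by simp [ht]), hab, φ.right_inv (by simp [ht])]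
    have hfin : (φ.symm ⁻¹' (D : Set S2)).Finite :=
      D.finite_toSet.preimage hinj.injOn
    have h1 := hfin.countable.isPathConnected_compl_of_one_lt_rank (hrank 2 (by norm_num))
    have h2 : ((D : Set S2)ᶜ : Set S2) = φ.symm '' (φ.symm ⁻¹' (D : Set S2))ᶜ := by
      ext x
      constructor
      · intro hx
        have hxs : x ∈ φ.source := by
          rw [hs]
          rintro rfl
          exact hx hv
        refine ⟨φ x, ?_, φ.left_inv hxs⟩
        change φ.symm (φ x) ∉ (D : Set S2)
        rwa [φ.left_inv hxs]
      · rintro ⟨y, hy, rfl⟩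
        exact hy
    rw [h2]
    exact h1.image hcont

/-! ### The set `R(S,D)` -/

/-- `Epi'(π₁(S ∖ D, o), 𝔖₃)`: the surjective homomorphisms to the symmetric group on three letters
that take simple loops to transpositions. -/
def EpiPrime (D : Finset S2) (o : Punctured D) : Type :=
  {ρ : PiOne D o →* Equiv.Perm (Fin 3) //
    Function.Surjective ρ ∧ ∀ c, IsSimpleLoop c → (ρ c).IsSwap}

/-- Two such homomorphisms are equivalent if they are conjugate in `𝔖₃`. -/
instance epiPrimeSetoid (D : Finset S2) (o : Punctured D) : Setoid (EpiPrime D o) where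
  r ρ σ := ∃ s : Equiv.Perm (Fin 3), ∀ g, σ.1 g = s * ρ.1 g * s⁻¹
  iseqv :=
    { refl := fun ρ => ⟨1, fun g => by simp⟩
      symm := by
        rintro ρ σ ⟨s, hs⟩
        exact ⟨s⁻¹, fun g => by rw [hs]; group⟩
      trans := by
        rintro ρ σ τ ⟨s, hs⟩ ⟨t, ht⟩
        exact ⟨t * s, fun g => by rw [ht, hs]; group⟩ }

/-- `R(S,D) = 𝔖₃ \ Epi'(π₁(S ∖ D, o), 𝔖₃)`. -/
def RSet (D : Finset S2) (o : Punctured D) : Type := Quotient (epiPrimeSetoid D o)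

/-- An automorphism `a` that preserves the simple loops takes `ρ` to `ρ ∘ a⁻¹`. -/
def EpiPrime.twist {D : Finset S2} {o : Punctured D} (a : simpleAut D o) (ρ : EpiPrime D o) :
    EpiPrime D o :=
  ⟨ρ.1.comp ((a⁻¹ : simpleAut D o) : MulAut (PiOne D o)).toMonoidHom,
    ρ.2.1.comp ((a⁻¹ : simpleAut D o) : MulAut (PiOne D o)).surjective,
    fun c hc => ρ.2.2 _ (((a⁻¹).2 c).2 hc)⟩

/-- The action on `R(S,D)` of the automorphisms of `π₁(S ∖ D, o)` that preserve the simple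
loops. -/
instance simpleAutActionRSet (D : Finset S2) (o : Punctured D) :
    MulAction (simpleAut D o) (RSet D o) where
  smul a := Quotient.map (EpiPrime.twist a) (by
    rintro ρ σ ⟨s, hs⟩
    exact ⟨s, fun g => hs _⟩)
  one_smul r := by
    induction r using Quotient.ind with | _ ρ =>
    rfl
  mul_smul a b r := by
    induction r using Quotient.ind with | _ ρ =>
    refine congrArg (Quotient.mk _) (Subtype.ext ?_)
    ext1 g
    change ρ.1 ((((a * b)⁻¹ : simpleAut D o) : MulAut (PiOne D o)) g) = _
    rw [mul_inv_rev]
    rfl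

/-- Inner automorphisms act trivially on `R(S,D)`. -/
theorem simpleAut_smul_eq {D : Finset S2} {o : Punctured D} (a a' : simpleAut D o) (b : PiOne D o)
    (h : (a' : MulAut (PiOne D o)) = MulAut.conj b * (a : MulAut (PiOne D o))) (r : RSet D o) :
    a' • r = a • r := by
  induction r using Quotient.ind with | _ ρ =>
  refine Quotient.sound ⟨ρ.1 ((a⁻¹ : simpleAut D o).1 b), fun g => ?_⟩
  have h2 : ∀ g, (a'⁻¹ : simpleAut D o).1 g = (a⁻¹ : simpleAut D o).1 (b⁻¹ * g * b) := by
    intro g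
    change (a'.1)⁻¹ g = (a.1)⁻¹ (b⁻¹ * g * b)
    rw [h, mul_inv_rev, MulAut.mul_apply, MulAut.conj_inv_apply]
  change ρ.1 ((a⁻¹ : simpleAut D o).1 g) = _ * ρ.1 ((a'⁻¹ : simpleAut D o).1 g) * _
  rw [h2]
  simp only [map_mul, map_inv]
  group

/-- The action of `pushAut f p` on `R(S,D)` does not depend on `p`. -/
theorem pushAut_smul_eq {D : Finset S2} {o : Punctured D} (f : DiffPlus D)
    (p q : Path.Homotopic.Quotient o (restr f o)) (r : RSet D o) :
    pushAut f q • r = pushAut f p • r := by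
  obtain ⟨b, hb⟩ := pushAut_eq_conj f p q
  exact simpleAut_smul_eq _ _ b hb r

/-- The homotopy class of some path from `o` to `f(o)`. -/
def somePathClass {D : Finset S2} (o : Punctured D) (f : DiffPlus D) :
    Path.Homotopic.Quotient o (restr f o) :=
  Path.Homotopic.Quotient.mk (PathConnectedSpace.somePath o (restr f o))

/-- The action of `DiffPlus D` on `R(S,D)`: `f` acts through the automorphism of `π₁(S ∖ D, o)`
that it induces together with any path from `o` to `f(o)`. -/
instance diffActionRSet (D : Finset S2) (o : Punctured D) :
    MulAction (DiffPlus D) (RSet D o) where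
  smul f r := pushAut f (somePathClass o f) • r
  one_smul r := by
    obtain ⟨p, hp⟩ := pushAut_of_isotopicToOne (o := o) 1 (one_mem (isotopicToOne D))
    change pushAut 1 (somePathClass o 1) • r = r
    rw [pushAut_smul_eq 1 p, hp, one_smul]
  mul_smul f g r := by
    change pushAut (f * g) (somePathClass o (f * g)) • r =
      pushAut f (somePathClass o f) • pushAut g (somePathClass o g) • r
    rw [← mul_smul, ← pushAut_mul]
    exact pushAut_smul_eq _ _ _ _

theorem diff_smul_def {D : Finset S2} {o : Punctured D} (f : DiffPlus D)
    (p : Path.Homotopic.Quotient o (restr f o)) (r : RSet D o) : f • r = pushAut f p • r :=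
  pushAut_smul_eq f p _ r

theorem isotopicToOne_smul {D : Finset S2} {o : Punctured D} (f : DiffPlus D)
    (hf : f ∈ isotopicToOne D) (r : RSet D o) : f • r = r := by
  obtain ⟨p, hp⟩ := pushAut_of_isotopicToOne (o := o) f hf
  rw [diff_smul_def f p, hp, one_smul]

/-- The action of `Mod(S,D)` on `R(S,D)`, given by `modAction_mk`. -/
instance modActionRSet (D : Finset S2) (o : Punctured D) :
    MulAction (ModGroup D) (RSet D o) :=
  MulAction.compHom (RSet D o)
    (QuotientGroup.lift (isotopicToOne D) (MulAction.toPermHom (DiffPlus D) (RSet D o))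
      (fun f hf => Equiv.ext (isotopicToOne_smul f hf)))

/-- The class of `f` in `Mod(S,D)` acts on `R(S,D)` as the automorphism of `π₁(S ∖ D, o)` that is
induced by `f` and any path from `o` to `f(o)`. -/
theorem modAction_mk {D : Finset S2} {o : Punctured D} (f : DiffPlus D)
    (p : Path.Homotopic.Quotient o (restr f o)) (r : RSet D o) :
    (QuotientGroup.mk f : ModGroup D) • r = pushAut f p • r :=
  diff_smul_def f p r

/-! ### The cyclic cover of degree six and the group `Γ` -/

/-- The subgroup of `π₁(S ∖ D, o)` of the connected `μ₆`-cover of `S ∖ D` for which all simple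
loops have the same monodromy, a generator of `μ₆` (so that the cover is totally ramified over
`D`): the kernel of this monodromy is the normal subgroup generated by the quotients of two simple
loops and the sixth powers of simple loops. It is the fundamental group of the complement in `Σ` of
the twelve ramification points. -/
def coverGroup (D : Finset S2) (o : Punctured D) : Subgroup (PiOne D o) :=
  Subgroup.normalClosure
    ({g | ∃ c c', IsSimpleLoop c ∧ IsSimpleLoop c' ∧ g = c * c'⁻¹} ∪
      {g | ∃ c, IsSimpleLoop c ∧ g = c ^ 6})

instance coverGroup_normal (D : Finset S2) (o : Punctured D) : (coverGroup D o).Normal :=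
  Subgroup.normalClosure_normal

theorem pow_mem_coverGroup {D : Finset S2} {o : Punctured D} {c : PiOne D o}
    (hc : IsSimpleLoop c) : c ^ 6 ∈ coverGroup D o :=
  Subgroup.subset_normalClosure (Or.inr ⟨c, hc, rfl⟩)

theorem simpleAut_mem_coverGroup {D : Finset S2} {o : Punctured D} (a : simpleAut D o)
    {k : PiOne D o} (hk : k ∈ coverGroup D o) : a.1 k ∈ coverGroup D o := by
  have h : coverGroup D o ≤ (coverGroup D o).comap a.1.toMonoidHom := by
    refine Subgroup.normalClosure_le_normal ?_
    rintro g (⟨c, c', hc, hc', rfl⟩ | ⟨c, hc, rfl⟩)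
    · refine Subgroup.subset_normalClosure (Or.inl ⟨a.1 c, a.1 c', (a.2 c).2 hc, (a.2 c').2 hc', ?_⟩)
      exact (map_mul a.1 c c'⁻¹).trans (by rw [map_inv])
    · refine Subgroup.subset_normalClosure (Or.inr ⟨a.1 c, (a.2 c).2 hc, ?_⟩)
      exact map_pow a.1 c 6
  exact h hk

/-- The restriction to the subgroup `coverGroup` of an automorphism that preserves the simple
loops. -/
def restrCover {D : Finset S2} {o : Punctured D} (a : simpleAut D o) :
    Additive (coverGroup D o) →+ Additive (coverGroup D o) :=
  MonoidHom.toAdditive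
    ((a.1.toMonoidHom.comp (coverGroup D o).subtype).codRestrict (coverGroup D o)
      (fun k => simpleAut_mem_coverGroup a k.2))

/-- Conjugation of an element of the normal subgroup `coverGroup` by an element of
`π₁(S ∖ D, o)`. -/
def conjCover {D : Finset S2} {o : Punctured D} (c : PiOne D o) (k : coverGroup D o) :
    coverGroup D o :=
  ⟨c * k * c⁻¹, (coverGroup_normal D o).conj_mem k k.2 c⟩

/-- The primitive sixth root of unity `τ = exp(π √-1 / 3)`. -/
def tau : ℂ := Complex.exp (Real.pi / 3 * Complex.I)

/-- The space `H¹(Σ; ℂ)_χ`. A class in `H¹(Σ; ℂ)` is a homomorphism to `ℂ` from the fundamental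
group of `Σ` minus the ramification points that vanishes on the loops around these points (which
are the sixth powers of the simple loops). It lies in the `χ`-eigenspace if the generator of the
covering group `μ₆` (which acts by conjugation with a simple loop) multiplies it by `τ`. -/
def H1chi (D : Finset S2) (o : Punctured D) : Submodule ℂ (Additive (coverGroup D o) →+ ℂ) where
  carrier := {φ |
    (∀ (c : PiOne D o) (hc : IsSimpleLoop c),
      φ (Additive.ofMul ⟨c ^ 6, pow_mem_coverGroup hc⟩) = 0) ∧
    ∀ c : PiOne D o, IsSimpleLoop c → ∀ k : coverGroup D o,
      φ (Additive.ofMul (conjCover c k)) = tau * φ (Additive.ofMul k)}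
  zero_mem' := ⟨fun _ _ => rfl, fun _ _ _ => by simp⟩
  add_mem' := by
    rintro φ ψ ⟨h1, h2⟩ ⟨h3, h4⟩
    refine ⟨fun c hc => ?_, fun c hc k => ?_⟩
    · rw [AddMonoidHom.add_apply, h1 c hc, h3 c hc, add_zero]
    · rw [AddMonoidHom.add_apply, AddMonoidHom.add_apply, h2 c hc, h4 c hc, mul_add]
  smul_mem' := by
    rintro z φ ⟨h1, h2⟩
    refine ⟨fun c hc => ?_, fun c hc k => ?_⟩
    · rw [AddMonoidHom.smul_apply, h1 c hc, smul_zero]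
    · rw [AddMonoidHom.smul_apply, AddMonoidHom.smul_apply, h2 c hc, smul_eq_mul, smul_eq_mul,
        mul_left_comm]

/-- The linear action on `H¹(Σ; ℂ)_χ` of the automorphisms of `π₁(S ∖ D, o)` that preserve the
simple loops: `a` takes `φ` to `φ ∘ a⁻¹`. It induces an action on the projective space
`ℙ(H¹(Σ; ℂ)_χ)`. -/
instance simpleAutActionH1chi (D : Finset S2) (o : Punctured D) :
    DistribMulAction (simpleAut D o) (H1chi D o) where
  smul a φ := ⟨φ.1.comp (restrCover a⁻¹), by
    refine ⟨fun c hc => ?_, fun c hc k => ?_⟩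
    · have h := φ.2.1 _ (((a⁻¹).2 c).2 hc)
      refine Eq.trans (congrArg φ.1 ?_) h
      exact congrArg Additive.ofMul (Subtype.ext (map_pow (a⁻¹ : simpleAut D o).1 c 6))
    · have h := φ.2.2 _ (((a⁻¹).2 c).2 hc)
        ⟨(a⁻¹ : simpleAut D o).1 k, simpleAut_mem_coverGroup a⁻¹ k.2⟩
      refine Eq.trans (congrArg φ.1 ?_) h
      refine congrArg Additive.ofMul (Subtype.ext ?_)
      change (a⁻¹ : simpleAut D o).1 (c * k * c⁻¹) = _
      rw [map_mul, map_mul, map_inv]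
      rfl⟩
  one_smul φ := by
    refine Subtype.ext (AddMonoidHom.ext fun k => congrArg φ.1 ?_)
    exact congrArg Additive.ofMul (Subtype.ext rfl)
  mul_smul a b φ := by
    refine Subtype.ext (AddMonoidHom.ext fun k => congrArg φ.1 ?_)
    refine congrArg Additive.ofMul (Subtype.ext ?_)
    change ((a * b)⁻¹ : simpleAut D o).1 _ = _
    rw [mul_inv_rev]
    rfl
  smul_zero _ := rfl
  smul_add _ _ _ := rfl

instance simpleAutActionH1chi_comm (D : Finset S2) (o : Punctured D) :
    SMulCommClass (simpleAut D o) ℂ (H1chi D o) where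
  smul_comm _ _ _ := rfl

/-- The group `Γ` of all transformations of the projective space `ℙ(S,D) = ℙ(H¹(Σ; ℂ)_χ)` that
are induced by orientation preserving diffeomorphisms of `S` that preserve `D`. -/
def Gamma (D : Finset S2) (o : Punctured D) : Subgroup (Equiv.Perm (ℙ ℂ (H1chi D o))) where
  carrier := {σ | ∃ (f : DiffPlus D) (p : Path.Homotopic.Quotient o (restr f o)),
    σ = MulAction.toPermHom (simpleAut D o) (ℙ ℂ (H1chi D o)) (pushAut f p)}
  one_mem' := by
    obtain ⟨p, hp⟩ := pushAut_of_isotopicToOne (o := o) 1 (one_mem (isotopicToOne D))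
    exact ⟨1, p, by rw [hp, map_one]⟩
  mul_mem' := by
    rintro _ _ ⟨f, p, rfl⟩ ⟨g, q, rfl⟩
    exact ⟨f * g, p.trans (q.map (restr f)), by rw [pushAut_mul, map_mul]⟩
  inv_mem' := by
    rintro _ ⟨f, p, rfl⟩
    obtain ⟨q, hq⟩ := pushAut_inv f p
    exact ⟨f⁻¹, q, by rw [← hq, map_inv]⟩

end

/-! Put one marked point at infinity and the others at 0, ..., 10. The fundamental group is then
free on simple loops c_0, ..., c_10 around the finite points, and every simple loop around the last
point is conjugate to the inverse of their product. The transpositions of three letters are the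
reflections x ↦ u - x of 𝔽₃, so a homomorphism in `EpiPrime` amounts to a sequence of eleven
elements u_k of 𝔽₃: the loop at infinity goes to a transposition by parity, and surjectivity means
that the sequence is not constant. This gives 3^11 - 3 homomorphisms; since 𝔖₃ has trivial centre it
acts freely on them by conjugation, whence the quotient by 6 (`card_epiPrime`, `card_RSet`).

Transitivity: the half-turn that exchanges k and k + 1 induces the Hurwitz move (a, b) ↦ (b, b⁻¹ a
b), which in terms of sequences is (a, b) ↦ (b, -a - b). Such moves bring every non-constant
sequence of odd length into the form v, v + 1, ..., v + 1 (`Hurwitz.exists_normal`), and these forms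
are conjugate under 𝔖₃.

Cubes: by the easy half of van Kampen's theorem it suffices to look at loops in the disc of the
half-turn and at loops where the half-turn is the identity. In the disc the claim is a relation
between two transpositions (`swap_relation`, `halfTurn_cube`).

Factorization through Γ: an automorphism a that is trivial on the projective space acts on the
χ-eigenspace by a scalar z. For any Eisenstein integers u_k the maps x ↦ ζ x + u_k define an affine
action of the fundamental group on the Eisenstein integers, and its translation parts on
`coverGroup` form a class in `H1chi`. A class with a value 1 shows that z and z⁻¹ are Eisenstein
integers, so z is a unit. Modulo the prime above three, ζ becomes -1 and the affine action becomes
the given homomorphism ρ. Hence ρ ∘ a⁻¹ has the parameters e u_k + t with e the residue of z, and as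
𝔖₃ is the full affine group of 𝔽₃, it is conjugate to ρ (`smul_eq_of_scalar`).

The topological input is collected in `HurwitzGenerators`. Generation comes from subdividing loops
with respect to two slit planes, freeness from the monodromy of explicit coverings, and the effect
of a half-turn from the way the image of a loop crosses the real line. -/

/-! ### Homotopy classes of paths -/

namespace PathClass

open Path

variable {X Y : Type} [TopologicalSpace X] [TopologicalSpace Y]

/-- The class of the paths in a simply connected subspace. -/
noncomputable def within (U : Set X) [SimplyConnectedSpace U] {x y : X} (hx : x ∈ U) (hy : y ∈ U) :
    Homotopic.Quotient x y :=
  (Homotopic.Quotient.mk (PathConnectedSpace.somePath (⟨x, hx⟩ : U) ⟨y, hy⟩)).map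
    ⟨Subtype.val, continuous_subtype_val⟩

/-- This is how concrete paths enter: in a simply connected piece only the end points matter, so a
class is determined by the pieces that it traverses. -/
theorem mk_eq_within (U : Set X) [SimplyConnectedSpace U] {x y : X} (hx : x ∈ U) (hy : y ∈ U)
    (γ : Path x y) (h : ∀ t, γ t ∈ U) : Homotopic.Quotient.mk γ = within U hx hy := by
  let γ' : Path (⟨x, hx⟩ : U) ⟨y, hy⟩ :=
    { toFun := fun t => ⟨γ t, h t⟩
      continuous_toFun := by fun_prop
      source' := by simp
      target' := by simp }
  have h1 : γ = γ'.map continuous_subtype_val := by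
    ext t
    rfl
  rw [h1, within]
  exact congrArg (fun q => Homotopic.Quotient.map q ⟨Subtype.val, continuous_subtype_val⟩)
    (Subsingleton.elim (Homotopic.Quotient.mk γ') _)

theorem exists_mk_eq_within (U : Set X) [SimplyConnectedSpace U] {x y : X} (hx : x ∈ U)
    (hy : y ∈ U) : ∃ γ : Path x y, (∀ t, γ t ∈ U) ∧ Homotopic.Quotient.mk γ = within U hx hy :=
  ⟨(PathConnectedSpace.somePath (⟨x, hx⟩ : U) ⟨y, hy⟩).map continuous_subtype_val,
    fun t => ((PathConnectedSpace.somePath (⟨x, hx⟩ : U) ⟨y, hy⟩) t).2, rfl⟩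

theorem within_trans (U : Set X) [SimplyConnectedSpace U] {x y z : X} (hx : x ∈ U) (hy : y ∈ U)
    (hz : z ∈ U) : (within U hx hy).trans (within U hy hz) = within U hx hz := by
  rw [within, within, ← map_trans]
  exact congrArg (fun q => Homotopic.Quotient.map q ⟨Subtype.val, continuous_subtype_val⟩)
    (Subsingleton.elim _ _)

theorem within_trans_assoc (U : Set X) [SimplyConnectedSpace U] {x y z w : X} (hx : x ∈ U)
    (hy : y ∈ U) (hz : z ∈ U) (q : Homotopic.Quotient z w) :
    (within U hx hy).trans ((within U hy hz).trans q) = (within U hx hz).trans q := by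
  rw [← Homotopic.Quotient.trans_assoc, within_trans]

theorem within_self (U : Set X) [SimplyConnectedSpace U] {x : X} (hx hx' : x ∈ U) :
    within U hx hx' = Homotopic.Quotient.refl x := by
  rw [← mk_eq_within U hx hx' (Path.refl x) (fun _ => hx)]
  rfl

theorem within_symm (U : Set X) [SimplyConnectedSpace U] {x y : X} (hx : x ∈ U) (hy : y ∈ U) :
    (within U hx hy).symm = within U hy hx := by
  obtain ⟨γ, hγ, h⟩ := exists_mk_eq_within U hx hy
  rw [← h, ← Homotopic.Quotient.mk_symm]
  exact mk_eq_within U hy hx γ.symm (fun t => hγ _)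

/-- Loops are generated by any subgroup that contains, with respect to a system of classes of paths
from the base point to the points of the members of an open cover, the paths in each of these
members and the changes from one member to another. -/
theorem mem_of_cover {ι : Type} {x₀ : X} (U : ι → Set X) (hU : ∀ i, IsOpen (U i))
    (hcov : ∀ x, ∃ i, x ∈ U i) (H : Subgroup (FundamentalGroup X x₀))
    (r : ∀ i (x : X), x ∈ U i → Homotopic.Quotient x₀ x)
    (h₀ : ∃ i, ∃ h : x₀ ∈ U i, (show FundamentalGroup X x₀ from r i x₀ h) ∈ H)
    (h₁ : ∀ i x y (hx : x ∈ U i) (hy : y ∈ U i) (γ : Path x y), (∀ t, γ t ∈ U i) →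
      (show FundamentalGroup X x₀ from
        (r i x hx).trans ((Homotopic.Quotient.mk γ).trans (r i y hy).symm)) ∈ H)
    (h₂ : ∀ i j x (hi : x ∈ U i) (hj : x ∈ U j),
      (show FundamentalGroup X x₀ from (r i x hi).trans (r j x hj).symm) ∈ H) : H = ⊤ := by
  have key : ∀ (γ : Path x₀ x₀) (i : ι) (hi : x₀ ∈ U i),
      (show FundamentalGroup X x₀ from
        (r i x₀ hi).trans ((Homotopic.Quotient.mk γ).trans (r i x₀ hi).symm)) ∈ H := by
    intro γ i hi
    have hc : ∀ k, IsOpen (γ ⁻¹' (U k)) := fun k => (hU k).preimage γ.continuous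
    have hc' : Set.univ ⊆ ⋃ k, γ ⁻¹' (U k) := fun s _ => by
      obtain ⟨k, hk⟩ := hcov (γ s)
      exact Set.mem_iUnion.2 ⟨k, hk⟩
    -- Lebesgue: a monotone subdivision of the interval, eventually constant, each of whose pieces
    -- lies in one member. The word is assembled along it with `h₁` for each piece and `h₂` for each
    -- change of member.
    obtain ⟨t, ht0, hmono, ⟨N, hN⟩, hsub⟩ :=
      exists_monotone_Icc_subset_open_cover_unitInterval hc hc'
    have hstep : ∀ m, ∀ k (hk : γ (t m) ∈ U k) l (hl : γ (t 0) ∈ U l),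
        (show FundamentalGroup X x₀ from
          (r l _ hl).trans ((Homotopic.Quotient.mk (γ.subpath (t 0) (t m))).trans (r k _ hk).symm)) ∈ H := by
      intro m
      induction m with
      | zero =>
        intro k hk l hl
        rw [Path.subpath_self]
        refine Set.mem_of_eq_of_mem ?_ (h₂ l k _ hl hk)
        rw [Homotopic.Quotient.mk_refl, Homotopic.Quotient.refl_trans]
      | succ m ih =>
        intro k hk l hl
        obtain ⟨s, hs⟩ := hsub m
        have hm : γ (t m) ∈ U s := hs ⟨le_rfl, hmono (Nat.le_succ m)⟩
        have hm' : γ (t (m + 1)) ∈ U s := hs ⟨hmono (Nat.le_succ m), le_rfl⟩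
        have e1 := ih s hm l hl
        have e2 := h₁ s _ _ hm hm' (γ.subpath (t m) (t (m + 1))) (fun u => by
          have : γ.subpath (t m) (t (m + 1)) u ∈ Set.range (γ.subpath (t m) (t (m + 1))) := ⟨u, rfl⟩
          rw [Path.range_subpath_of_le _ _ _ (hmono (Nat.le_succ m))] at this
          obtain ⟨v, hv, hv'⟩ := this
          rw [← hv']
          exact hs hv)
        have e3 := h₂ s k _ hm' hk
        have e4 := H.mul_mem e3 (H.mul_mem e2 e1)
        have e5 : Homotopic.Quotient.mk (γ.subpath (t 0) (t (m + 1))) =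
            (Homotopic.Quotient.mk (γ.subpath (t 0) (t m))).trans
              (Homotopic.Quotient.mk (γ.subpath (t m) (t (m + 1)))) := by
          rw [← Homotopic.Quotient.mk_trans]
          exact (Homotopic.Quotient.eq.2 ⟨Path.Homotopy.subpathTransSubpath γ _ _ _⟩).symm
        refine Set.mem_of_eq_of_mem ?_ e4
        simp only [FundamentalGroup.mul_def, e5, Homotopic.Quotient.trans_assoc, symm_trans_cancel]
    have h0 : γ (t 0) = x₀ := by rw [ht0]; exact γ.source
    have hN' : γ (t N) = x₀ := by rw [hN N le_rfl]; exact γ.target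
    have e := hstep N i (by rw [hN']; exact hi) i (by rw [h0]; exact hi)
    -- The values of `γ` at the subdivision points equal `x₀` only propositionally; the end points
    -- are generalized so that they can be substituted.
    have gen : ∀ (s u : unitInterval) (hs : s = 0) (hu : u = 1) (h1 : γ s ∈ U i) (h2 : γ u ∈ U i),
        (show FundamentalGroup X x₀ from
          (r i _ h1).trans ((Homotopic.Quotient.mk (γ.subpath s u)).trans (r i _ h2).symm)) =
        (show FundamentalGroup X x₀ from
          (r i x₀ hi).trans ((Homotopic.Quotient.mk γ).trans (r i x₀ hi).symm)) := by
      rintro s u rfl rfl h1 h2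
      rw [Path.subpath_zero_one]
      have : ∀ (a b : X) (ha : a = x₀) (hb : b = x₀) (h1 : a ∈ U i) (h2 : b ∈ U i),
          (show FundamentalGroup X x₀ from
            (r i a h1).trans ((Homotopic.Quotient.mk (γ.cast ha hb)).trans (r i b h2).symm)) =
          (show FundamentalGroup X x₀ from
            (r i x₀ hi).trans ((Homotopic.Quotient.mk γ).trans (r i x₀ hi).symm)) := by
        rintro a b rfl rfl h1 h2
        rfl
      exact this _ _ γ.source γ.target h1 h2
    rw [← gen _ _ ht0 (hN N le_rfl) (by rw [h0]; exact hi) (by rw [hN']; exact hi)]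
    exact e
  obtain ⟨i, hi, hr⟩ := h₀
  refine eq_top_iff.2 fun g _ => ?_
  obtain ⟨γ, rfl⟩ := Homotopic.Quotient.mk_surjective g
  -- Conjugation by the class from `h₀` removes the detour along `r` at both ends.
  have e := H.mul_mem hr (H.mul_mem (key γ i hi) (H.inv_mem hr))
  refine Set.mem_of_eq_of_mem ?_ e
  simp only [FundamentalGroup.mul_def, FundamentalGroup.inv_def, Homotopic.Quotient.trans_assoc,
    symm_trans_cancel]
  rw [Homotopic.Quotient.symm_trans, Homotopic.Quotient.trans_refl]

/-- The easy half of van Kampen's theorem: loops in the members generate. -/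
theorem eq_top_of_union {x₀ : X} {U V : Set X} (hU : IsOpen U) (hV : IsOpen V)
    (hUV : U ∪ V = Set.univ) (hx : x₀ ∈ U ∩ V) (pU : IsPathConnected U) (pV : IsPathConnected V)
    (pUV : IsPathConnected (U ∩ V)) (H : Subgroup (FundamentalGroup X x₀))
    (H₁ : ∀ γ : Path x₀ x₀, (∀ t, γ t ∈ U) → (show FundamentalGroup X x₀ from Homotopic.Quotient.mk γ) ∈ H)
    (H₂ : ∀ γ : Path x₀ x₀, (∀ t, γ t ∈ V) → (show FundamentalGroup X x₀ from Homotopic.Quotient.mk γ) ∈ H) :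
    H = ⊤ := by
  let W : Bool → Set X := fun i => bif i then U else V
  have pW : ∀ i, IsPathConnected (W i) := by rintro (_ | _) <;> assumption
  have hW : ∀ i, x₀ ∈ W i := by rintro (_ | _); exacts [hx.2, hx.1]
  have HW : ∀ i, ∀ γ : Path x₀ x₀, (∀ t, γ t ∈ W i) →
      (show FundamentalGroup X x₀ from Homotopic.Quotient.mk γ) ∈ H := by
    rintro (_ | _) <;> assumption
  have hUV' : ∀ i j, ∀ x ∈ W i ∩ W j, ∃ γ : Path x₀ x, ∀ t, γ t ∈ W i ∩ W j := by
    rintro (_ | _) (_ | _) x ⟨h1, h2⟩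
    · obtain ⟨γ, hγ⟩ := (pW false).joinedIn _ (hW _) x h1
      exact ⟨γ, fun t => ⟨hγ t, hγ t⟩⟩
    · obtain ⟨γ, hγ⟩ := pUV.joinedIn _ hx x ⟨h2, h1⟩
      exact ⟨γ, fun t => (hγ t).symm⟩
    · exact pUV.joinedIn _ hx x ⟨h1, h2⟩ |>.imp fun γ h => h
    · obtain ⟨γ, hγ⟩ := (pW true).joinedIn _ (hW _) x h1
      exact ⟨γ, fun t => ⟨hγ t, hγ t⟩⟩
  have hp : ∀ i x, x ∈ W i → ∃ γ : Path x₀ x, ∀ t, γ t ∈ W i := fun i x h =>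
    ((pW i).joinedIn _ (hW i) x h)
  choose p hp using hp
  have trans_mem : ∀ (S : Set X) {a b c : X} (α : Path a b) (β : Path b c), (∀ t, α t ∈ S) →
      (∀ t, β t ∈ S) → ∀ t, (α.trans β) t ∈ S := by
    intro S a b c α β ha hb t
    have : (α.trans β) t ∈ Set.range (α.trans β) := ⟨t, rfl⟩
    rw [Path.trans_range] at this
    rcases this with ⟨s, hs⟩ | ⟨s, hs⟩
    · rw [← hs]; exact ha s
    · rw [← hs]; exact hb s
  refine mem_of_cover W ?_ ?_ H (fun i x h => Homotopic.Quotient.mk (p i x h)) ⟨true, hx.1, ?_⟩ ?_ ?_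
  · rintro (_ | _) <;> assumption
  · intro x
    have : x ∈ U ∪ V := hUV ▸ Set.mem_univ x
    rcases this with h | h
    exacts [⟨true, h⟩, ⟨false, h⟩]
  · exact HW true _ (hp _ _ _)
  · intro i x y hx hy γ hγ
    rw [← Homotopic.Quotient.mk_symm, ← Homotopic.Quotient.mk_trans, ← Homotopic.Quotient.mk_trans]
    exact HW i _ (trans_mem _ _ _ (hp _ _ _) (trans_mem _ _ _ hγ fun t => hp _ _ _ _))
  · intro i j x hi hj
    -- Connectedness of the intersection is used here: inserting `δ` splits the change of member
    -- into one loop in each of them.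
    obtain ⟨δ, hδ⟩ := hUV' i j x ⟨hi, hj⟩
    have e1 := HW i ((p i x hi).trans δ.symm) (trans_mem _ _ _ (hp _ _ _) fun t => (hδ _).1)
    have e2 := HW j (δ.trans (p j x hj).symm) (trans_mem _ _ _ (fun t => (hδ t).2) fun t => hp _ _ _ _)
    refine Set.mem_of_eq_of_mem ?_ (H.mul_mem e2 e1)
    rw [FundamentalGroup.mul_def]
    simp only [Homotopic.Quotient.mk_trans, Homotopic.Quotient.mk_symm, Homotopic.Quotient.trans_assoc, symm_trans_cancel]

end PathClass

/-! ### The plane minus finitely many integers -/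

/-- The plane without the points `0, ..., n - 1`. -/
abbrev Plane (n : ℕ) : Type := {z : ℂ // ∀ k : ℕ, k < n → z ≠ k}

namespace Plane

open Path PathClass

/-- The sign of the imaginary part in the upper (`true`) and lower (`false`) half plane. -/
noncomputable def sgn (b : Bool) : ℝ := bif b then 1 else -1

theorem sgn_mul_self (b : Bool) : sgn b * sgn b = 1 := by cases b <;> norm_num [sgn]

/-- The complement of the vertical rays from the points `0, ..., n - 1` downward (`true`) or upward
(`false`). -/
def slit (n : ℕ) (b : Bool) : Set ℂ := {z | ∀ k : ℕ, k < n → z.re = k → 0 < sgn b * z.im}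

theorem slit_ne {n : ℕ} {b : Bool} {z : ℂ} (hz : z ∈ slit n b) (k : ℕ) (hk : k < n) : z ≠ k := by
  rintro rfl
  simpa using hz k hk (by simp)

/-- The complement of the vertical rays, as a subset of the punctured plane. -/
def half (n : ℕ) (b : Bool) : Set (Plane n) := {z | (z : ℂ) ∈ slit n b}

theorem mem_slit_of_pos {n : ℕ} {b : Bool} {z : ℂ} (h : 0 < sgn b * z.im) : z ∈ slit n b :=
  fun _ _ _ => h

/-- On the real line the punctures are missing, so the weak inequality suffices. Curves may
therefore touch the real line without leaving the slit plane. -/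
theorem mem_half_of_nonneg {n : ℕ} {b : Bool} {z : Plane n} (h : 0 ≤ sgn b * (z : ℂ).im) :
    z ∈ half n b := by
  intro k hk hz
  refine lt_of_le_of_ne h fun h0 => z.2 k hk (Complex.ext (by simpa using hz) ?_)
  have : sgn b ≠ 0 := by cases b <;> norm_num [sgn]
  rcases mul_eq_zero.1 h0.symm with h | h
  · exact absurd h this
  · simpa using h

theorem mem_half_of_re {n : ℕ} {b : Bool} {z : Plane n} (h : ∀ k : ℕ, k < n → (z : ℂ).re ≠ k) :
    z ∈ half n b := fun k hk hz => absurd hz (h k hk)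

theorem isOpen_half (n : ℕ) (b : Bool) : IsOpen (half n b) := by
  have h : half n b = ⋂ k ∈ Finset.range n,
      ({z : Plane n | (z : ℂ).re ≠ k} ∪ {z : Plane n | 0 < sgn b * (z : ℂ).im}) := by
    ext z
    simp only [half, slit, Set.mem_ofPred_eq, Finset.mem_range, Set.mem_iInter, Set.mem_union]
    exact forall₂_congr fun k hk => by tauto
  rw [h]
  refine isOpen_biInter_finset fun k _ => IsOpen.union ?_ ?_
  · exact isOpen_ne_fun (by fun_prop) (by fun_prop)
  · exact isOpen_lt (by fun_prop) (by fun_prop)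

theorem exists_mem_half {n : ℕ} (z : Plane n) : ∃ b, z ∈ half n b := by
  rcases le_total 0 (z : ℂ).im with h | h
  · exact ⟨true, mem_half_of_nonneg (by simpa [sgn] using h)⟩
  · exact ⟨false, mem_half_of_nonneg (by simpa [sgn] using h)⟩

/-- Two stages: push every point vertically to height |im| + 1 on the side away from the rays, which
meets no ray, and then contract inside the open half plane to i or -i. -/
instance contractible_half (n : ℕ) (b : Bool) : ContractibleSpace (half n b) := by
  have hb : sgn b * sgn b = 1 := sgn_mul_self b
  rw [contractible_iff_id_nullhomotopic]
  have mk : ∀ G : unitInterval × half n b → ℂ, Continuous G → (∀ q, G q ∈ slit n b) →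
      ∃ G' : C(unitInterval × half n b, half n b), ∀ q, ((G' q : Plane n) : ℂ) = G q :=
    fun G hG h => ⟨⟨fun q => ⟨⟨G q, slit_ne (h q)⟩, h q⟩,
      Continuous.subtype_mk (Continuous.subtype_mk hG _) _⟩, fun _ => rfl⟩
  have pt : (⟨sgn b * Complex.I, slit_ne (b := b) (mem_slit_of_pos (by simp [hb]))⟩ : Plane n)
      ∈ half n b := mem_slit_of_pos (by simp [hb])
  obtain ⟨F, hF⟩ := mk (fun q => ⟨((q.2 : Plane n) : ℂ).re, ((q.2 : Plane n) : ℂ).im +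
      q.1 * (sgn b * (|((q.2 : Plane n) : ℂ).im| + 1) - ((q.2 : Plane n) : ℂ).im)⟩) (by
    exact Complex.equivRealProdCLM.symm.continuous.comp (Continuous.prodMk (by fun_prop)
      (by fun_prop))) (by
    rintro ⟨t, z⟩ k hk hz
    have h1 := z.2 k hk hz
    have ht0 := t.2.1
    have ht1 := t.2.2
    have h2 : (1 : ℝ) * ((z : Plane n) : ℂ).im ≤ |((z : Plane n) : ℂ).im| := by
      rw [one_mul]; exact le_abs_self _
    have h4 : 0 ≤ |((z : Plane n) : ℂ).im| := abs_nonneg _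
    dsimp only
    have e : sgn b * (((z : Plane n) : ℂ).im +
      t * (sgn b * (|((z : Plane n) : ℂ).im| + 1) - ((z : Plane n) : ℂ).im)) =
      (1 - t) * (sgn b * ((z : Plane n) : ℂ).im) + t * (|((z : Plane n) : ℂ).im| + 1) := by
      linear_combination (t : ℝ) * (|((z : Plane n) : ℂ).im| + 1) * hb
    rw [e]
    rcases eq_or_lt_of_le ht0 with h | h
    · rw [← h]; simpa using h1
    · have := mul_nonneg (sub_nonneg.2 ht1) h1.le
      have := mul_pos h (by linarith : 0 < |((z : Plane n) : ℂ).im| + 1)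
      linarith)
  obtain ⟨G, hG⟩ := mk (fun q => ⟨(1 - q.1) * ((q.2 : Plane n) : ℂ).re,
      sgn b * ((1 - q.1) * (|((q.2 : Plane n) : ℂ).im| + 1) + q.1)⟩) (by
    exact Complex.equivRealProdCLM.symm.continuous.comp (Continuous.prodMk (by fun_prop)
      (by fun_prop))) (by
    rintro ⟨t, z⟩
    have ht0 := t.2.1
    have ht1 := t.2.2
    have h4 : 0 ≤ |((z : Plane n) : ℂ).im| := abs_nonneg _
    refine mem_slit_of_pos ?_
    dsimp only
    rw [← mul_assoc, hb, one_mul]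
    rcases eq_or_lt_of_le ht1 with h | h
    · rw [h]; norm_num
    · have := mul_pos (sub_pos.2 h) (by linarith : 0 < |((z : Plane n) : ℂ).im| + 1)
      linarith)
  refine ⟨⟨_, pt⟩, ContinuousMap.Homotopic.trans (g := ⟨fun z => F (1, z), by fun_prop⟩) ?_ ?_⟩
  · refine ⟨⟨F, fun z => ?_, fun z => rfl⟩⟩
    refine Subtype.ext (Subtype.ext ?_)
    change ((F (0, z) : Plane n) : ℂ) = _
    rw [hF]
    simp
  · refine ⟨⟨G, fun z => ?_, fun z => ?_⟩⟩
    · refine Subtype.ext (Subtype.ext ?_)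
      change ((G (0, z) : Plane n) : ℂ) = ((F (1, z) : Plane n) : ℂ)
      rw [hF, hG]
      simp
    · refine Subtype.ext (Subtype.ext ?_)
      change ((G (1, z) : Plane n) : ℂ) = sgn b * Complex.I
      rw [hG]
      apply Complex.ext <;> simp

/-- The class of the paths in the complement of the downward or upward rays. -/
noncomputable abbrev arc {n : ℕ} (b : Bool) {x y : Plane n} (hx : x ∈ half n b) (hy : y ∈ half n b) :
    Homotopic.Quotient x y := within (half n b) hx hy

theorem arc_congr {n : ℕ} {x y : Plane n} (γ : Path x y) (h : ∀ b t, γ t ∈ half n b) (b b' : Bool)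
    (hx : x ∈ half n b) (hy : y ∈ half n b) (hx' : x ∈ half n b') (hy' : y ∈ half n b') :
    arc b hx hy = arc b' hx' hy' :=
  (mk_eq_within _ hx hy γ (h b)).symm.trans (mk_eq_within _ hx' hy' γ (h b'))

/-- `x` lies in the vertical strip number `k`. -/
def InStrip {n : ℕ} (k : ℕ) (x : Plane n) : Prop :=
  ∀ j : ℕ, j < n → (j < k ∧ (j : ℝ) < (x : ℂ).re) ∨ (k ≤ j ∧ (x : ℂ).re < j)

theorem InStrip.mem {n k : ℕ} {x : Plane n} (h : InStrip k x) (b : Bool) : x ∈ half n b :=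
  mem_half_of_re fun j hj => by rcases h j hj with h | h; exacts [h.2.ne', h.2.ne]

theorem InStrip.exists_path {n k : ℕ} {x y : Plane n} (hx : InStrip k x) (hy : InStrip k y) :
    ∃ γ : Path x y, ∀ b t, γ t ∈ half n b := by
  have key : ∀ t : unitInterval, ∀ j : ℕ, j < n →
      ((1 - (t : ℝ)) * (x : ℂ) + (t : ℝ) * (y : ℂ)).re ≠ j := by
    intro t j hj
    have ht0 := t.2.1
    have ht1 := t.2.2
    have e : ((1 - (t : ℝ)) * (x : ℂ) + (t : ℝ) * (y : ℂ)).re =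
      (1 - (t : ℝ)) * (x : ℂ).re + (t : ℝ) * (y : ℂ).re := by simp
    rw [e]
    rcases hx j hj with h1 | h1 <;> rcases hy j hj with h2 | h2
    · rcases eq_or_lt_of_le ht0 with h | h
      · rw [← h]; simpa using h1.2.ne'
      · nlinarith [mul_nonneg (sub_nonneg.2 ht1) (sub_pos.2 h1.2).le, mul_pos h (sub_pos.2 h2.2)]
    · omega
    · omega
    · rcases eq_or_lt_of_le ht0 with h | h
      · rw [← h]; simpa using h1.2.ne
      · nlinarith [mul_nonneg (sub_nonneg.2 ht1) (sub_pos.2 h1.2).le, mul_pos h (sub_pos.2 h2.2)]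
  refine ⟨⟨⟨fun t => ⟨(1 - (t : ℝ)) * (x : ℂ) + (t : ℝ) * (y : ℂ), fun j hj h =>
    key t j hj (by rw [h]; simp)⟩, Continuous.subtype_mk (by fun_prop) _⟩, ?_, ?_⟩, fun b t => ?_⟩
  · exact Subtype.ext (by simp)
  · exact Subtype.ext (by simp)
  · exact mem_half_of_re (key t)

/-- The point with real part `k - 1 / 2` and imaginary part `y`. -/
noncomputable def pt (n k : ℕ) (y : ℝ) : Plane n := ⟨⟨k - 1 / 2, y⟩, fun j _ h => by
  have h1 : (k - 1 / 2 : ℝ) = j := congrArg Complex.re h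
  have h2 : (2 * k : ℝ) = 2 * j + 1 := by linarith
  have h3 : 2 * k = 2 * j + 1 := by exact_mod_cast h2
  omega⟩

theorem pt_inStrip (n k : ℕ) (y : ℝ) : InStrip k (pt n k y) := by
  intro j _
  rcases lt_or_ge j k with h | h
  · left
    have : (j : ℝ) + 1 ≤ k := by exact_mod_cast h
    refine ⟨h, ?_⟩
    change (j : ℝ) < k - 1 / 2
    linarith
  · right
    have : (k : ℝ) ≤ j := by exact_mod_cast h
    refine ⟨h, ?_⟩
    change (k - 1 / 2 : ℝ) < j
    linarith

/-- The base point of the punctured plane. -/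
noncomputable abbrev base (n : ℕ) : Plane n := pt n 0 (sgn false * 2)

theorem base_mem (n : ℕ) : base n ∈ half n false := (pt_inStrip n 0 _).mem _

/-- The point of the real line half a unit to the left of `k`. -/
noncomputable abbrev gap (n k : ℕ) : Plane n := pt n k 0

theorem gap_inStrip (n k : ℕ) : InStrip k (gap n k) := pt_inStrip n k 0

theorem gap_mem (n k : ℕ) (b : Bool) : gap n k ∈ half n b := (gap_inStrip n k).mem b

/-- The class of the path from the base point to a point of a slit plane that crosses the real line,
if at all, in the strip number `0`. -/
noncomputable def toPoint {n : ℕ} (b : Bool) {x : Plane n} (hx : x ∈ half n b) :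
    Homotopic.Quotient (base n) x :=
  (arc false (base_mem n) (gap_mem n 0 false)).trans (arc b (gap_mem n 0 b) hx)

/-- The loop that passes upward through the strip number `k` and returns through the strip number
`0`. -/
noncomputable def loop (n k : ℕ) : FundamentalGroup (Plane n) (base n) :=
  (toPoint false (gap_mem n k false)).trans (toPoint true (gap_mem n k true)).symm

theorem toPoint_trans {n : ℕ} (b : Bool) {x y : Plane n} (hx : x ∈ half n b) (hy : y ∈ half n b) :
    (toPoint b hx).trans (arc b hx hy) = toPoint b hy := by
  rw [toPoint, Homotopic.Quotient.trans_assoc, within_trans]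
  rfl

theorem toPoint_false {n : ℕ} {x : Plane n} (hx : x ∈ half n false) :
    toPoint false hx = arc false (base_mem n) hx := within_trans _ _ _ _

theorem arc_eq {n : ℕ} (b : Bool) {x y : Plane n} (hx : x ∈ half n b) (hy : y ∈ half n b) :
    arc b hx hy = (toPoint b hx).symm.trans (toPoint b hy) := by
  rw [← toPoint_trans b hx hy, symm_trans_cancel]

/-- A segment between two points of a strip lies in both slit planes, so moving the crossing point
inside its strip changes both halves of the loop by the same class. -/
theorem loop_eq {n k : ℕ} {x : Plane n} (hx : InStrip k x) :
    loop n k = (toPoint false (hx.mem false)).trans (toPoint true (hx.mem true)).symm := by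
  obtain ⟨γ, hγ⟩ := (gap_inStrip n k).exists_path hx
  have h := arc_congr γ hγ false true (gap_mem n k _) (hx.mem _) (gap_mem n k _) (hx.mem _)
  rw [← toPoint_trans false (gap_mem n k _) (hx.mem _),
    ← toPoint_trans true (gap_mem n k _) (hx.mem _), h, symm_trans_rev,
    Homotopic.Quotient.trans_assoc, trans_symm_cancel]
  rfl

theorem loop_zero (n : ℕ) : loop n 0 = 1 := by
  simp only [loop, toPoint, arc, within_self]
  exact Homotopic.Quotient.trans_symm _

/-- The number of the strip of a point. -/
theorem exists_inStrip {n : ℕ} {x : Plane n} (h : ∀ b, x ∈ half n b) : ∃ k ≤ n, InStrip k x := by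
  have hre : ∀ j : ℕ, j < n → (x : ℂ).re ≠ j := fun j hj hx => by
    have h1 := h true j hj hx
    have h2 := h false j hj hx
    simp only [sgn, cond_true, cond_false] at h1 h2
    linarith
  -- The natural ceiling sends everything to the left of 0 to strip 0, and the minimum sends
  -- everything to the right of `n - 1` to strip `n`.
  refine ⟨min n ⌈(x : ℂ).re⌉₊, min_le_left _ _, fun j hj => ?_⟩
  rcases lt_or_gt_of_ne (hre j hj) with h1 | h1
  · right
    exact ⟨(min_le_right _ _).trans (Nat.ceil_le.2 h1.le), h1⟩
  · left
    exact ⟨lt_min hj (Nat.lt_ceil.2 h1), h1⟩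

/-- The loops through the strips generate the fundamental group of the punctured plane. -/
theorem eq_top_of_loop_mem {n : ℕ} (H : Subgroup (FundamentalGroup (Plane n) (base n)))
    (h : ∀ k ≤ n, loop n k ∈ H) : H = ⊤ := by
  have h2 : ∀ i j x (hi : x ∈ half n i) (hj : x ∈ half n j),
      (show FundamentalGroup (Plane n) (base n) from
        (toPoint i hi).trans (toPoint j hj).symm) ∈ H := by
    have one : ∀ i x (hi : x ∈ half n i), (show FundamentalGroup (Plane n) (base n) from
        (toPoint i hi).trans (toPoint i hi).symm) ∈ H := fun i x hi => by
      refine Set.mem_of_eq_of_mem ?_ H.one_mem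
      exact Homotopic.Quotient.trans_symm _
    have two : ∀ x (hi : x ∈ half n false) (hj : x ∈ half n true),
        (show FundamentalGroup (Plane n) (base n) from
          (toPoint false hi).trans (toPoint true hj).symm) ∈ H := fun x hi hj => by
      obtain ⟨k, hk, hs⟩ := exists_inStrip (x := x) (by rintro (_ | _) <;> assumption)
      exact Set.mem_of_eq_of_mem (loop_eq hs).symm (h k hk)
    rintro (_ | _) (_ | _) x hi hj
    · exact one _ _ _
    · exact two _ _ _
    · refine Set.mem_of_eq_of_mem ?_ (H.inv_mem (two x hj hi))
      rw [FundamentalGroup.inv_def, symm_trans_rev, PathClass.symm_symm]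
    · exact one _ _ _
  refine mem_of_cover (half n) (isOpen_half n) exists_mem_half H (fun b x hx => toPoint b hx)
    ⟨false, base_mem n, ?_⟩ ?_ h2
  · refine Set.mem_of_eq_of_mem ?_ H.one_mem
    rw [toPoint_false]
    exact within_self _ _ _
  · intro i x y hx hy γ hγ
    refine Set.mem_of_eq_of_mem ?_ H.one_mem
    rw [mk_eq_within _ hx hy γ hγ, ← toPoint_trans i hx hy, symm_trans_rev, trans_symm_cancel]
    exact Homotopic.Quotient.trans_symm _

end Plane

/-! ### Images of classes of paths under maps. -/

namespace PathClass

open Path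

variable {X Y : Type} [TopologicalSpace X] [TopologicalSpace Y]

/-- The image of a class of paths under a map with prescribed values at the end points. -/
noncomputable def mapTo (f : C(X, Y)) {x y : X} {x' y' : Y} (hx : f x = x') (hy : f y = y')
    (q : Homotopic.Quotient x y) : Homotopic.Quotient x' y' := (q.map f).cast hx.symm hy.symm

theorem mapTo_rfl (f : C(X, Y)) {x y : X} (q : Homotopic.Quotient x y) :
    mapTo f rfl rfl q = q.map f := Homotopic.Quotient.cast_rfl_rfl _

theorem mapTo_trans (f : C(X, Y)) {x y z : X} {x' y' z' : Y} (hx : f x = x') (hy : f y = y')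
    (hz : f z = z') (p : Homotopic.Quotient x y) (q : Homotopic.Quotient y z) :
    mapTo f hx hz (p.trans q) = (mapTo f hx hy p).trans (mapTo f hy hz q) := by
  subst hx hy hz
  simp only [mapTo_rfl, map_trans]

theorem mapTo_symm (f : C(X, Y)) {x y : X} {x' y' : Y} (hx : f x = x') (hy : f y = y')
    (p : Homotopic.Quotient x y) : mapTo f hy hx p.symm = (mapTo f hx hy p).symm := by
  subst hx hy
  simp only [mapTo_rfl, map_symm]

theorem mapTo_mk (f : C(X, Y)) {x y : X} {x' y' : Y} (hx : f x = x') (hy : f y = y')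
    (γ : Path x y) (γ' : Path x' y') (h : ∀ t, γ' t = f (γ t)) :
    mapTo f hx hy (Homotopic.Quotient.mk γ) = Homotopic.Quotient.mk γ' := by
  subst hx hy
  rw [mapTo_rfl, ← Homotopic.Quotient.mk_map]
  congr 1
  ext t
  exact (h t).symm

/-- A path is the composition of its two halves. -/
theorem exists_halves {x y : X} (γ : Path x y) (m : X) (hm : γ ⟨1 / 2, by norm_num, by norm_num⟩ = m) :
    ∃ (α : Path x m) (β : Path m y), γ = α.trans β ∧
      (∀ t, ∃ s : unitInterval, (s : ℝ) ≤ 1 / 2 ∧ α t = γ s) ∧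
      ∀ t, ∃ s : unitInterval, 1 / 2 ≤ (s : ℝ) ∧ β t = γ s := by
  have h1 : ∀ t : unitInterval, (t : ℝ) / 2 ∈ unitInterval := fun t =>
    ⟨by linarith [t.2.1], by linarith [t.2.2]⟩
  have h2 : ∀ t : unitInterval, (1 + (t : ℝ)) / 2 ∈ unitInterval := fun t =>
    ⟨by linarith [t.2.1], by linarith [t.2.2]⟩
  refine ⟨⟨⟨fun t => γ ⟨t / 2, h1 t⟩, by fun_prop⟩, ?_, ?_⟩,
    ⟨⟨fun t => γ ⟨(1 + t) / 2, h2 t⟩, by fun_prop⟩, ?_, ?_⟩, ?_, fun t =>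
      ⟨⟨t / 2, h1 t⟩, ?_, rfl⟩, fun t => ⟨⟨(1 + t) / 2, h2 t⟩, ?_, rfl⟩⟩
  · refine Eq.trans (congrArg γ ?_) γ.source
    exact Subtype.ext (by simp)
  · exact hm
  · refine Eq.trans (congrArg γ ?_) hm
    exact Subtype.ext (by simp)
  · refine Eq.trans (congrArg γ ?_) γ.target
    exact Subtype.ext (by simp)
  · ext t
    rw [Path.trans_apply]
    split_ifs with h
    · exact congrArg γ (Subtype.ext (by simp))
    · refine congrArg γ (Subtype.ext ?_)
      simp
  · change (t : ℝ) / 2 ≤ 1 / 2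
    linarith [t.2.2]
  · change 1 / 2 ≤ (1 + (t : ℝ)) / 2
    linarith [t.2.1]

end PathClass

/-! ### The action of a half-turn on the loops through the strips. -/

namespace Plane

open Path PathClass

/-- A closed curve that crosses the real line upward in one strip and downward in another. -/
theorem conj_eq_of_halves {n a c : ℕ} {x m : Plane n} (γ : Path x x)
    (hm : γ ⟨1 / 2, by norm_num, by norm_num⟩ = m) (ha : InStrip a x) (hc : InStrip c m) (b : Bool)
    (h₁ : ∀ s : unitInterval, (s : ℝ) ≤ 1 / 2 → γ s ∈ half n b)
    (h₂ : ∀ s : unitInterval, 1 / 2 ≤ (s : ℝ) → γ s ∈ half n (!b)) :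
    (show FundamentalGroup (Plane n) (base n) from
      (toPoint false (ha.mem false)).trans ((Homotopic.Quotient.mk γ).trans
        (toPoint false (ha.mem false)).symm)) =
      bif b then (loop n c)⁻¹ * loop n a else (loop n a)⁻¹ * loop n c := by
  obtain ⟨α, β, rfl, hα, hβ⟩ := exists_halves γ m hm
  have e1 := mk_eq_within (half n b) (ha.mem b) (hc.mem b) α fun t => by
    obtain ⟨s, hs, h⟩ := hα t
    rw [h]
    exact h₁ s hs
  have e2 := mk_eq_within (half n (!b)) (hc.mem (!b)) (ha.mem (!b)) β fun t => by
    obtain ⟨s, hs, h⟩ := hβ t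
    rw [h]
    exact h₂ s hs
  have e3 := arc_eq b (ha.mem b) (hc.mem b)
  have e4 := arc_eq (!b) (hc.mem (!b)) (ha.mem (!b))
  rw [arc] at e3 e4
  rw [loop_eq ha, loop_eq hc, Homotopic.Quotient.mk_trans, e1, e2, e3, e4]
  cases b <;>
  simp only [cond_true, cond_false, FundamentalGroup.mul_def, FundamentalGroup.inv_def,
    symm_trans_rev, PathClass.symm_symm, Homotopic.Quotient.trans_assoc, trans_symm_cancel,
    Bool.not_true, Bool.not_false, Homotopic.Quotient.trans_symm, Homotopic.Quotient.trans_refl]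

/-- The counterclockwise half-turn that exchanges `k` and `k + 1`. -/
noncomputable def halfTurn (k : ℕ) (z : ℂ) : ℂ :=
  (k + 1 / 2) + 2 * (z - (k + 1 / 2)) *
    Complex.exp (Real.pi * Real.smoothTransition (2 - ‖2 * (z - (k + 1 / 2))‖) * Complex.I) / 2

theorem halfTurn_eq_self {k : ℕ} {z : ℂ} (h : 1 ≤ ‖z - (k + 1 / 2)‖) : halfTurn k z = z := by
  rw [halfTurn, Real.smoothTransition.zero_of_nonpos]
  · simp
  · rw [norm_mul, Complex.norm_ofNat]
    linarith

theorem halfTurn_vertical (k : ℕ) (b : Bool) {y : ℝ} (hy : 0 ≤ y) :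
    halfTurn k (k + 1 / 2 + sgn b * y * Complex.I) =
      (k + 1 / 2) + sgn b * y * Complex.I *
        Complex.exp ((Real.pi * Real.smoothTransition (2 - 2 * y) : ℝ) * Complex.I) := by
  have hb : ‖(sgn b : ℂ)‖ = 1 := by cases b <;> simp [sgn]
  have h : ‖2 * ((k + 1 / 2 + sgn b * y * Complex.I) - ((k : ℂ) + 1 / 2))‖ = 2 * y := by
    rw [add_sub_cancel_left, norm_mul, norm_mul, norm_mul, hb]
    simp [abs_of_nonneg hy]
  rw [halfTurn, h]
  push_cast
  ring

theorem sgn_mul_im_halfTurn (k : ℕ) (b : Bool) {y : ℝ} (hy : 0 ≤ y) :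
    sgn b * (halfTurn k (k + 1 / 2 + sgn b * y * Complex.I)).im =
      y * Real.cos (Real.pi * Real.smoothTransition (2 - 2 * y)) := by
  rw [halfTurn_vertical k b hy]
  have h1 : ((k : ℂ) + 1 / 2).im = 0 := by
    simp
  have h2 : ((sgn b : ℂ) * y * Complex.I *
      Complex.exp ((Real.pi * Real.smoothTransition (2 - 2 * y) : ℝ) * Complex.I)).im =
      sgn b * y * Real.cos (Real.pi * Real.smoothTransition (2 - 2 * y)) := by
    rw [mul_assoc, mul_assoc, Complex.im_ofReal_mul, Complex.im_ofReal_mul, Complex.I_mul_im,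
      Complex.exp_ofReal_mul_I_re, mul_assoc]
  rw [Complex.add_im, h1, h2, zero_add]
  rw [← mul_assoc, ← mul_assoc, sgn_mul_self, one_mul]

/-- At distance 3/4 from the centre of `halfTurn` the argument of the transition function is 2 - 2 ·
3/4 = 1/2, so the half-turn is exactly a quarter-turn there. -/
theorem smoothTransition_half : Real.smoothTransition (1 / 2) = 1 / 2 := by
  have : 0 < expNegInvGlue (1 / 2) := expNegInvGlue.pos_of_pos (by norm_num)
  rw [Real.smoothTransition, show (1 : ℝ) - 1 / 2 = 1 / 2 by norm_num]
  field_simp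
  norm_num

/-- Outside radius 3/4 the rotation is by at most a right angle, so a vertical ray from the centre
stays on its side of the real line. Inside this radius, by the next lemma, the angle is at least a
right angle and the ray passes to the other side. -/
theorem sgn_mul_im_halfTurn_nonneg (k : ℕ) (b : Bool) {y : ℝ} (hy : 3 / 4 ≤ y) :
    0 ≤ sgn b * (halfTurn k (k + 1 / 2 + sgn b * y * Complex.I)).im := by
  rw [sgn_mul_im_halfTurn k b (by linarith)]
  have h1 : Real.smoothTransition (2 - 2 * y) ≤ 1 / 2 := by
    rw [← smoothTransition_half]
    exact Real.smoothTransition.monotone (by linarith)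
  have h0 := Real.smoothTransition.nonneg (2 - 2 * y)
  refine mul_nonneg (by linarith) (Real.cos_nonneg_of_neg_pi_div_two_le_of_le ?_ ?_) <;>
  nlinarith [Real.pi_pos]

theorem sgn_mul_im_halfTurn_nonpos (k : ℕ) (b : Bool) {y : ℝ} (h0 : 0 ≤ y) (hy : y ≤ 3 / 4) :
    sgn b * (halfTurn k (k + 1 / 2 + sgn b * y * Complex.I)).im ≤ 0 := by
  rw [sgn_mul_im_halfTurn k b h0]
  have h1 : 1 / 2 ≤ Real.smoothTransition (2 - 2 * y) := by
    rw [← smoothTransition_half]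
    exact Real.smoothTransition.monotone (by linarith)
  have h0 := Real.smoothTransition.le_one (2 - 2 * y)
  refine mul_nonpos_of_nonneg_of_nonpos (by linarith)
    (Real.cos_nonpos_of_pi_div_two_le_of_le ?_ ?_) <;>
  nlinarith [Real.pi_pos]

/-- The crossing point is k - 1/4 for the upper ray, in strip k, and k + 5/4 for the lower ray, in
strip k + 2. -/
theorem halfTurn_three_quarters (k : ℕ) (b : Bool) :
    halfTurn k (k + 1 / 2 + sgn b * (3 / 4 : ℝ) * Complex.I) = k + 1 / 2 - sgn b * (3 / 4) := by
  rw [halfTurn_vertical k b (by norm_num), show (2 : ℝ) - 2 * (3 / 4) = 1 / 2 by norm_num,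
    smoothTransition_half, show ((Real.pi * (1 / 2) : ℝ) : ℂ) = Real.pi / 2 by push_cast; ring,
    Complex.exp_pi_div_two_mul_I]
  push_cast
  linear_combination (sgn b : ℂ) * (3 / 4) * Complex.I_sq

/-- The class of a segment in a slit plane, and that of its image under a half-turn. -/
theorem mapTo_segment {n : ℕ} {T : C(Plane n, Plane n)} {x y x' y' : Plane n} (hx : T x = x') (hy : T y = y') (b b' : Bool)
    (xb : x ∈ half n b) (yb : y ∈ half n b) (xb' : x' ∈ half n b') (yb' : y' ∈ half n b')
    (h : ∀ t : ℝ, 0 ≤ t → t ≤ 1 → (1 - t) * (x : ℂ) + t * (y : ℂ) ∈ slit n b)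
    (h' : ∀ (t : ℝ) (z : Plane n), 0 ≤ t → t ≤ 1 → (z : ℂ) = (1 - t) * (x : ℂ) + t * (y : ℂ) →
      T z ∈ half n b') :
    mapTo T hx hy (arc b xb yb) = arc b' xb' yb' := by
  let γ : Path x y :=
    { toFun := fun t => ⟨(1 - (t : ℝ)) * (x : ℂ) + (t : ℝ) * (y : ℂ), slit_ne (h t t.2.1 t.2.2)⟩
      continuous_toFun := Continuous.subtype_mk (by fun_prop) _
      source' := Subtype.ext (by simp)
      target' := Subtype.ext (by simp) }
  let γ' : Path x' y' :=
    { toFun := fun t => T (γ t)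
      continuous_toFun := by fun_prop
      source' := by rw [γ.source, hx]
      target' := by rw [γ.target, hy] }
  rw [arc, arc, ← mk_eq_within _ xb yb γ (fun t => h t t.2.1 t.2.2),
    ← mk_eq_within _ xb' yb' γ' (fun t => h' t _ t.2.1 t.2.2 rfl)]
  exact mapTo_mk _ _ _ _ _ fun _ => rfl

theorem apply_of_far {n k : ℕ} {T : C(Plane n, Plane n)}
    (hT : ∀ z : Plane n, (T z : ℂ) = halfTurn k z) {z : Plane n} (h : 1 ≤ |(z : ℂ).re - (k + 1 / 2)| ∨ 1 ≤ |(z : ℂ).im|) :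
    T z = z := by
  refine Subtype.ext ?_
  rw [hT]
  refine halfTurn_eq_self ?_
  have hre : ((z : ℂ) - (k + 1 / 2)).re = (z : ℂ).re - (k + 1 / 2) := by simp
  have him : ((z : ℂ) - (k + 1 / 2)).im = (z : ℂ).im := by simp
  rcases h with h | h
  · exact (hre ▸ h).trans (Complex.abs_re_le_norm _)
  · exact (him ▸ h).trans (Complex.abs_im_le_norm _)

theorem mapTo_arc_of_far {n k : ℕ} {T : C(Plane n, Plane n)}
    (hT : ∀ z : Plane n, (T z : ℂ) = halfTurn k z) {x y : Plane n} (hx : T x = x) (hy : T y = y) (b : Bool)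
    (xb : x ∈ half n b) (yb : y ∈ half n b)
    (h : ∀ t : ℝ, 0 ≤ t → t ≤ 1 → (1 - t) * (x : ℂ) + t * (y : ℂ) ∈ slit n b)
    (h' : ∀ (t : ℝ) (z : ℂ), 0 ≤ t → t ≤ 1 → z = (1 - t) * (x : ℂ) + t * (y : ℂ) →
      1 ≤ |z.re - (k + 1 / 2)| ∨ 1 ≤ |z.im|) :
    mapTo T hx hy (arc b xb yb) = arc b xb yb := by
  refine mapTo_segment hx hy b b xb yb xb yb h fun t z h0 h1 hz => ?_
  rw [apply_of_far hT (h' t z h0 h1 hz)]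
  have := h t h0 h1
  rw [← hz] at this
  exact this

theorem pt_far {n k : ℕ} {T : C(Plane n, Plane n)}
    (hT : ∀ z : Plane n, (T z : ℂ) = halfTurn k z) {i : ℕ} (hi : i ≠ k + 1) (y : ℝ) : T (pt n i y) = pt n i y := by
  refine apply_of_far hT (Or.inl ?_)
  change 1 ≤ |(i : ℝ) - 1 / 2 - (k + 1 / 2)|
  rcases lt_or_gt_of_ne hi with h | h
  · have : (i : ℝ) + 1 ≤ k + 1 := by exact_mod_cast h
    rw [abs_of_nonpos] <;> linarith
  · have : (k : ℝ) + 1 + 1 ≤ i := by exact_mod_cast h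
    rw [abs_of_nonneg] <;> linarith

theorem pt_far' {n k : ℕ} {T : C(Plane n, Plane n)}
    (hT : ∀ z : Plane n, (T z : ℂ) = halfTurn k z) (i : ℕ) (b : Bool) : T (pt n i (sgn b * 2)) = pt n i (sgn b * 2) := by
  refine apply_of_far hT (Or.inr ?_)
  change 1 ≤ |sgn b * 2|
  cases b <;> norm_num [sgn]

theorem segment_slit {n : ℕ} (b : Bool) {i : ℕ} {y y' t : ℝ} :
    (1 - t) * (pt n i y : ℂ) + t * (pt n i y' : ℂ) ∈ slit n b := by
  have : (1 - t) * (pt n i y : ℂ) + t * (pt n i y' : ℂ) = (pt n i ((1 - t) * y + t * y') : ℂ) := by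
    apply Complex.ext
    · simp [pt]
      ring
    · simp [pt]
  rw [this]
  exact (pt_inStrip n i _).mem b

theorem mapTo_vertical {n k : ℕ} {T : C(Plane n, Plane n)}
    (hT : ∀ z : Plane n, (T z : ℂ) = halfTurn k z) {i : ℕ} (hi : i ≠ k + 1) (b : Bool) (y y' : ℝ) :
    mapTo T (pt_far hT hi y) (pt_far hT hi y')
      (arc b ((pt_inStrip n i y).mem b) ((pt_inStrip n i y').mem b)) =
      arc b ((pt_inStrip n i y).mem b) ((pt_inStrip n i y').mem b) := by
  refine mapTo_arc_of_far hT _ _ _ _ _ (fun t _ _ => segment_slit b) fun t z _ _ hz => Or.inl ?_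
  have : z.re = i - 1 / 2 := by
    rw [hz]
    simp [pt]
    ring
  rw [this]
  rcases lt_or_gt_of_ne hi with h | h
  · have : (i : ℝ) + 1 ≤ k + 1 := by exact_mod_cast h
    rw [abs_of_nonpos] <;> linarith
  · have : (k : ℝ) + 1 + 1 ≤ i := by exact_mod_cast h
    rw [abs_of_nonneg] <;> linarith

theorem mapTo_horizontal {n k : ℕ} {T : C(Plane n, Plane n)}
    (hT : ∀ z : Plane n, (T z : ℂ) = halfTurn k z) (i j : ℕ) (b : Bool) :
    mapTo T (pt_far' hT i b) (pt_far' hT j b)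
      (arc b ((pt_inStrip n i (sgn b * 2)).mem b) ((pt_inStrip n j (sgn b * 2)).mem b)) =
      arc b ((pt_inStrip n i (sgn b * 2)).mem b) ((pt_inStrip n j (sgn b * 2)).mem b) := by
  have him : ∀ t : ℝ, ((1 - t) * (pt n i (sgn b * 2) : ℂ) + t * (pt n j (sgn b * 2) : ℂ)).im =
      sgn b * 2 := fun t => by
    simp [pt]
    ring
  refine mapTo_arc_of_far hT _ _ _ _ _ (fun t _ _ => mem_slit_of_pos ?_)
    fun t z _ _ hz => Or.inr ?_
  · rw [him, ← mul_assoc, sgn_mul_self]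
    norm_num
  · rw [hz, him]
    cases b <;> norm_num [sgn]

/-- The path can be taken horizontally at height 2 or -2, beyond the support of the half-turn, and
then vertically in the middle of strip `i`, which has distance at least 1 from the centre unless `i
= k + 1`. -/
theorem mapTo_toHub {n k : ℕ} {T : C(Plane n, Plane n)}
    (hT : ∀ z : Plane n, (T z : ℂ) = halfTurn k z) {i : ℕ} (hi : i ≠ k + 1) (b : Bool) :
    mapTo T (pt_far' hT 0 b) (pt_far hT hi 0)
      (arc b ((pt_inStrip n 0 (sgn b * 2)).mem b) ((pt_inStrip n i 0).mem b)) =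
      arc b ((pt_inStrip n 0 (sgn b * 2)).mem b) ((pt_inStrip n i 0).mem b) := by
  have := mapTo_trans T (pt_far' hT 0 b) (pt_far' hT i b) (pt_far hT hi 0)
    (arc b ((pt_inStrip n 0 (sgn b * 2)).mem b) ((pt_inStrip n i (sgn b * 2)).mem b))
    (arc b ((pt_inStrip n i (sgn b * 2)).mem b) ((pt_inStrip n i 0).mem b))
  rw [mapTo_horizontal hT, mapTo_vertical hT hi] at this
  simpa only [arc, within_trans] using this

theorem apply_center {n k : ℕ} {T : C(Plane n, Plane n)}
    (hT : ∀ z : Plane n, (T z : ℂ) = halfTurn k z) : T (pt n (k + 1) 0) = pt n (k + 1) 0 := by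
  refine Subtype.ext ?_
  have h : (pt n (k + 1) 0 : ℂ) = k + 1 / 2 + sgn true * (0 : ℝ) * Complex.I := by
    apply Complex.ext
    · simp [pt]
      ring
    · simp [pt]
  rw [hT, h, halfTurn_vertical k true le_rfl]
  simp

theorem pt_center {n k : ℕ} (b : Bool) (y : ℝ) :
    (pt n (k + 1) (sgn b * y) : ℂ) = k + 1 / 2 + sgn b * y * Complex.I := by
  apply Complex.ext
  · simp [pt]
    ring
  · simp [pt]

/-- The image of the class of a vertical path to the centre of a half-turn. -/
theorem mapTo_toCenter {n k : ℕ} {T : C(Plane n, Plane n)}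
    (hT : ∀ z : Plane n, (T z : ℂ) = halfTurn k z) {p : Plane n} (b : Bool) (hp : (p : ℂ) = k + 1 / 2 - sgn b * (3 / 4))
    {j : ℕ} (hj : InStrip j p) :
    mapTo T (pt_far' hT 0 b) (apply_center hT)
      (arc b ((pt_inStrip n 0 (sgn b * 2)).mem b) ((pt_inStrip n (k + 1) 0).mem b)) =
      (arc b ((pt_inStrip n 0 (sgn b * 2)).mem b) (hj.mem b)).trans
        (arc (!b) (hj.mem (!b)) ((pt_inStrip n (k + 1) 0).mem (!b))) := by
  -- The vertical path is cut at distance 3/4 from the centre. The outer part stays on its side, the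
  -- inner part passes to the other side, and `p` is the image of the cut point.
  have hp' : T (pt n (k + 1) (sgn b * (3 / 4 : ℝ))) = p := Subtype.ext (by
    rw [hT, pt_center, halfTurn_three_quarters, hp])
  have e1 := mapTo_segment (T := T) (pt_far' hT (k + 1) b) hp' b b ((pt_inStrip n _ _).mem b)
    ((pt_inStrip n _ _).mem b) ((pt_inStrip n _ _).mem b) (hj.mem b)
    (fun t _ _ => segment_slit b) (fun t z h0 h1 hz => by
      have : (z : ℂ) = k + 1 / 2 + sgn b * (2 - t * (5 / 4) : ℝ) * Complex.I := by
        rw [hz, pt_center, pt_center]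
        push_cast
        ring
      refine mem_half_of_nonneg ?_
      rw [hT, this]
      exact sgn_mul_im_halfTurn_nonneg k b (by linarith))
  have e2 := mapTo_segment (T := T) hp' (apply_center hT) b (!b) ((pt_inStrip n _ _).mem b)
    ((pt_inStrip n _ _).mem b) (hj.mem (!b)) ((pt_inStrip n _ _).mem (!b))
    (fun t _ _ => segment_slit b) (fun t z h0 h1 hz => by
      have : (z : ℂ) = k + 1 / 2 + sgn b * ((1 - t) * (3 / 4) : ℝ) * Complex.I := by
        have h00 : (pt n (k + 1) 0 : ℂ) = k + 1 / 2 + sgn b * (0 : ℝ) * Complex.I := by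
          rw [← pt_center, mul_zero]
        rw [hz, pt_center, h00]
        push_cast
        ring
      refine mem_half_of_nonneg ?_
      rw [hT, this]
      have h2 := sgn_mul_im_halfTurn_nonpos k b (y := (1 - t) * (3 / 4)) (by linarith)
        (by linarith)
      have h3 : sgn (!b) = - sgn b := by cases b <;> simp [sgn]
      rw [h3]
      linarith)
  have e3 := mapTo_trans T (pt_far' hT 0 b) (pt_far' hT (k + 1) b) (apply_center hT)
    (arc b ((pt_inStrip n 0 (sgn b * 2)).mem b) ((pt_inStrip n (k + 1) (sgn b * 2)).mem b))
    ((arc b ((pt_inStrip n (k + 1) (sgn b * 2)).mem b)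
        ((pt_inStrip n (k + 1) (sgn b * (3 / 4))).mem b)).trans
      (arc b ((pt_inStrip n (k + 1) (sgn b * (3 / 4))).mem b) ((pt_inStrip n (k + 1) 0).mem b)))
  rw [mapTo_horizontal hT, mapTo_trans T _ hp', e1, e2] at e3
  simpa only [arc, within_trans, within_trans_assoc] using e3

/-- The points of strip 0 at heights 2 and -2 are fixed by every half-turn, so it suffices to know
the images of the arcs from these two hubs to the real line. -/
theorem loop_eq_arcs {n : ℕ} (i : ℕ) : loop n i =
    (arc false ((pt_inStrip n 0 (sgn false * 2)).mem false) (gap_mem n i false)).trans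
      ((arc true ((pt_inStrip n 0 (sgn true * 2)).mem true) (gap_mem n i true)).symm.trans
        ((arc true ((pt_inStrip n 0 (sgn true * 2)).mem true) (gap_mem n 0 true)).trans
          (arc false ((pt_inStrip n 0 (sgn false * 2)).mem false) (gap_mem n 0 false)).symm)) := by
  rw [loop, toPoint_false, toPoint, symm_trans_rev, within_symm _ _ (gap_mem n i true),
    within_symm _ _ (gap_mem n i true), within_trans_assoc]

theorem apply_base {n k : ℕ} {T : C(Plane n, Plane n)}
    (hT : ∀ z : Plane n, (T z : ℂ) = halfTurn k z) : T (base n) = base n := pt_far hT (Nat.succ_ne_zero k).symm _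

theorem mapTo_loop {n k : ℕ} {T : C(Plane n, Plane n)}
    (hT : ∀ z : Plane n, (T z : ℂ) = halfTurn k z) {i : ℕ} (hi : i ≠ k + 1) :
    mapTo T (apply_base hT) (apply_base hT) (loop n i) = loop n i := by
  have h0 := mapTo_toHub hT (Nat.succ_ne_zero k).symm
  have h1 := mapTo_toHub hT hi
  rw [loop_eq_arcs, mapTo_trans T _ (pt_far hT hi 0), mapTo_trans T _ (pt_far' hT 0 true),
    mapTo_trans T _ (pt_far hT (Nat.succ_ne_zero k).symm 0), mapTo_symm, mapTo_symm, h0, h1, h0, h1]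

theorem toPoint_base (n : ℕ) : toPoint false (base_mem n) = Homotopic.Quotient.refl _ := by
  rw [toPoint_false]
  exact within_self _ _ _

theorem toPoint_gap_zero (n : ℕ) :
    toPoint true (gap_mem n 0 true) = toPoint false (gap_mem n 0 false) := by
  rw [toPoint, toPoint, arc, arc, arc, within_self, within_self]

/-- The effect of a half-turn on the loop that passes through the strip between the points that
are exchanged. -/
theorem mapTo_loop_succ {n k : ℕ} {T : C(Plane n, Plane n)}
    (hT : ∀ z : Plane n, (T z : ℂ) = halfTurn k z) :
    mapTo T (apply_base hT) (apply_base hT) (loop n (k + 1)) =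
      loop n k * (loop n (k + 1))⁻¹ * loop n (k + 2) := by
  -- The two crossing points k + 5/4 and k - 1/4. Multiplying by four turns the fact that they are
  -- not integers into a congruence.
  let p : Bool → Plane n := fun b => ⟨k + 1 / 2 - sgn b * (3 / 4), fun j _ h => by
    have h1 : ((k + 1 / 2 - sgn b * (3 / 4) : ℝ) : ℂ) = ((j : ℝ) : ℂ) := by
      push_cast
      exact h
    have h2 : (k + 1 / 2 - sgn b * (3 / 4) : ℝ) = j := by exact_mod_cast h1
    cases b
    · simp only [sgn, cond_false] at h2
      have h3 : (4 * k + 5 : ℝ) = 4 * j := by linarith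
      have h4 : 4 * k + 5 = 4 * j := by exact_mod_cast h3
      omega
    · simp only [sgn, cond_true] at h2
      have h3 : (4 * k : ℝ) = 4 * j + 1 := by linarith
      have h4 : 4 * k = 4 * j + 1 := by exact_mod_cast h3
      omega⟩
  have hp : ∀ b, (p b : ℂ).re = k + 1 / 2 - sgn b * (3 / 4) := fun b => by
    simp [p]
  have h2 : InStrip (k + 2) (p false) := by
    intro j _
    rw [hp]
    simp only [sgn, cond_false]
    rcases lt_or_ge j (k + 2) with h | h
    · left
      have : (j : ℝ) + 1 ≤ k + 2 := by exact_mod_cast h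
      exact ⟨h, by linarith⟩
    · right
      have : (k : ℝ) + 2 ≤ j := by exact_mod_cast h
      exact ⟨h, by linarith⟩
  have h0 : InStrip k (p true) := by
    intro j _
    rw [hp]
    simp only [sgn, cond_true]
    rcases lt_or_ge j k with h | h
    · left
      have : (j : ℝ) + 1 ≤ k := by exact_mod_cast h
      exact ⟨h, by linarith⟩
    · right
      have : (k : ℝ) ≤ j := by exact_mod_cast h
      exact ⟨h, by linarith⟩
  have e0 := mapTo_toHub hT (Nat.succ_ne_zero k).symm
  have e1 := mapTo_toCenter hT false (p := p false) rfl h2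
  have e2 := mapTo_toCenter hT true (p := p true) rfl h0
  conv_lhs =>
    rw [loop_eq_arcs (k + 1), mapTo_trans T _ (apply_center hT),
      mapTo_trans T _ (pt_far' hT 0 true),
      mapTo_trans T _ (pt_far hT (Nat.succ_ne_zero k).symm 0), mapTo_symm, mapTo_symm, e0, e1, e2, e0]
  -- The image passes up through strip k + 2, down through the centre in strip k + 1 and up through
  -- strip k; products are read from right to left.
  rw [loop_eq h2, loop_eq h0, loop]
  simp only [arc_eq, Bool.not_true, Bool.not_false, toPoint_base, toPoint_gap_zero,
    FundamentalGroup.mul_def, FundamentalGroup.inv_def, symm_trans_rev, PathClass.symm_symm,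
    Homotopic.Quotient.trans_assoc, Homotopic.Quotient.trans_symm, Homotopic.Quotient.trans_refl]
  exact Homotopic.Quotient.refl_trans _

end Plane

/-! ### Freeness of the loops, by coverings of the punctured plane. -/

namespace Plane

open Path PathClass

theorem isOpen_inStrip (n k : ℕ) : IsOpen {x : Plane n | InStrip k x} := by
  have h : {x : Plane n | InStrip k x} = ⋂ j ∈ Finset.range n,
      {x : Plane n | (j < k ∧ (j : ℝ) < (x : ℂ).re) ∨ (k ≤ j ∧ (x : ℂ).re < j)} := by
    ext x
    simp [InStrip]
  rw [h]
  refine isOpen_biInter_finset fun j _ => ?_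
  by_cases hj : j < k
  · simp only [hj, not_le.2 hj, true_and, false_and, or_false]
    exact isOpen_lt (by fun_prop) (by fun_prop)
  · simp only [hj, not_lt.1 hj, true_and, false_and, false_or]
    exact isOpen_lt (by fun_prop) (by fun_prop)

/-- The number of the strip that contains a point. -/
noncomputable def strip {n : ℕ} (x : Plane n) : ℕ :=
  -- The value 0 on the vertical lines through the punctures is a dummy: only the strips lie in both
  -- slit planes.
  open Classical in if h : ∃ k ≤ n, InStrip k x then h.choose else 0

/-- The bound `k ≤ n` makes the number unique: to the right of all punctures every number from `n`
on satisfies `InStrip`. -/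
theorem strip_eq {n k : ℕ} (hk : k ≤ n) {x : Plane n} (hx : InStrip k x) : strip x = k := by
  have h : ∃ k ≤ n, InStrip k x := ⟨k, hk, hx⟩
  have h1 : strip x = h.choose := dif_pos h
  obtain ⟨h2, h3⟩ := h.choose_spec
  rw [h1]
  rcases lt_trichotomy h.choose k with h4 | h4 | h4
  · rcases hx _ (h4.trans_le hk) with h5 | h5 <;> rcases h3 _ (h4.trans_le hk) with h6 | h6
    · omega
    · linarith [h5.2, h6.2]
    · omega
    · omega
  · exact h4
  · rcases hx _ (h4.trans_le h2) with h5 | h5 <;> rcases h3 _ (h4.trans_le h2) with h6 | h6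
    · omega
    · omega
    · linarith [h5.2, h6.2]
    · omega

theorem strip_eventuallyEq {n : ℕ} {x : Plane n} (h : ∀ b, x ∈ half n b) :
    ∀ᶠ y in nhds x, strip y = strip x := by
  obtain ⟨k, hk, hx⟩ := exists_inStrip h
  filter_upwards [(isOpen_inStrip n k).mem_nhds hx] with y hy
  rw [strip_eq hk hx, strip_eq hk hy]

section cover

variable (n : ℕ) {G : Type} [Group G] [TopologicalSpace G] [DiscreteTopology G] (w : ℕ → G)

/-- The transition function from one of the slit planes to the lower one. -/
noncomputable def transition (b : Bool) (x : Plane n) : G := bif b then (w (strip x))⁻¹ else 1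

/-- The covering of the punctured plane that is trivial over the slit planes and whose transition
function on the strip number `k` is multiplication by `(w k)⁻¹`. -/
noncomputable def coverCore : FiberBundleCore Bool (Plane n) G where
  baseSet := half n
  isOpen_baseSet := isOpen_half n
  indexAt x := (exists_mem_half x).choose
  mem_baseSet_at x := (exists_mem_half x).choose_spec
  -- Writing the transition as a quotient of two factors makes the cocycle condition automatic.
  coordChange i j x v := (transition n w j x)⁻¹ * transition n w i x * v
  coordChange_self i x _ v := by rw [inv_mul_cancel, one_mul]
  continuousOn_coordChange i j := by
    -- Inside one slit plane `strip` is not locally constant, but for equal indices the factors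
    -- cancel; for different indices the point lies in a strip.
    by_cases hij : i = j
    · subst hij
      simp only [inv_mul_cancel, one_mul]
      exact continuous_snd.continuousOn
    · rintro ⟨x, v⟩ ⟨⟨hi, hj⟩, _⟩
      refine ContinuousAt.continuousWithinAt ?_
      have h : ∀ b, x ∈ half n b := by
        rintro b
        cases i <;> cases j <;> cases b <;> simp_all
      have h1 := strip_eventuallyEq h
      have h2 : (fun p : Plane n × G =>
          (transition n w j p.1)⁻¹ * transition n w i p.1 * p.2) =ᶠ[nhds (x, v)]
          fun p => (transition n w j x)⁻¹ * transition n w i x * p.2 := by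
        filter_upwards [continuous_fst.continuousAt.eventually h1] with p hp
        simp only [transition, hp]
      refine ContinuousAt.congr ?_ h2.symm
      have h3 : Continuous fun g : G => (transition n w j x)⁻¹ * transition n w i x * g :=
        continuous_of_discreteTopology
      exact (h3.comp continuous_snd).continuousAt
  coordChange_comp i j k x _ v := by group

theorem coverCore_isCoveringMap : IsCoveringMap (coverCore n w).proj :=
  FiberBundle.isCoveringMap (F := G) (E := (coverCore n w).Fiber)

variable {n}

/-- The point of the covering with given coordinate over a slit plane. -/
noncomputable def sheet (b : Bool) (x : Plane n) (v : G) : (coverCore n w).TotalSpace :=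
  ⟨x, (coverCore n w).coordChange b ((coverCore n w).indexAt x) x v⟩

theorem sheet_injective (b : Bool) (x : Plane n) : Function.Injective (sheet w b x) := by
  intro v v' h
  have h1 := congrArg (fun e => e.2) h
  simp only [sheet] at h1
  exact mul_left_cancel h1

theorem sheet_change (x : Plane n) (v : G) :
    sheet w true x v = sheet w false x ((w (strip x))⁻¹ * v) := by
  refine congrArg (Bundle.TotalSpace.mk x) ?_
  have h : ∀ a b c : G, a * b * c = a * 1 * (b * c) := fun a b c => by group
  exact h _ _ _

/-- The covering is trivial over a slit plane, so the curve with constant coordinate `v` lifts the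
path. -/
theorem monodromy_arc (b : Bool) {x y : Plane n} (hx : x ∈ half n b) (hy : y ∈ half n b) (v : G) :
    (coverCore_isCoveringMap n w).monodromy (arc b hx hy) ⟨sheet w b x v, rfl⟩ =
      ⟨sheet w b y v, rfl⟩ := by
  obtain ⟨γ, hγ, h⟩ := exists_mk_eq_within _ hx hy
  let Γ : Path (sheet w b x v) (sheet w b y v) :=
    { toFun := fun t => sheet w b (γ t) v
      continuous_toFun := by
        have h1 : ContinuousOn ((coverCore n w).localTriv b).toPartialEquiv.symm
          (((coverCore n w).localTriv b).target) :=
          ((coverCore n w).localTriv b).toOpenPartialHomeomorph.continuousOn_symm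
        have h2 : Continuous fun t => ((γ t, v) : Plane n × G) := by fun_prop
        refine (h1.comp_continuous h2 fun t => ?_)
        exact ⟨hγ t, Set.mem_univ _⟩
      source' := by rw [γ.source]
      target' := by rw [γ.target] }
  refine IsCoveringMap.monodromy_eq_of_map_eq _ (Homotopic.Quotient.mk Γ) ?_
  rw [arc, ← h]
  rfl

/-- The normalization `w 0 = 1` makes the coordinates over the two slit planes agree on strip 0,
where this path changes from one to the other. -/
theorem monodromy_toPoint (hw : w 0 = 1) (b : Bool) {x : Plane n} (hx : x ∈ half n b) (v : G) :
    (coverCore_isCoveringMap n w).monodromy (toPoint b hx) ⟨sheet w false (base n) v, rfl⟩ =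
      ⟨sheet w b x v, rfl⟩ := by
  rw [toPoint, IsCoveringMap.monodromy_trans_apply, monodromy_arc]
  have h : sheet w false (gap n 0) v = sheet w b (gap n 0) v := by
    cases b
    · rfl
    · rw [sheet_change, strip_eq (Nat.zero_le n) (gap_inStrip n 0), hw, inv_one, one_mul]
  have h2 : (⟨sheet w false (gap n 0) v, rfl⟩ : (coverCore n w).proj ⁻¹' {gap n 0}) =
      ⟨sheet w b (gap n 0) v, rfl⟩ := Subtype.ext h
  rw [h2, monodromy_arc]

/-- The coordinate changes only at the passage through strip `k`, where it is multiplied on the left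
by `w k`. -/
theorem monodromy_loop (hw : w 0 = 1) {k : ℕ} (hk : k ≤ n) (v : G) :
    (coverCore_isCoveringMap n w).monodromy (loop n k) ⟨sheet w false (base n) v, rfl⟩ =
      ⟨sheet w false (base n) (w k * v), rfl⟩ := by
  rw [loop, IsCoveringMap.monodromy_trans_apply, monodromy_toPoint w hw]
  have h : sheet w false (gap n k) v = sheet w true (gap n k) (w k * v) := by
    rw [sheet_change, strip_eq hk (gap_inStrip n k), inv_mul_cancel_left]
  have h2 : (⟨sheet w false (gap n k) v, rfl⟩ : (coverCore n w).proj ⁻¹' {gap n k}) =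
      ⟨sheet w true (gap n k) (w k * v), rfl⟩ := Subtype.ext h
  rw [h2, ← monodromy_toPoint w hw true (gap_mem n k true), ← IsCoveringMap.monodromy_trans_apply,
    Homotopic.Quotient.trans_symm, IsCoveringMap.monodromy_refl]
  rfl

end cover

/-- The fundamental group of the punctured plane is free on the loops `loop n k`, `0 < k ≤ n`. -/
theorem exists_hom (n : ℕ) {G : Type} [Group G] (w : ℕ → G) (hw : w 0 = 1) :
    ∃ Φ : FundamentalGroup (Plane n) (base n) →* G, ∀ k ≤ n, Φ (loop n k) = w k := by
  let _ : TopologicalSpace G := ⊥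
  have _ : DiscreteTopology G := ⟨rfl⟩
  let cov := coverCore_isCoveringMap n w
  let s : G → (coverCore n w).proj ⁻¹' {base n} := fun v => ⟨sheet w false (base n) v, rfl⟩
  have hs : Function.Injective s := fun v v' h =>
    sheet_injective w false (base n) (congrArg Subtype.val h)
  -- The elements whose monodromy is a left multiplication form a subgroup that contains the loops.
  -- The multiplier is unique because `s` is injective, and it is the required homomorphism.
  have key : ∀ g : FundamentalGroup (Plane n) (base n), ∃ h : G, ∀ v,
      cov.monodromyPerm (base n) g (s v) = s (h * v) := by
    let H : Subgroup (FundamentalGroup (Plane n) (base n)) :=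
      { carrier := {g | ∃ h : G, ∀ v, cov.monodromyPerm (base n) g (s v) = s (h * v)}
        one_mem' := ⟨1, fun v => by rw [map_one, one_mul]; rfl⟩
        mul_mem' := by
          rintro a b ⟨h, ha⟩ ⟨h', hb⟩
          exact ⟨h * h', fun v => by rw [map_mul, Equiv.Perm.mul_apply, hb, ha, mul_assoc]⟩
        inv_mem' := by
          rintro a ⟨h, ha⟩
          refine ⟨h⁻¹, fun v => ?_⟩
          rw [map_inv, Equiv.Perm.inv_eq_iff_eq, ha, mul_inv_cancel_left] }
    have hH : H = ⊤ := eq_top_of_loop_mem H fun k hk => ⟨w k, fun v => monodromy_loop w hw hk v⟩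
    intro g
    exact (hH ▸ Subgroup.mem_top g : g ∈ H)
  choose Φ hΦ using key
  refine ⟨MonoidHom.mk' Φ fun a b => ?_, fun k hk => ?_⟩
  · have h := hΦ (a * b) 1
    rw [map_mul, Equiv.Perm.mul_apply, hΦ, hΦ] at h
    have := hs h
    simpa using this.symm
  · have h := (hΦ (loop n k) 1).symm.trans (monodromy_loop w hw hk 1)
    have := hs h
    simpa using this

end Plane

/-! ### Oriented discs in the sphere -/

/-- The area form of the complex plane. -/
def cross (a b : ℂ) : ℝ := a.re * b.im - a.im * b.re

theorem cross_map (L : ℂ →L[ℝ] ℂ) (a b : ℂ) :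
    cross (L a) (L b) = cross (L 1) (L Complex.I) * cross a b := by
  have h : ∀ z : ℂ, L z = z.re * L 1 + z.im * L Complex.I := fun z => by
    have h1 : z = z.re • (1 : ℂ) + z.im • Complex.I := by
      apply Complex.ext <;> simp
    conv_lhs => rw [h1]
    rw [map_add, map_smul, map_smul]
    simp
  rw [h a, h b]
  simp [cross]
  ring

/-- The parametrization of the sphere by a disc, as a curve in Euclidean space. -/
abbrev OrientedDisc.amb (j : OrientedDisc) (z : ℂ) : E3 := (j.toFun z : E3)

instance finrank_e3 : Fact (Module.finrank ℝ E3 = 2 + 1) := ⟨finrank_euclideanSpace_fin⟩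

section area

theorem contDiff_val_comp {j : ℂ → S2} (hj : ContMDiff 𝓘(ℝ, ℂ) (𝓡 2) ∞ j) :
    ContDiff ℝ ∞ (fun z => (j z : E3)) :=
  contMDiff_iff_contDiff.1 ((contMDiff_coe_sphere (E := E3) (n := 2) (m := ∞)).comp hj)

theorem mfderiv_val_mfderiv {j : ℂ → S2} (hj : ContMDiff 𝓘(ℝ, ℂ) (𝓡 2) ∞ j) (z a : ℂ) :
    mfderiv (𝓡 2) 𝓘(ℝ, E3) (Subtype.val : S2 → E3) (j z)
      (mfderiv 𝓘(ℝ, ℂ) (𝓡 2) j z (show TangentSpace 𝓘(ℝ, ℂ) z from a)) =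
      fderiv ℝ (fun z => (j z : E3)) z a := by
  have h := mfderiv_comp (I := 𝓘(ℝ, ℂ)) (I' := 𝓡 2) (I'' := 𝓘(ℝ, E3)) (f := j)
    (g := (Subtype.val : S2 → E3)) z
    ((contMDiff_coe_sphere (E := E3) (n := 2) (m := ∞)).mdifferentiableAt (by simp))
    (hj.mdifferentiableAt (by simp))
  rw [← mfderiv_eq_fderiv]
  exact (congrArg (fun L => L a) h).symm

theorem areaForm_mfderiv {j : ℂ → S2} (hj : ContMDiff 𝓘(ℝ, ℂ) (𝓡 2) ∞ j) (z a b : ℂ) :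
    areaForm (j z) (mfderiv 𝓘(ℝ, ℂ) (𝓡 2) j z (show TangentSpace 𝓘(ℝ, ℂ) z from a))
      (mfderiv 𝓘(ℝ, ℂ) (𝓡 2) j z (show TangentSpace 𝓘(ℝ, ℂ) z from b)) =
      Matrix.det ![(j z : E3).ofLp, (fderiv ℝ (fun z => (j z : E3)) z a).ofLp,
        (fderiv ℝ (fun z => (j z : E3)) z b).ofLp] := by
  rw [areaForm, mfderiv_val_mfderiv hj, mfderiv_val_mfderiv hj]

theorem det_three (u v w : Fin 3 → ℝ) : Matrix.det ![u, v, w] =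
    u 0 * v 1 * w 2 - u 0 * v 2 * w 1 - u 1 * v 0 * w 2 + u 1 * v 2 * w 0 + u 2 * v 0 * w 1 -
      u 2 * v 1 * w 0 := Matrix.det_fin_three _

theorem det_linear (p : E3) (L : ℂ →L[ℝ] E3) (a b : ℂ) :
    Matrix.det ![p.ofLp, (L a).ofLp, (L b).ofLp] =
      cross a b * Matrix.det ![p.ofLp, (L 1).ofLp, (L Complex.I).ofLp] := by
  have h : ∀ z : ℂ, L z = z.re • L 1 + z.im • L Complex.I := fun z => by
    have h1 : z = z.re • (1 : ℂ) + z.im • Complex.I := by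
      apply Complex.ext <;> simp
    conv_lhs => rw [h1]
    rw [map_add, map_smul, map_smul]
  rw [h a, h b]
  simp only [det_three, PiLp.add_apply, PiLp.smul_apply, smul_eq_mul, cross]
  ring

end area

namespace OrientedDisc

theorem contDiff_amb (j : OrientedDisc) : ContDiff ℝ ∞ j.amb := contDiff_val_comp j.smooth

/-- The area of the unit square at a point of an oriented disc. -/
noncomputable def jac (j : OrientedDisc) (z : ℂ) : ℝ :=
  Matrix.det ![(j.amb z).ofLp, (fderiv ℝ j.amb z 1).ofLp, (fderiv ℝ j.amb z Complex.I).ofLp]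

theorem jac_pos (j : OrientedDisc) (z : ℂ) : 0 < j.jac z := by
  have h := j.oriented z
  rwa [areaForm_mfderiv j.smooth] at h

theorem areaForm_eq (j : OrientedDisc) (z a b : ℂ) :
    areaForm (j.toFun z)
      (mfderiv 𝓘(ℝ, ℂ) (𝓡 2) j.toFun z (show TangentSpace 𝓘(ℝ, ℂ) z from a))
      (mfderiv 𝓘(ℝ, ℂ) (𝓡 2) j.toFun z (show TangentSpace 𝓘(ℝ, ℂ) z from b)) =
      cross a b * j.jac z := by
  rw [areaForm_mfderiv j.smooth, det_linear]
  rfl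

theorem norm_amb (j : OrientedDisc) (z : ℂ) : ‖j.amb z‖ = 1 := by
  simp

/-- The local inverse of an oriented disc. -/
theorem exists_local_inverse (j : OrientedDisc) (z₀ : ℂ) :
    ∃ K : E3 → ℂ, ContDiffAt ℝ ∞ K (j.amb z₀) ∧
      (∀ᶠ x : S2 in nhds (j.toFun z₀), j.toFun (K x) = x) ∧
      ∀ᶠ z in nhds z₀, K (j.amb z) = z := by
  -- The disc is thickened in the radial direction, so that the inverse function theorem applies in
  -- Euclidean space. Since `jac` does not vanish, the image of the derivative is transverse to the
  -- radius.
  let G : ℂ × ℝ → E3 := fun p => (1 + p.2) • j.amb p.1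
  have hG : ContDiff ℝ ∞ G :=
    (contDiff_const.add contDiff_snd).smul (j.contDiff_amb.comp contDiff_fst)
  have hd : HasFDerivAt j.amb (fderiv ℝ j.amb z₀) z₀ :=
    (j.contDiff_amb.differentiable (by simp) z₀).hasFDerivAt
  let L : ℂ × ℝ →L[ℝ] E3 := (fderiv ℝ j.amb z₀).comp (ContinuousLinearMap.fst ℝ ℂ ℝ) +
    (ContinuousLinearMap.snd ℝ ℂ ℝ).smulRight (j.amb z₀)
  have hL : HasFDerivAt G L (z₀, 0) := by
    have h1 : HasFDerivAt (fun p : ℂ × ℝ => 1 + p.2) (ContinuousLinearMap.snd ℝ ℂ ℝ) (z₀, 0) :=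
      hasFDerivAt_snd.const_add 1
    have h2 : HasFDerivAt (fun p : ℂ × ℝ => j.amb p.1)
        ((fderiv ℝ j.amb z₀).comp (ContinuousLinearMap.fst ℝ ℂ ℝ)) (z₀, 0) :=
      HasFDerivAt.comp (z₀, (0 : ℝ)) (f := Prod.fst) (g := j.amb) hd hasFDerivAt_fst
    have h3 := h1.smul h2
    refine h3.congr_fderiv ?_
    simp [L]
  have hinj : Function.Injective L := by
    rw [injective_iff_map_eq_zero]
    rintro ⟨a, r⟩ h
    have h0 : fderiv ℝ j.amb z₀ a = - (r • j.amb z₀) := by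
      have : fderiv ℝ j.amb z₀ a + r • j.amb z₀ = 0 := h
      exact eq_neg_of_add_eq_zero_left this
    have hz : ∀ b, cross a b * j.jac z₀ = 0 := fun b => by
      rw [jac, ← det_linear, h0]
      simp only [det_three, PiLp.neg_apply, PiLp.smul_apply, smul_eq_mul]
      ring
    have hc : ∀ b, cross a b = 0 := fun b =>
      (mul_eq_zero.1 (hz b)).resolve_right (j.jac_pos z₀).ne'
    have ha : a = 0 := by
      apply Complex.ext
      · simpa [cross] using hc Complex.I
      · simpa [cross] using hc 1
    subst ha
    have hr : r • j.amb z₀ = 0 := by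
      rw [map_zero] at h0
      exact neg_eq_zero.1 h0.symm
    rcases smul_eq_zero.1 hr with h1 | h1
    · rw [h1]; rfl
    · have := j.norm_amb z₀
      rw [h1, norm_zero] at this
      norm_num at this
  have hfin : Module.finrank ℝ (ℂ × ℝ) = Module.finrank ℝ E3 := by
    rw [Module.finrank_prod, Complex.finrank_real_complex, Module.finrank_self,
      finrank_euclideanSpace_fin]
  let e : (ℂ × ℝ) ≃L[ℝ] E3 :=
    (LinearEquiv.ofInjectiveOfFinrankEq (L : ℂ × ℝ →ₗ[ℝ] E3) hinj hfin).toContinuousLinearEquiv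
  have he : HasFDerivAt G (e : ℂ × ℝ →L[ℝ] E3) (z₀, 0) := by
    refine hL.congr_fderiv ?_
    ext p <;> rfl
  have hGa : ContDiffAt ℝ ∞ G (z₀, 0) := hG.contDiffAt
  let P := hGa.toOpenPartialHomeomorph G he (by simp)
  have hG0 : G (z₀, 0) = j.amb z₀ := by simp [G]
  have hs : (z₀, (0 : ℝ)) ∈ P.source := hGa.mem_toOpenPartialHomeomorph_source he (by simp)
  have ht : j.amb z₀ ∈ P.target := by
    rw [← hG0]
    exact P.map_source hs
  have hcoe : ∀ p, P p = G p := fun p => rfl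
  refine ⟨fun x => (P.symm x).1, ?_, ?_, ?_⟩
  · have := hGa.to_localInverse he (by simp)
    rw [hG0] at this
    exact contDiffAt_fst.comp _ this
  · have h1 : ∀ᶠ y in nhds (j.amb z₀), G (P.symm y) = y := by
      filter_upwards [P.open_target.mem_nhds ht] with y hy
      exact P.right_inv hy
    have h2 : ∀ᶠ y in nhds (j.amb z₀), |(P.symm y).2| < 1 := by
      have hc : ContinuousAt (fun y => |(P.symm y).2|) (j.amb z₀) :=
        (continuous_abs.comp continuous_snd).continuousAt.comp (P.continuousAt_symm ht)
      refine hc.eventually_lt continuousAt_const ?_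
      rw [← hG0, ← hcoe, P.left_inv hs]
      simp
    have hcv : Filter.Tendsto (Subtype.val : S2 → E3) (nhds (j.toFun z₀)) (nhds (j.amb z₀)) :=
      continuous_subtype_val.continuousAt
    filter_upwards [hcv.eventually h1, hcv.eventually h2] with x hx1 hx2
    have hx3 : (1 + (P.symm x).2) • j.amb (P.symm x).1 = x := hx1
    have hx4 : ‖(x : E3)‖ = 1 := by simp
    have hx5 : |1 + (P.symm x).2| = 1 := by
      have := congrArg norm hx3
      rwa [hx4, norm_smul, j.norm_amb, mul_one, Real.norm_eq_abs] at this
    -- A point of the sphere has norm 1, so the radial factor is 1 or -1, and a radial coordinate of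
    -- absolute value less than 1 excludes -1.
    have hx6 : (P.symm x).2 = 0 := by
      rw [abs_lt] at hx2
      rw [abs_of_pos (by linarith)] at hx5
      linarith
    rw [hx6, add_zero, one_smul] at hx3
    exact Subtype.ext hx3
  · have h1 : ∀ᶠ p in nhds (z₀, (0 : ℝ)), P.symm (G p) = p := by
      filter_upwards [P.open_source.mem_nhds hs] with p hp
      exact P.left_inv hp
    have hcv : Filter.Tendsto (fun z : ℂ => (z, (0 : ℝ))) (nhds z₀) (nhds (z₀, 0)) :=
      (by fun_prop : Continuous fun z : ℂ => (z, (0 : ℝ))).continuousAt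
    filter_upwards [hcv.eventually h1] with z hz
    have hz' : G (z, 0) = j.amb z := by simp [G]
    rw [← hz', hz]

theorem isOpenMap (j : OrientedDisc) : IsOpenMap j.toFun := by
  rw [isOpenMap_iff_nhds_le]
  intro z₀
  obtain ⟨K, hK, h1, h2⟩ := j.exists_local_inverse z₀
  have hc : Filter.Tendsto (fun x : S2 => K x) (nhds (j.toFun z₀)) (nhds z₀) := by
    have h3 : K (j.amb z₀) = z₀ := h2.self_of_nhds
    have h4 : ContinuousAt (fun x : S2 => K x) (j.toFun z₀) :=
      ContinuousAt.comp (f := (Subtype.val : S2 → E3)) (g := K) hK.continuousAt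
        continuous_subtype_val.continuousAt
    have h5 : Filter.Tendsto (fun x : S2 => K x) (nhds (j.toFun z₀)) (nhds (K (j.amb z₀))) :=
      h4.tendsto
    rwa [h3] at h5
  intro s hs
  rw [Filter.mem_map] at hs
  filter_upwards [h1, hc hs] with x hx hx'
  rw [← hx]
  exact hx'

theorem isOpenEmbedding (j : OrientedDisc) : Topology.IsOpenEmbedding j.toFun :=
  .of_continuous_injective_isOpenMap j.smooth.continuous j.injective j.isOpenMap

/-- The tangent vectors of the sphere at a point of an oriented disc. -/
theorem mfderiv_surjective (j : OrientedDisc) (z : ℂ) :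
    Function.Surjective (mfderiv 𝓘(ℝ, ℂ) (𝓡 2) j.toFun z) := by
  let L : ℂ →L[ℝ] EuclideanSpace ℝ (Fin 2) := mfderiv 𝓘(ℝ, ℂ) (𝓡 2) j.toFun z
  have hinj : Function.Injective (L : ℂ →ₗ[ℝ] EuclideanSpace ℝ (Fin 2)) := by
    rw [injective_iff_map_eq_zero]
    intro a ha
    have hc : ∀ b, cross a b = 0 := fun b => by
      have h := j.areaForm_eq z a b
      have h0 : mfderiv 𝓘(ℝ, ℂ) (𝓡 2) j.toFun z (show TangentSpace 𝓘(ℝ, ℂ) z from a) = 0 := ha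
      rw [h0] at h
      have h1 : ∀ v, areaForm (j.toFun z) 0 v = 0 := fun v => by
        have h2 : (show E3 from mfderiv (𝓡 2) 𝓘(ℝ, E3) (Subtype.val : S2 → E3) (j.toFun z) 0) =
          (0 : E3) := map_zero _
        rw [areaForm, h2, det_three]
        simp
      rw [h1] at h
      exact (mul_eq_zero.1 h.symm).resolve_right (j.jac_pos z).ne'
    apply Complex.ext
    · simpa [cross] using hc Complex.I
    · simpa [cross] using hc 1
  have hfin : Module.finrank ℝ ℂ = Module.finrank ℝ (EuclideanSpace ℝ (Fin 2)) := by
    rw [Complex.finrank_real_complex, finrank_euclideanSpace_fin]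
  exact (LinearMap.injective_iff_surjective_of_finrank_eq_finrank hfin).1 hinj

end OrientedDisc

/-! ### Diffeomorphisms of the sphere with support in a disc -/

section planar

/-- A diffeomorphism of the plane with compact support preserves the orientation. -/
theorem cross_fderiv_pos {h h' : ℂ → ℂ} (hh : ContDiff ℝ ∞ h) (hh' : ContDiff ℝ ∞ h')
    (hinv : ∀ z, h' (h z) = z) {R : ℝ} (hR : ∀ z, R ≤ ‖z‖ → h z = z) (z : ℂ) :
    0 < cross (fderiv ℝ h z 1) (fderiv ℝ h z Complex.I) := by
  have hcont : Continuous fun z => cross (fderiv ℝ h z 1) (fderiv ℝ h z Complex.I) := by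
    have h1 : Continuous (fderiv ℝ h) := hh.continuous_fderiv (by simp)
    have h2 : ∀ v : ℂ, Continuous fun z => fderiv ℝ h z v := fun v => h1.clm_apply continuous_const
    have := h2 1
    have := h2 Complex.I
    unfold cross
    fun_prop
  have hne : ∀ z, cross (fderiv ℝ h z 1) (fderiv ℝ h z Complex.I) ≠ 0 := by
    intro z h0
    have hc : fderiv ℝ (h' ∘ h) z = (fderiv ℝ h' (h z)).comp (fderiv ℝ h z) :=
      fderiv_comp z (hh'.differentiable (by simp) _) (hh.differentiable (by simp) _)
    have hid : h' ∘ h = id := funext hinv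
    rw [hid, fderiv_id] at hc
    have h1 : ∀ v, fderiv ℝ h' (h z) (fderiv ℝ h z v) = v := fun v =>
      (congrArg (fun L => L v) hc).symm
    have h2 := cross_map (fderiv ℝ h' (h z)) (fderiv ℝ h z 1) (fderiv ℝ h z Complex.I)
    rw [h1, h1, h0, mul_zero] at h2
    simp [cross] at h2
  have hfar : 0 < cross (fderiv ℝ h (|R| + 1 : ℝ) 1) (fderiv ℝ h (|R| + 1 : ℝ) Complex.I) := by
    have hev : h =ᶠ[nhds ((|R| + 1 : ℝ) : ℂ)] id := by
      have hop : IsOpen {z : ℂ | R < ‖z‖} := isOpen_lt continuous_const continuous_norm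
      have hmem : ((|R| + 1 : ℝ) : ℂ) ∈ {z : ℂ | R < ‖z‖} := by
        change R < ‖((|R| + 1 : ℝ) : ℂ)‖
        rw [Complex.norm_real, Real.norm_eq_abs, abs_of_pos (by positivity)]
        linarith [le_abs_self R]
      filter_upwards [hop.mem_nhds hmem] with z hz
      exact hR z (le_of_lt hz)
    rw [hev.fderiv_eq, fderiv_id]
    simp [cross]
  -- The Jacobian determinant is continuous, vanishes nowhere and is positive far away, so the
  -- intermediate value theorem on the connected plane applies.
  by_contra hneg
  obtain ⟨w, _, hw⟩ := isPreconnected_univ.intermediate_value (Set.mem_univ z)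
    (Set.mem_univ ((|R| + 1 : ℝ) : ℂ)) hcont.continuousOn
    (show (0 : ℝ) ∈ Set.Icc _ _ from ⟨not_lt.1 hneg, hfar.le⟩)
  exact hne w hw

/-- The turn over the angle `s π β(r)` of the circle with radius `r`. -/
noncomputable def turn (s : ℝ) (z : ℂ) : ℂ :=
  z * Complex.exp ((s * (Real.pi * Real.smoothTransition (2 - ‖z‖)) : ℝ) * Complex.I)

theorem norm_turn (s : ℝ) (z : ℂ) : ‖turn s z‖ = ‖z‖ := by
  rw [turn, norm_mul, Complex.norm_exp_ofReal_mul_I, mul_one]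

theorem turn_turn (s : ℝ) (z : ℂ) : turn (-s) (turn s z) = z := by
  rw [turn, norm_turn, turn, mul_assoc, ← Complex.exp_add, ← add_mul, ← Complex.ofReal_add]
  simp

/-- The norm is not smooth at 0, but the angle is constant on the unit disc; away from 0 this is a
composition of smooth maps. -/
theorem contDiff_turn (s : ℝ) : ContDiff ℝ ∞ (turn s) := by
  rw [contDiff_iff_contDiffAt]
  intro z
  rcases eq_or_ne z 0 with rfl | hz
  · have hev : turn s =ᶠ[nhds 0] fun z => z * Complex.exp ((s * Real.pi : ℝ) * Complex.I) := by
      filter_upwards [Metric.ball_mem_nhds (0 : ℂ) one_pos] with z hz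
      rw [turn, Real.smoothTransition.one_of_one_le, mul_one]
      have : ‖z‖ < 1 := by simpa using hz
      linarith
    refine ContDiffAt.congr_of_eventuallyEq ?_ hev
    exact contDiffAt_id.mul contDiffAt_const
  · have h1 : ContDiffAt ℝ ∞ (fun z : ℂ => ‖z‖) z := contDiffAt_norm ℝ hz
    have h2 : ContDiffAt ℝ ∞ (fun z : ℂ => Real.smoothTransition (2 - ‖z‖)) z :=
      Real.smoothTransition.contDiffAt.comp z (contDiffAt_const.sub h1)
    have h3 : ContDiffAt ℝ ∞ (fun z : ℂ => s * (Real.pi * Real.smoothTransition (2 - ‖z‖))) z :=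
      contDiffAt_const.mul (contDiffAt_const.mul h2)
    have h4 : ContDiffAt ℝ ∞ (fun z : ℂ =>
        ((s * (Real.pi * Real.smoothTransition (2 - ‖z‖)) : ℝ) : ℂ)) z :=
      Complex.ofRealCLM.contDiff.contDiffAt.comp z h3
    exact contDiffAt_id.mul (h4.mul contDiffAt_const).cexp

/-- The half-turn that exchanges `k` and `k + 1`, in the positive or negative direction. -/
noncomputable def halfTurn' (s : ℝ) (k : ℕ) (z : ℂ) : ℂ :=
  (k + 1 / 2) + turn s (2 * (z - (k + 1 / 2))) / 2

theorem halfTurn'_one (k : ℕ) : halfTurn' 1 k = Plane.halfTurn k := by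
  ext z
  rw [halfTurn', Plane.halfTurn, turn]
  push_cast
  ring_nf

theorem halfTurn'_halfTurn' (s : ℝ) (k : ℕ) (z : ℂ) : halfTurn' (-s) k (halfTurn' s k z) = z := by
  have h : 2 * (halfTurn' s k z - (k + 1 / 2)) = turn s (2 * (z - (k + 1 / 2))) := by
    rw [halfTurn']
    ring
  rw [halfTurn', h, turn_turn]
  ring

theorem contDiff_halfTurn' (s : ℝ) (k : ℕ) : ContDiff ℝ ∞ (halfTurn' s k) :=
  contDiff_const.add (((contDiff_turn s).comp
    (contDiff_const.mul (contDiff_id.sub contDiff_const))).div_const 2)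

theorem halfTurn'_eq_self {s : ℝ} {k : ℕ} {z : ℂ} (h : 1 ≤ ‖z - (k + 1 / 2)‖) :
    halfTurn' s k z = z := by
  rw [halfTurn', turn, Real.smoothTransition.zero_of_nonpos]
  · simp
  · rw [norm_mul, Complex.norm_ofNat]
    linarith

theorem halfTurn'_eq_self_of_large {s : ℝ} {k : ℕ} {z : ℂ} (h : (k + 2 : ℝ) ≤ ‖z‖) :
    halfTurn' s k z = z := by
  refine halfTurn'_eq_self ?_
  have h1 : ‖(k + 1 / 2 : ℂ)‖ = k + 1 / 2 := by
    have : (k + 1 / 2 : ℂ) = ((k + 1 / 2 : ℝ) : ℂ) := by push_cast; rfl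
    rw [this, Complex.norm_real, Real.norm_eq_abs, abs_of_pos (by positivity)]
  have h2 := norm_sub_norm_le z (k + 1 / 2)
  rw [h1] at h2
  linarith

end planar

namespace OrientedDisc

open Classical in
/-- The extension by the identity to the sphere of a self-map of a disc. -/
noncomputable def extend (j : OrientedDisc) (h : ℂ → ℂ) (x : S2) : S2 :=
  if hx : ∃ z, j.toFun z = x then j.toFun (h hx.choose) else x

theorem extend_apply (j : OrientedDisc) (h : ℂ → ℂ) (z : ℂ) :
    j.extend h (j.toFun z) = j.toFun (h z) := by
  have hx : ∃ w, j.toFun w = j.toFun z := ⟨z, rfl⟩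
  rw [extend, dif_pos hx, j.injective hx.choose_spec]

theorem extend_of_notMem (j : OrientedDisc) (h : ℂ → ℂ) {x : S2} (hx : x ∉ Set.range j.toFun) :
    j.extend h x = x := dif_neg hx

theorem extend_extend (j : OrientedDisc) {h h' : ℂ → ℂ} (hinv : ∀ z, h' (h z) = z) (x : S2) :
    j.extend h' (j.extend h x) = x := by
  by_cases hx : x ∈ Set.range j.toFun
  · obtain ⟨z, rfl⟩ := hx
    rw [extend_apply, extend_apply, hinv]
  · rw [extend_of_notMem j h hx, extend_of_notMem j h' hx]

/-- The image of the ball outside which `h` is the identity is compact, hence closed, so a point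
that is not in the disc has a neighbourhood that misses it. -/
theorem eventually_extend (j : OrientedDisc) {h : ℂ → ℂ} {R : ℝ} (hR : ∀ z, R ≤ ‖z‖ → h z = z)
    {x : S2} (hx : x ∉ Set.range j.toFun) : j.extend h =ᶠ[nhds x] id := by
  have hc : IsClosed (j.toFun '' Metric.closedBall 0 R) :=
    ((isCompact_closedBall 0 R).image j.smooth.continuous).isClosed
  have hx' : x ∈ (j.toFun '' Metric.closedBall 0 R)ᶜ := fun ⟨z, _, hz⟩ => hx ⟨z, hz⟩
  filter_upwards [hc.isOpen_compl.mem_nhds hx'] with y hy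
  by_cases h1 : y ∈ Set.range j.toFun
  · obtain ⟨z, rfl⟩ := h1
    rw [extend_apply, hR]
    · rfl
    · by_contra h2
      exact hy ⟨z, by simpa using (not_le.1 h2).le, rfl⟩
  · exact extend_of_notMem j h h1

/-- Inside the disc the local inverse `K` serves as a chart; elsewhere the extension is locally the
identity. -/
theorem contMDiff_extend (j : OrientedDisc) {h : ℂ → ℂ} (hh : ContDiff ℝ ∞ h) {R : ℝ}
    (hR : ∀ z, R ≤ ‖z‖ → h z = z) : ContMDiff (𝓡 2) (𝓡 2) ∞ (j.extend h) := by
  intro x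
  by_cases hx : x ∈ Set.range j.toFun
  · obtain ⟨z, rfl⟩ := hx
    obtain ⟨K, hK, h1, h2⟩ := j.exists_local_inverse z
    have hev : j.extend h =ᶠ[nhds (j.toFun z)] fun x => j.toFun (h (K x)) := by
      filter_upwards [h1] with y hy
      conv_lhs => rw [← hy]
      rw [extend_apply]
    have h3 : ContMDiffAt (𝓡 2) 𝓘(ℝ, ℂ) ∞ (fun x : S2 => K x) (j.toFun z) :=
      ContMDiffAt.comp (I' := 𝓘(ℝ, E3)) (g := K) (f := (Subtype.val : S2 → E3)) (j.toFun z)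
        hK.contMDiffAt ((contMDiff_coe_sphere (E := E3) (n := 2) (m := ∞)) _)
    have h4 : ContMDiff 𝓘(ℝ, ℂ) (𝓡 2) ∞ fun z => j.toFun (h z) := j.smooth.comp hh.contMDiff
    exact ((h4 _).comp (j.toFun z) h3).congr_of_eventuallyEq hev
  · exact (contMDiff_id x).congr_of_eventuallyEq (j.eventually_extend hR hx)

theorem orientationPreserving_extend (j : OrientedDisc) {h : ℂ → ℂ} (hh : ContDiff ℝ ∞ h)
    {R : ℝ} (hR : ∀ z, R ≤ ‖z‖ → h z = z)
    (hpos : ∀ z, 0 < cross (fderiv ℝ h z 1) (fderiv ℝ h z Complex.I)) :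
    OrientationPreserving (j.extend h) := by
  intro x u v
  by_cases hx : x ∈ Set.range j.toFun
  · obtain ⟨z, rfl⟩ := hx
    obtain ⟨a, rfl⟩ := j.mfderiv_surjective z u
    obtain ⟨b, rfl⟩ := j.mfderiv_surjective z v
    have hf := j.contMDiff_extend hh hR
    have e1 : mfderiv 𝓘(ℝ, ℂ) (𝓡 2) (j.extend h ∘ j.toFun) z =
        (mfderiv (𝓡 2) (𝓡 2) (j.extend h) (j.toFun z)).comp
          (mfderiv 𝓘(ℝ, ℂ) (𝓡 2) j.toFun z) :=
      mfderiv_comp z (hf.mdifferentiableAt (by simp)) (j.smooth.mdifferentiableAt (by simp))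
    have e2 : mfderiv 𝓘(ℝ, ℂ) (𝓡 2) (j.toFun ∘ h) z =
        (mfderiv 𝓘(ℝ, ℂ) (𝓡 2) j.toFun (h z)).comp (mfderiv 𝓘(ℝ, ℂ) 𝓘(ℝ, ℂ) h z) :=
      mfderiv_comp z (j.smooth.mdifferentiableAt (by simp))
        (hh.contMDiff.mdifferentiableAt (by simp))
    have e3 : j.extend h ∘ j.toFun = j.toFun ∘ h := funext fun w => j.extend_apply h w
    rw [mfderiv_eq_fderiv] at e2
    -- The points `j.extend h (j.toFun z)` and `j.toFun (h z)` are equal, but their tangent spaces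
    -- are different types. The identity is stated for an arbitrary map, derivative and point, and
    -- proved by substitution.
    have gen : ∀ (F : ℂ → S2) (L : ℂ →L[ℝ] EuclideanSpace ℝ (Fin 2)) (y : S2),
        F = j.toFun ∘ h → L = mfderiv 𝓘(ℝ, ℂ) (𝓡 2) F z → y = F z →
        areaForm y (show TangentSpace (𝓡 2) y from L a) (show TangentSpace (𝓡 2) y from L b) =
          cross (fderiv ℝ h z a) (fderiv ℝ h z b) * j.jac (h z) := by
      rintro F L y rfl rfl rfl
      rw [← j.areaForm_eq (h z), e2]
      rfl
    have gen2 : ∀ a b : ℂ, 0 < cross (fderiv ℝ h z a) (fderiv ℝ h z b) * j.jac (h z) ↔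
        0 < cross a b * j.jac z := fun a b => by
      rw [cross_map, mul_pos_iff_of_pos_right (j.jac_pos _),
        mul_pos_iff_of_pos_right (j.jac_pos _), mul_pos_iff_of_pos_left (hpos z)]
    have e4 := gen _ _ (j.extend h (j.toFun z)) e3 e1.symm rfl
    have e5 := j.areaForm_eq z a b
    refine Iff.trans (iff_of_eq (congrArg (fun t => 0 < t) e4)) ?_
    refine Iff.trans ?_ (iff_of_eq (congrArg (fun t => 0 < t) e5)).symm
    exact gen2 a b
  · have hev := j.eventually_extend hR hx
    have e1 : mfderiv (𝓡 2) (𝓡 2) (j.extend h) x = mfderiv (𝓡 2) (𝓡 2) (id : S2 → S2) x :=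
      hev.mfderiv_eq
    have gen : ∀ (L : EuclideanSpace ℝ (Fin 2) →L[ℝ] EuclideanSpace ℝ (Fin 2)) (y : S2), y = x →
        L = mfderiv (𝓡 2) (𝓡 2) (id : S2 → S2) x →
        areaForm y (show TangentSpace (𝓡 2) y from L u) (show TangentSpace (𝓡 2) y from L v) =
          areaForm x u v := by
      rintro L y rfl rfl
      rw [mfderiv_id]
      rfl
    exact iff_of_eq (congrArg (fun t => 0 < t) (gen _ _ (j.extend_of_notMem h hx) e1))

/-- A diffeomorphism of the plane with compact support extends to the sphere. -/
theorem exists_diffPlus (j : OrientedDisc) {D : Finset S2} {h h' : ℂ → ℂ} (hh : ContDiff ℝ ∞ h)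
    (hh' : ContDiff ℝ ∞ h') (hinv : ∀ z, h' (h z) = z) (hinv' : ∀ z, h (h' z) = z) {R : ℝ}
    (hR : ∀ z, R ≤ ‖z‖ → h z = z) (hD : ∀ z, j.toFun (h z) ∈ D ↔ j.toFun z ∈ D) :
    ∃ f : DiffPlus D, ∀ z, (f : Equiv.Perm S2) (j.toFun z) = j.toFun (h z) := by
  have hR' : ∀ z, R ≤ ‖z‖ → h' z = z := fun z hz => by
    conv_lhs => rw [← hR z hz]
    exact hinv z
  refine ⟨⟨⟨j.extend h, j.extend h', j.extend_extend hinv, j.extend_extend hinv'⟩,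
    j.contMDiff_extend hh hR, j.contMDiff_extend hh' hR',
    j.orientationPreserving_extend hh hR (cross_fderiv_pos hh hh' hinv hR), fun x => ?_⟩,
    j.extend_apply h⟩
  change j.extend h x ∈ D ↔ x ∈ D
  by_cases hx : x ∈ Set.range j.toFun
  · obtain ⟨z, rfl⟩ := hx
    rw [extend_apply]
    exact hD z
  · rw [extend_of_notMem j h hx]

end OrientedDisc

/-! ### Stereographic coordinates -/

noncomputable section stereo

/-- The numerator of the stereographic projection with centre `e 2`. -/
def stereoNum (e : Fin 3 → E3) (w : ℂ) : E3 :=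
  (2 * w.re) • e 0 + (2 * w.im) • e 1 + (w.re ^ 2 + w.im ^ 2 - 1) • e 2

/-- The inverse of the stereographic projection with centre `e 2`, as a map to Euclidean space. -/
def stereoVec (e : Fin 3 → E3) (w : ℂ) : E3 := (w.re ^ 2 + w.im ^ 2 + 1)⁻¹ • stereoNum e w

variable {e : Fin 3 → E3}

/-- This is the identity 4|w|² + (|w|² - 1)² = (|w|² + 1)². -/
theorem norm_stereoVec (he : Orthonormal ℝ e) (w : ℂ) : ‖stereoVec e w‖ = 1 := by
  have hpos : 0 < w.re ^ 2 + w.im ^ 2 + 1 := by positivity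
  have h1 : ‖stereoNum e w‖ ^ 2 = (w.re ^ 2 + w.im ^ 2 + 1) ^ 2 := by
    rw [← real_inner_self_eq_norm_sq]
    have h := he.inner_right_fintype ![2 * w.re, 2 * w.im, w.re ^ 2 + w.im ^ 2 - 1]
    have hn : stereoNum e w = ∑ i, (![2 * w.re, 2 * w.im, w.re ^ 2 + w.im ^ 2 - 1] : Fin 3 → ℝ) i • e i := by
      simp [stereoNum, Fin.sum_univ_three]
    rw [hn, he.inner_sum, Fin.sum_univ_three]
    simp
    ring
  have h2 : ‖stereoNum e w‖ = w.re ^ 2 + w.im ^ 2 + 1 :=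
    (sq_eq_sq₀ (norm_nonneg _) hpos.le).1 h1
  rw [stereoVec, norm_smul, h2, norm_inv, Real.norm_of_nonneg hpos.le, inv_mul_cancel₀ hpos.ne']

theorem contDiff_re : ContDiff ℝ ∞ Complex.re := Complex.reCLM.contDiff
theorem contDiff_im : ContDiff ℝ ∞ Complex.im := Complex.imCLM.contDiff

theorem contDiff_stereoVec (e : Fin 3 → E3) : ContDiff ℝ ∞ (stereoVec e) := by
  have h1 := contDiff_re
  have h2 := contDiff_im
  have h3 : ContDiff ℝ ∞ fun w : ℂ => (w.re ^ 2 + w.im ^ 2 + 1)⁻¹ :=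
    ContDiff.inv (by fun_prop) fun w => by positivity
  have h4 : ContDiff ℝ ∞ (stereoNum e) := by
    unfold stereoNum
    fun_prop
  exact h3.smul h4

theorem inner_stereoVec (he : Orthonormal ℝ e) (w : ℂ) :
    inner ℝ (e 0) (stereoVec e w) = (w.re ^ 2 + w.im ^ 2 + 1)⁻¹ * (2 * w.re) ∧
    inner ℝ (e 1) (stereoVec e w) = (w.re ^ 2 + w.im ^ 2 + 1)⁻¹ * (2 * w.im) ∧
    inner ℝ (e 2) (stereoVec e w) = (w.re ^ 2 + w.im ^ 2 + 1)⁻¹ * (w.re ^ 2 + w.im ^ 2 - 1) := by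
  have h : ∀ i k, inner ℝ (e i) (e k) = if i = k then 1 else (0 : ℝ) :=
    orthonormal_iff_ite.1 he
  refine ⟨?_, ?_, ?_⟩ <;>
    simp only [stereoVec, stereoNum, inner_smul_right, inner_add_right, h] <;> simp

/-- The last coordinate is 1 - 2 / (|w|² + 1); it recovers the common denominator, and then the
other two coordinates recover `w`. -/
theorem stereoVec_injective (he : Orthonormal ℝ e) : Function.Injective (stereoVec e) := by
  intro w w' h
  obtain ⟨h0, h1, h2⟩ := inner_stereoVec he w
  obtain ⟨k0, k1, k2⟩ := inner_stereoVec he w'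
  rw [h] at h0 h1 h2
  rw [h0] at k0
  rw [h1] at k1
  rw [h2] at k2
  have e1 : ∀ w : ℂ, (w.re ^ 2 + w.im ^ 2 + 1)⁻¹ * (w.re ^ 2 + w.im ^ 2 - 1) =
      1 - 2 * (w.re ^ 2 + w.im ^ 2 + 1)⁻¹ := fun w => by
    have : w.re ^ 2 + w.im ^ 2 + 1 ≠ 0 := by positivity
    field_simp
    ring
  rw [e1, e1] at k2
  have e2 : (w.re ^ 2 + w.im ^ 2 + 1)⁻¹ = (w'.re ^ 2 + w'.im ^ 2 + 1)⁻¹ := by linarith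
  have e3 : (w'.re ^ 2 + w'.im ^ 2 + 1)⁻¹ ≠ 0 := by positivity
  rw [e2] at k0 k1
  exact Complex.ext (by simpa using mul_left_cancel₀ e3 k0)
    (by simpa using mul_left_cancel₀ e3 k1)

/-- The derivative of the scalar factor contributes only multiples of the first row, so the
determinant is the cube of the factor times that of the numerator. The negative sign is the reason
why `stereo` asks for a negatively oriented frame. -/
theorem stereoVec_jac (e : Fin 3 → E3) (w : ℂ) :
    Matrix.det ![(stereoVec e w).ofLp, (fderiv ℝ (stereoVec e) w 1).ofLp,
      (fderiv ℝ (stereoVec e) w Complex.I).ofLp] =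
    -4 * ((w.re ^ 2 + w.im ^ 2 + 1)⁻¹) ^ 2 *
      Matrix.det ![(e 0).ofLp, (e 1).ofLp, (e 2).ofLp] := by
  have hpos : w.re ^ 2 + w.im ^ 2 + 1 ≠ 0 := by positivity
  have hre : HasFDerivAt Complex.re Complex.reCLM w := Complex.reCLM.hasFDerivAt
  have him : HasFDerivAt Complex.im Complex.imCLM w := Complex.imCLM.hasFDerivAt
  have hs : DifferentiableAt ℝ (fun w : ℂ => (w.re ^ 2 + w.im ^ 2 + 1)⁻¹) w :=
    (((hre.differentiableAt.pow 2).add (him.differentiableAt.pow 2)).add_const 1).inv hpos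
  have hN : HasFDerivAt (stereoNum e) _ w :=
    (((hre.const_mul 2).smul_const (e 0)).add ((him.const_mul 2).smul_const (e 1))).add
      ((((hre.pow 2).add (him.pow 2)).sub_const 1).smul_const (e 2))
  have h : HasFDerivAt (stereoVec e) _ w := hs.hasFDerivAt.smul hN
  have hd : ∀ a : ℂ, fderiv ℝ (stereoVec e) w a = (w.re ^ 2 + w.im ^ 2 + 1)⁻¹ •
      ((2 * a.re) • e 0 + (2 * a.im) • e 1 + (2 * w.re * a.re + 2 * w.im * a.im) • e 2) +
      (fderiv ℝ (fun w : ℂ => (w.re ^ 2 + w.im ^ 2 + 1)⁻¹) w a) • stereoNum e w := fun a => by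
    rw [h.fderiv]
    simp
  have hsc : ∀ (t p q : ℝ) (N A B : E3), Matrix.det ![(t • N).ofLp, (t • A + p • N).ofLp,
      (t • B + q • N).ofLp] = t ^ 3 * Matrix.det ![N.ofLp, A.ofLp, B.ofLp] := by
    intro t p q N A B
    simp only [det_three, PiLp.add_apply, PiLp.smul_apply, smul_eq_mul]
    ring
  have hdet : Matrix.det ![(stereoNum e w).ofLp,
      ((2 * (1 : ℂ).re) • e 0 + (2 * (1 : ℂ).im) • e 1 +
        (2 * w.re * (1 : ℂ).re + 2 * w.im * (1 : ℂ).im) • e 2).ofLp,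
      ((2 * Complex.I.re) • e 0 + (2 * Complex.I.im) • e 1 +
        (2 * w.re * Complex.I.re + 2 * w.im * Complex.I.im) • e 2).ofLp] =
      -4 * (w.re ^ 2 + w.im ^ 2 + 1) * Matrix.det ![(e 0).ofLp, (e 1).ofLp, (e 2).ofLp] := by
    simp only [det_three, stereoNum, PiLp.add_apply, PiLp.smul_apply, smul_eq_mul,
      Complex.one_re, Complex.one_im, Complex.I_re, Complex.I_im]
    ring
  rw [hd, hd, stereoVec, hsc, hdet]
  field_simp

theorem contMDiff_stereo (he : Orthonormal ℝ e) : ContMDiff 𝓘(ℝ, ℂ) (𝓡 2) ∞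
    (fun w => (⟨stereoVec e w, by simp [norm_stereoVec he]⟩ : S2)) :=
  ContMDiff.codRestrict_sphere (contDiff_stereoVec e).contMDiff _

/-- The inverse of the stereographic projection with centre `e 2`. -/
def stereo (e : Fin 3 → E3) (he : Orthonormal ℝ e)
    (hdet : Matrix.det ![(e 0).ofLp, (e 1).ofLp, (e 2).ofLp] < 0) : OrientedDisc where
  toFun w := ⟨stereoVec e w, by simp [norm_stereoVec he]⟩
  smooth := contMDiff_stereo he
  injective w w' h := stereoVec_injective he (congrArg Subtype.val h)
  oriented w := by
    refine lt_of_lt_of_eq ?_ (areaForm_mfderiv (contMDiff_stereo he) w 1 Complex.I).symm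
    refine lt_of_lt_of_eq ?_ (stereoVec_jac e w).symm
    have : 0 < ((w.re ^ 2 + w.im ^ 2 + 1)⁻¹) ^ 2 := by positivity
    nlinarith

theorem stereoVec_zero (e : Fin 3 → E3) : stereoVec e 0 = - e 2 := by
  simp [stereoVec, stereoNum]

theorem exists_stereoVec_eq (b : OrthonormalBasis (Fin 3) ℝ E3) {p : E3} (hp : ‖p‖ = 1)
    (hne : p ≠ b 2) : ∃ w, stereoVec b w = p := by
  have hsum : p = inner ℝ (b 0) p • b 0 + inner ℝ (b 1) p • b 1 + inner ℝ (b 2) p • b 2 := by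
    conv_lhs => rw [← b.sum_repr' p, Fin.sum_univ_three]
  have hn : inner ℝ (b 0) p ^ 2 + inner ℝ (b 1) p ^ 2 + inner ℝ (b 2) p ^ 2 = 1 := by
    have := b.sum_sq_norm_inner_right p
    rw [Fin.sum_univ_three, hp] at this
    simpa using this
  generalize inner ℝ (b 0) p = x at hsum hn
  generalize inner ℝ (b 1) p = y at hsum hn
  generalize inner ℝ (b 2) p = c at hsum hn
  have hc : c ≠ 1 := by
    rintro rfl
    have h1 : x = 0 := by nlinarith [sq_nonneg x, sq_nonneg y]
    have h2 : y = 0 := by nlinarith [sq_nonneg x, sq_nonneg y]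
    rw [h1, h2] at hsum
    exact hne (by simpa using hsum)
  have hc' : 1 - c ≠ 0 := sub_ne_zero.2 hc.symm
  refine ⟨⟨x / (1 - c), y / (1 - c)⟩, ?_⟩
  have h1 : (x / (1 - c)) ^ 2 + (y / (1 - c)) ^ 2 = (1 + c) / (1 - c) := by
    field_simp
    linear_combination hn
  have h2 : ((1 + c) / (1 - c) + 1)⁻¹ = (1 - c) / 2 := by
    have : (1 + c) / (1 - c) + 1 = 2 / (1 - c) := by field_simp; ring
    rw [this, inv_div]
  rw [hsum]
  simp only [stereoVec, stereoNum, h1, h2, smul_add, smul_smul]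
  refine congrArg₂ (· + ·) (congrArg₂ (· + ·) (congrArg (· • _) ?_) (congrArg (· • _) ?_))
    (congrArg (· • _) ?_)
  · field_simp
  · field_simp
  · field_simp
    ring

theorem stereoVec_ne (he : Orthonormal ℝ e) (w : ℂ) : stereoVec e w ≠ e 2 := by
  intro h
  have h1 := (inner_stereoVec he w).2.2
  have h2 : inner ℝ (e 2) (e 2) = (1 : ℝ) := by
    rw [real_inner_self_eq_norm_sq, he.1]; norm_num
  rw [h, h2] at h1
  have : w.re ^ 2 + w.im ^ 2 + 1 ≠ 0 := by positivity
  field_simp at h1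
  linarith

/-- The rotation over π about the axis `e 0` is z ↦ 1 / z in the stereographic coordinate. The
rotated frame gives a disc around the centre of projection with the same orientation. -/
theorem stereoVec_inv (e : Fin 3 → E3) {z : ℂ} (hz : z ≠ 0) :
    stereoVec ![e 0, -e 1, -e 2] z = stereoVec e z⁻¹ := by
  have h0 : z.re ^ 2 + z.im ^ 2 ≠ 0 := by
    have := Complex.normSq_pos.2 hz
    rw [Complex.normSq_apply] at this
    nlinarith
  have h1 : z.re ^ 2 + z.im ^ 2 + 1 ≠ 0 := by positivity
  have hr : z⁻¹.re = z.re / (z.re ^ 2 + z.im ^ 2) := by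
    rw [Complex.inv_re, Complex.normSq_apply, sq, sq]
  have hi : z⁻¹.im = -z.im / (z.re ^ 2 + z.im ^ 2) := by
    rw [Complex.inv_im, Complex.normSq_apply, sq, sq]
  have h2 : (z.re / (z.re ^ 2 + z.im ^ 2)) ^ 2 + (-z.im / (z.re ^ 2 + z.im ^ 2)) ^ 2 =
      (z.re ^ 2 + z.im ^ 2)⁻¹ := by
    field_simp
    
  have h3 : ((z.re ^ 2 + z.im ^ 2)⁻¹ + 1)⁻¹ =
      (z.re ^ 2 + z.im ^ 2) / (z.re ^ 2 + z.im ^ 2 + 1) := by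
    have : (z.re ^ 2 + z.im ^ 2)⁻¹ + 1 = (z.re ^ 2 + z.im ^ 2 + 1) / (z.re ^ 2 + z.im ^ 2) := by
      field_simp
      ring
    rw [this, inv_div]
  simp only [stereoVec, stereoNum, hr, hi, h2, h3]
  simp only [smul_add, smul_smul, Matrix.cons_val_zero, Matrix.cons_val_one, Matrix.cons_val,
    smul_neg, ← neg_smul]
  refine congrArg₂ (· + ·) (congrArg₂ (· + ·) (congrArg (· • _) ?_) (congrArg (· • _) ?_))
    (congrArg (· • _) ?_)
  · field_simp
  · field_simp
  · field_simp
    ring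

/-- Exchanging the first two vectors of an orthonormal basis corrects the sign of the determinant
and keeps the third vector. -/
theorem exists_frame (v : S2) : ∃ b : OrthonormalBasis (Fin 3) ℝ E3, b 2 = v ∧
    Matrix.det ![(b 0).ofLp, (b 1).ofLp, (b 2).ofLp] < 0 := by
  have hv : ‖(v : E3)‖ = 1 := by simp
  have horth : Orthonormal ℝ (({2} : Set (Fin 3)).domRestrict fun _ => (v : E3)) := by
    rw [orthonormal_iff_ite]
    rintro ⟨i, rfl⟩ ⟨k, rfl⟩
    rw [if_pos rfl]
    have h1 : inner ℝ (v : E3) (v : E3) = (1 : ℝ) := by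
      rw [real_inner_self_eq_norm_sq, hv, one_pow]
    exact h1
  obtain ⟨b, hb⟩ := horth.exists_orthonormalBasis_extension_of_card_eq (by simp)
  have hb2 : b 2 = v := hb 2 rfl
  have hne : Matrix.det ![(b 0).ofLp, (b 1).ofLp, (b 2).ofLp] ≠ 0 := by
    intro h0
    obtain ⟨u, hu, hu'⟩ := Matrix.exists_mulVec_eq_zero_iff.2 h0
    have h1 : ∀ i, inner ℝ (b i) (WithLp.toLp 2 u : E3) = 0 := by
      intro i
      have := congrFun hu' i
      fin_cases i <;>
      simpa [Matrix.mulVec, dotProduct, PiLp.inner_apply, Fin.sum_univ_three, mul_comm] using this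
    have h2 : (WithLp.toLp 2 u : E3) = 0 := by
      rw [← b.sum_repr' (WithLp.toLp 2 u : E3)]
      simp [h1]
    exact hu (congrArg WithLp.ofLp h2)
  rcases lt_or_gt_of_ne hne with h | h
  · exact ⟨b, hb2, h⟩
  · refine ⟨b.reindex (Equiv.swap 0 1), ?_, ?_⟩
    · rw [OrthonormalBasis.reindex_apply, Equiv.symm_swap]
      exact (congrArg b (by decide)).trans hb2
    · simp only [OrthonormalBasis.reindex_apply, Equiv.symm_swap, Equiv.swap_apply_left,
        Equiv.swap_apply_right]
      have : (Equiv.swap (0 : Fin 3) 1) 2 = 2 := by decide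
      rw [this]
      rw [det_three] at h ⊢
      linarith

end stereo

/-! ### Coordinates in which the marked points are `0`, ..., `n - 1` and infinity -/

/-- Orientation preserving diffeomorphisms of the plane that move the points over a bounded
distance. -/
structure BoundedDiffeo (S : ℂ → ℂ) : Prop where
  contDiff : ContDiff ℝ ∞ S
  bijective : Function.Bijective S
  oriented : ∀ z, 0 < cross (fderiv ℝ S z 1) (fderiv ℝ S z Complex.I)
  bounded : ∃ M : ℝ, ∀ z, ‖S z - z‖ ≤ M

namespace BoundedDiffeo

theorem comp {S T : ℂ → ℂ} (hS : BoundedDiffeo S) (hT : BoundedDiffeo T) :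
    BoundedDiffeo (S ∘ T) where
  contDiff := hS.contDiff.comp hT.contDiff
  bijective := hS.bijective.comp hT.bijective
  oriented z := by
    rw [fderiv_comp z (hS.contDiff.differentiable (by simp) _)
      (hT.contDiff.differentiable (by simp) _)]
    change 0 < cross (fderiv ℝ S (T z) (fderiv ℝ T z 1))
      (fderiv ℝ S (T z) (fderiv ℝ T z Complex.I))
    rw [cross_map]
    exact mul_pos (hS.oriented _) (hT.oriented _)
  bounded := by
    obtain ⟨M, hM⟩ := hS.bounded
    obtain ⟨M', hM'⟩ := hT.bounded
    refine ⟨M + M', fun z => ?_⟩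
    have : (S ∘ T) z - z = (S (T z) - T z) + (T z - z) := by
      simp
    rw [this]
    exact (norm_add_le _ _).trans (add_le_add (hM _) (hM' _))

/-- Since `L u = 0`, the map preserves `L`. Hence the shear with -p is its inverse, and the Jacobian
determinant is 1 because the derivative of p enters only as a multiple of `L u`. -/
theorem shear {p : ℝ → ℝ} (hp : ContDiff ℝ ∞ p) (hb : ∃ M, ∀ t, |p t| ≤ M) {u : ℂ} (hu : ‖u‖ = 1)
    (L : ℂ →L[ℝ] ℝ) (hL : L u = 0) : BoundedDiffeo (fun z => z + p (L z) * u) where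
  contDiff := contDiff_id.add
    ((Complex.ofRealCLM.contDiff.comp (hp.comp L.contDiff)).mul contDiff_const)
  bijective := by
    have hl : ∀ (q : ℝ) z, L (z + q * u) = L z := fun q z => by
      have : (q : ℂ) * u = q • u := (Complex.real_smul).symm
      rw [this, map_add, map_smul, hL, smul_zero, add_zero]
    refine Function.bijective_iff_has_inverse.2 ⟨fun z => z + (-p (L z) : ℝ) * u, fun z => ?_,
      fun z => ?_⟩
    · simp only [hl]
      push_cast
      ring
    · simp only [hl]
      push_cast
      ring
  oriented z := by
    have h1 : HasFDerivAt (fun z => ((p (L z) : ℝ) : ℂ)) (Complex.ofRealCLM.comp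
        ((deriv p (L z)) • L)) z :=
      Complex.ofRealCLM.hasFDerivAt.comp z
        (((hp.differentiable (by simp) _).hasDerivAt).comp_hasFDerivAt z L.hasFDerivAt)
    have h2 := (hasFDerivAt_id z).add (h1.mul_const u)
    have h3 : HasFDerivAt (fun z => z + p (L z) * u) _ z := h2
    have hd : ∀ a : ℂ, fderiv ℝ (fun z => z + p (L z) * u) z a =
        a + (deriv p (L z) * L a : ℝ) * u := fun a => by
      rw [h3.fderiv]
      simp [mul_comm]
    rw [hd, hd]
    have h4 : u.re * L 1 + u.im * L Complex.I = 0 := by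
      rw [← hL]
      have h5 : u = u.re • (1 : ℂ) + u.im • Complex.I := by
        apply Complex.ext <;> simp
      conv_rhs => rw [h5]
      rw [map_add, map_smul, map_smul, smul_eq_mul, smul_eq_mul]
    simp only [cross, Complex.add_re, Complex.add_im, Complex.re_ofReal_mul,
      Complex.im_ofReal_mul, Complex.one_re, Complex.one_im, Complex.I_re, Complex.I_im]
    have h6 : (1 + deriv p (L z) * L 1 * u.re) * (1 + deriv p (L z) * L Complex.I * u.im) -
      (0 + deriv p (L z) * L 1 * u.im) * (0 + deriv p (L z) * L Complex.I * u.re) = 1 := by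
      linear_combination (deriv p (L z)) * h4
    rw [h6]
    exact one_pos
  bounded := by
    obtain ⟨M, hM⟩ := hb
    refine ⟨M, fun z => ?_⟩
    rw [add_sub_cancel_left, norm_mul, hu, mul_one, Complex.norm_real]
    exact hM _

theorem shear_re {p : ℝ → ℝ} (hp : ContDiff ℝ ∞ p) (hb : ∃ M, ∀ t, |p t| ≤ M) :
    BoundedDiffeo (fun z => z + p z.im) := by
  simpa using shear hp hb (u := 1) (by simp) Complex.imCLM (by simp)

theorem shear_im {p : ℝ → ℝ} (hp : ContDiff ℝ ∞ p) (hb : ∃ M, ∀ t, |p t| ≤ M) :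
    BoundedDiffeo (fun z => z + p z.re * Complex.I) := by
  simpa using shear hp hb (u := Complex.I) (by simp) Complex.reCLM (by simp)

/-- Bounded smooth functions interpolate. -/
theorem exists_interpolation {n : ℕ} {x : Fin n → ℝ} (hx : Function.Injective x) (y : Fin n → ℝ) :
    ∃ p : ℝ → ℝ, ContDiff ℝ ∞ p ∧ (∃ M, ∀ t, |p t| ≤ M) ∧ ∀ i, p (x i) = y i := by
  -- Interpolation in arctan t instead of t keeps the polynomial bounded, since its argument stays
  -- in a compact interval.
  let P := Lagrange.interpolate Finset.univ (fun i => Real.arctan (x i)) y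
  refine ⟨fun t => P.eval (Real.arctan t), ?_, ?_, fun i => ?_⟩
  · exact (Polynomial.contDiff_aeval P ∞).comp Real.contDiff_arctan
  · obtain ⟨M, hM⟩ := isCompact_Icc.exists_bound_of_continuousOn
      (P.continuous.continuousOn (s := Set.Icc (-(Real.pi / 2)) (Real.pi / 2)))
    exact ⟨M, fun t => hM _ ⟨(Real.neg_pi_div_two_lt_arctan t).le,
      (Real.arctan_lt_pi_div_two t).le⟩⟩
  · exact Lagrange.eval_interpolate_at_node y (Real.arctan_injective.comp hx).injOn
      (Finset.mem_univ i)

/-- Distinct points of the plane can be moved to `0`, ..., `n - 1`. -/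
theorem exists_apply_eq {n : ℕ} {f : Fin n → ℂ} (hf : Function.Injective f) :
    ∃ S, BoundedDiffeo S ∧ ∀ i : Fin n, S (i : ℕ) = f i := by
  have harc : ∃ M, ∀ t, |Real.arctan t| ≤ M := ⟨Real.pi / 2, fun t =>
    abs_le.2 ⟨(Real.neg_pi_div_two_lt_arctan t).le, (Real.arctan_lt_pi_div_two t).le⟩⟩
  -- A generic shear makes the real parts distinct: every pair of points excludes at most one value
  -- of `c`.
  obtain ⟨c, hc⟩ : ∃ c : ℝ, Function.Injective fun i =>
      (f i).re + c * Real.arctan (f i).im := by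
    have hfin : (Set.range fun q : Fin n × Fin n => ((f q.2).re - (f q.1).re) /
        (Real.arctan (f q.1).im - Real.arctan (f q.2).im)).Finite := Set.finite_range _
    obtain ⟨c, hc⟩ := hfin.exists_notMem
    refine ⟨c, fun i k h => ?_⟩
    simp only at h
    by_cases him : (f i).im = (f k).im
    · rw [him] at h
      exact hf (Complex.ext (by linarith) him)
    · have h1 : Real.arctan (f i).im - Real.arctan (f k).im ≠ 0 :=
        sub_ne_zero.2 fun h2 => him (Real.arctan_injective h2)
      refine absurd ⟨(i, k), ?_⟩ hc
      rw [div_eq_iff h1]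
      linarith
  have hcast : Function.Injective fun i : Fin n => ((i : ℕ) : ℝ) := fun i k h =>
    Fin.ext (Nat.cast_injective h)
  obtain ⟨p1, hp1, hb1, h1⟩ : ∃ p : ℝ → ℝ, ContDiff ℝ ∞ p ∧ (∃ M, ∀ t, |p t| ≤ M) ∧
      ∀ i, p (f i).im = -(c * Real.arctan (f i).im) := by
    obtain ⟨M, hM⟩ := harc
    refine ⟨fun t => -c * Real.arctan t, contDiff_const.mul Real.contDiff_arctan,
      ⟨|-c| * M, fun t => ?_⟩, fun i => by ring⟩
    rw [abs_mul]
    exact mul_le_mul_of_nonneg_left (hM t) (abs_nonneg _)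
  obtain ⟨r, hr⟩ : ∃ r : Fin n → ℝ, ∀ i, Real.arctan (f i).im = r i := ⟨_, fun i => rfl⟩
  simp only [hr] at hc h1
  obtain ⟨p4, hp4, hb4, h4⟩ := exists_interpolation hcast fun i => ((i : ℕ) : ℝ)
  obtain ⟨p3, hp3, hb3, h3⟩ := exists_interpolation hcast fun i => (f i).re + c * r i - (i : ℕ)
  obtain ⟨p2, hp2, hb2, h2⟩ := exists_interpolation hc fun i => (f i).im - (i : ℕ)
  -- Read from the right: the integer i is raised to i + i√-1, moved to the sheared real part of `f
  -- i`, then to its imaginary part, and finally the shear is undone. The first shear makes the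
  -- imaginary parts distinct, as the next interpolation requires.
  refine ⟨_, (shear_re hp1 hb1).comp
    ((shear_im hp2 hb2).comp ((shear_re hp3 hb3).comp (shear_im hp4 hb4))), fun i => ?_⟩
  apply Complex.ext <;> simp [h1, h2, h3, h4]

end BoundedDiffeo

/-- The composition of an oriented disc with a diffeomorphism of the plane. -/
def OrientedDisc.comp (j : OrientedDisc) {S : ℂ → ℂ} (hS : ContDiff ℝ ∞ S)
    (hinj : Function.Injective S)
    (hpos : ∀ z, 0 < cross (fderiv ℝ S z 1) (fderiv ℝ S z Complex.I)) : OrientedDisc where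
  toFun z := j.toFun (S z)
  smooth := j.smooth.comp hS.contMDiff
  injective := j.injective.comp hinj
  oriented z := by
    have hj : ContMDiff 𝓘(ℝ, ℂ) (𝓡 2) ∞ fun z => j.toFun (S z) := j.smooth.comp hS.contMDiff
    have e1 : fderiv ℝ (fun z => ((j.toFun (S z) : S2) : E3)) z =
        (fderiv ℝ j.amb (S z)).comp (fderiv ℝ S z) :=
      fderiv_comp (g := j.amb) z (j.contDiff_amb.differentiable (by simp) _)
        (hS.differentiable (by simp) _)
    refine lt_of_lt_of_eq ?_ (areaForm_mfderiv hj z 1 Complex.I).symm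
    rw [e1]
    refine lt_of_lt_of_eq ?_ (det_linear (j.amb (S z)) (fderiv ℝ j.amb (S z)) _ _).symm
    exact mul_pos (hpos z) (j.jac_pos _)

/-- Oriented discs around a marked point and its complement, that have the other marked points at
`0`, ..., `n - 1`. -/
theorem exists_discs {D : Finset S2} {n : ℕ} (hD : D.card = n + 1) :
    ∃ J Jinf : OrientedDisc, Set.range J.toFun = {Jinf.toFun 0}ᶜ ∧ Jinf.toFun 0 ∈ D ∧
      (∀ z, J.toFun z ∈ D ↔ ∃ k : ℕ, k < n ∧ z = k) ∧
      ∃ M : ℝ, ∀ z, z ≠ 0 → ∃ w, ‖w - z⁻¹‖ ≤ M ∧ Jinf.toFun z = J.toFun w := by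
  obtain ⟨v, hv⟩ : D.Nonempty := Finset.card_pos.1 (by omega)
  obtain ⟨b, hb, hdet⟩ := exists_frame v
  let j := stereo b b.orthonormal hdet
  have hjrange : Set.range j.toFun = {v}ᶜ := by
    ext x
    constructor
    · rintro ⟨z, rfl⟩ h
      exact stereoVec_ne b.orthonormal z ((congrArg Subtype.val h).trans hb.symm)
    · intro hx
      obtain ⟨w, hw⟩ := exists_stereoVec_eq b (p := x) (by simp)
        (fun h => hx (Subtype.ext (h.trans hb)))
      exact ⟨w, Subtype.ext hw⟩
  have hcard : (D.erase v).card = n := by rw [Finset.card_erase_of_mem hv]; omega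
  let en := (D.erase v).equivFinOfCardEq hcard
  have hmem : ∀ i : Fin n, ∃ z, j.toFun z = (en.symm i : S2) := fun i => by
    have : ((en.symm i : S2)) ∈ Set.range j.toFun := by
      rw [hjrange]
      exact (Finset.mem_erase.1 (en.symm i).2).1
    exact this
  choose f hf using hmem
  have hfinj : Function.Injective f := fun i k h => by
    have : (en.symm i : S2) = en.symm k := by rw [← hf, ← hf, h]
    exact en.symm.injective (Subtype.ext this)
  obtain ⟨S, hS, hSf⟩ := BoundedDiffeo.exists_apply_eq hfinj
  have horth' : Orthonormal ℝ ![b 0, -b 1, -b 2] := by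
    rw [orthonormal_iff_ite]
    have h : ∀ i k, inner ℝ (b i) (b k) = if i = k then 1 else (0 : ℝ) :=
      orthonormal_iff_ite.1 b.orthonormal
    intro i k
    fin_cases i <;> fin_cases k <;> simp [h]
  have hdet' : Matrix.det ![((![b 0, -b 1, -b 2] : Fin 3 → E3) 0).ofLp,
      ((![b 0, -b 1, -b 2] : Fin 3 → E3) 1).ofLp, ((![b 0, -b 1, -b 2] : Fin 3 → E3) 2).ofLp] < 0 := by
    rw [det_three] at hdet ⊢
    simp
    linarith
  have h0 : (stereo _ horth' hdet').toFun 0 = v := by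
    refine Subtype.ext ?_
    change stereoVec _ 0 = _
    rw [stereoVec_zero]
    simpa using hb
  refine ⟨j.comp hS.contDiff hS.bijective.1 hS.oriented, stereo _ horth' hdet', ?_, ?_, ?_, ?_⟩
  · rw [h0, ← hjrange]
    exact hS.bijective.2.range_comp j.toFun
  · rw [h0]
    exact hv
  · intro z
    change j.toFun (S z) ∈ D ↔ _
    constructor
    · intro h
      have h1 : j.toFun (S z) ∈ D.erase v := by
        refine Finset.mem_erase.2 ⟨?_, h⟩
        have : j.toFun (S z) ∈ Set.range j.toFun := ⟨_, rfl⟩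
        rw [hjrange] at this
        exact this
      refine ⟨en ⟨_, h1⟩, (en _).2, hS.bijective.1 (j.injective ?_)⟩
      rw [hSf, hf, Equiv.symm_apply_apply]
    · rintro ⟨k, hk, rfl⟩
      have h1 := hSf ⟨k, hk⟩
      simp only at h1
      rw [h1, hf]
      exact (Finset.mem_erase.1 (en.symm _).2).2
  · obtain ⟨M, hM⟩ := hS.bounded
    refine ⟨M, fun z hz => ?_⟩
    obtain ⟨w, hw⟩ := hS.bijective.2 z⁻¹
    refine ⟨w, ?_, ?_⟩
    · rw [norm_sub_rev, ← hw]
      exact hM w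
    · change _ = j.toFun (S w)
      rw [hw]
      exact Subtype.ext (stereoVec_inv b hz)

/-! ### Free homotopies of loops -/

noncomputable section

namespace PathClass

open Path

variable {X Y : Type} [TopologicalSpace X] [TopologicalSpace Y]

/-- Two classes of loops are conjugate along some path. -/
def Conj {x y : X} (p : Homotopic.Quotient x x) (q : Homotopic.Quotient y y) : Prop :=
  ∃ s : Homotopic.Quotient x y, p = s.trans (q.trans s.symm)

theorem Conj.trans {x y z : X} {p : Homotopic.Quotient x x} {q : Homotopic.Quotient y y}
    {r : Homotopic.Quotient z z} (h : Conj p q) (h' : Conj q r) : Conj p r := by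
  obtain ⟨s, rfl⟩ := h
  obtain ⟨t, rfl⟩ := h'
  exact ⟨s.trans t, by simp only [symm_trans_rev, Homotopic.Quotient.trans_assoc]⟩

theorem Conj.symm {x y : X} {p : Homotopic.Quotient x x} {q : Homotopic.Quotient y y}
    (h : Conj p q) : Conj q p := by
  obtain ⟨s, rfl⟩ := h
  refine ⟨s.symm, ?_⟩
  simp only [PathClass.symm_symm, Homotopic.Quotient.trans_assoc, symm_trans_cancel,
    Homotopic.Quotient.symm_trans, Homotopic.Quotient.trans_refl]

theorem Conj.map {x y : X} {p : Homotopic.Quotient x x} {q : Homotopic.Quotient y y}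
    (h : Conj p q) (f : C(X, Y)) : Conj (p.map f) (q.map f) := by
  obtain ⟨s, rfl⟩ := h
  exact ⟨s.map f, by simp only [map_trans, map_symm]⟩

/-- The standard loop in the circle. -/
def stdLoop : Path (1 : Circle) 1 where
  toFun t := ⟨Complex.exp (2 * Real.pi * (t : ℝ) * Complex.I), by
    have : 2 * Real.pi * (t : ℝ) * Complex.I = ((2 * Real.pi * t : ℝ) : ℂ) * Complex.I := by
      push_cast; ring
    rw [this]
    exact mem_sphere_zero_iff_norm.2 (Complex.norm_exp_ofReal_mul_I _)⟩
  continuous_toFun := by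
    refine Continuous.subtype_mk ?_ _
    fun_prop
  source' := by ext; simp
  target' := by ext; simp [Complex.exp_two_pi_mul_I]

/-- The loop given by a map from the circle. -/
def circ (f : C(Circle, X)) : Homotopic.Quotient (f 1) (f 1) :=
  (Homotopic.Quotient.mk stdLoop).map f

/-- The track of the point 1 of the circle under the homotopy conjugates one loop into the other. -/
theorem conj_circ {f g : C(Circle, X)} (h : f.Homotopic g) : Conj (circ f) (circ g) := by
  obtain ⟨F⟩ := h
  refine ⟨Homotopic.Quotient.mk (F.evalAt 1), ?_⟩
  have h : (circ f).trans (Homotopic.Quotient.mk (F.evalAt 1)) =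
      (Homotopic.Quotient.mk (F.evalAt 1)).trans (circ g) :=
    Homotopic.Quotient.eq.2 (Homotopic.map_trans_evalAt F stdLoop)
  rw [← Homotopic.Quotient.trans_assoc, ← h, Homotopic.Quotient.trans_assoc,
    Homotopic.Quotient.trans_symm, Homotopic.Quotient.trans_refl]

end PathClass

/-- The punctured disc of radius `ε`. -/
abbrev PuncturedDisc (ε : ℝ) : Type := {w : ℂ // w ≠ 0 ∧ ‖w‖ < ε}

namespace PuncturedDisc

/-- The circle of radius `‖α‖`. -/
def round {ε : ℝ} (α : ℂ) (hα : α ≠ 0) (hε : ‖α‖ < ε) : C(Circle, PuncturedDisc ε) where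
  toFun z := ⟨α * z, mul_ne_zero hα z.coe_ne_zero, by rwa [norm_mul, Circle.norm_coe, mul_one]⟩
  continuous_toFun := by
    refine Continuous.subtype_mk ?_ _
    fun_prop

/-- Along the straight homotopy the distance to α z stays below ‖α‖ = ‖α z‖, so 0 is avoided; the
outer bound is convexity of the ball. -/
theorem homotopic_round {ε : ℝ} {α : ℂ} (hα : α ≠ 0) (hε : ‖α‖ < ε) (a : C(Circle, PuncturedDisc ε))
    (ha : ∀ z, ‖(a z : ℂ) - α * z‖ < ‖α‖) : a.Homotopic (round α hα hε) := by
  refine ⟨⟨⟨fun q => ⟨(1 - (q.1 : ℝ)) * a q.2 + (q.1 : ℝ) * (α * q.2), ?_, ?_⟩, ?_⟩, ?_, ?_⟩⟩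
  · intro h
    have h1 : α * q.2 = -((1 - (q.1 : ℝ)) * (a q.2 - α * q.2)) := by linear_combination h
    have h2 : ‖α‖ = ‖(1 - (q.1 : ℝ) : ℂ)‖ * ‖(a q.2 : ℂ) - α * q.2‖ := by
      have := congrArg norm h1
      rwa [norm_neg, norm_mul, norm_mul, Circle.norm_coe, mul_one] at this
    have h3 : ‖(1 - (q.1 : ℝ) : ℂ)‖ ≤ 1 := by
      rw [← Complex.ofReal_one, ← Complex.ofReal_sub, Complex.norm_real, Real.norm_eq_abs, abs_le]
      constructor <;> linarith [q.1.2.1, q.1.2.2]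
    have h4 := ha q.2
    nlinarith [norm_nonneg ((a q.2 : ℂ) - α * q.2)]
  · have hb := (convex_ball (0 : ℂ) ε) (x := a q.2) (by simpa using (a q.2).2.2)
      (y := α * q.2)
      (by rwa [mem_ball_zero_iff, norm_mul, Circle.norm_coe, mul_one]) (a := 1 - (q.1 : ℝ)) (b := (q.1 : ℝ))
      (by linarith [q.1.2.2]) q.1.2.1 (by ring)
    simpa using hb
  · refine Continuous.subtype_mk ?_ _
    fun_prop
  · intro z
    refine Subtype.ext ?_
    simp
  · intro z
    refine Subtype.ext ?_
    simp [round]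

/-- Interpolate linearly between the logarithms of the complex radii; the logarithm of the norm is
then a convex combination too. -/
theorem round_homotopic {ε : ℝ} {α β : ℂ} (hα : α ≠ 0) (hε : ‖α‖ < ε) (hβ : β ≠ 0)
    (hε' : ‖β‖ < ε) : (round α hα hε).Homotopic (round β hβ hε') := by
  have hpos : 0 < ε := (norm_nonneg _).trans_lt hε
  refine ⟨⟨⟨fun q => ⟨Complex.exp ((1 - (q.1 : ℝ)) * Complex.log α +
    (q.1 : ℝ) * Complex.log β) * q.2, ?_, ?_⟩, ?_⟩, ?_, ?_⟩⟩
  · exact mul_ne_zero (Complex.exp_ne_zero _) q.2.coe_ne_zero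
  · have h1 : Real.log ‖α‖ < Real.log ε := Real.log_lt_log (norm_pos_iff.2 hα) hε
    have h2 : Real.log ‖β‖ < Real.log ε := Real.log_lt_log (norm_pos_iff.2 hβ) hε'
    rw [norm_mul, Circle.norm_coe, mul_one, Complex.norm_exp, ← Real.lt_log_iff_exp_lt hpos]
    have h3 : ((1 - (q.1 : ℝ)) * Complex.log α + (q.1 : ℝ) * Complex.log β : ℂ).re =
        (1 - (q.1 : ℝ)) * Real.log ‖α‖ + q.1 * Real.log ‖β‖ := by
      have : (1 - (q.1 : ℝ) : ℂ) = ((1 - q.1 : ℝ) : ℂ) := by push_cast; rfl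
      rw [this, Complex.add_re, Complex.re_ofReal_mul, Complex.re_ofReal_mul, Complex.log_re,
        Complex.log_re]
    rw [h3]
    have := (convex_Iio (Real.log ε)) h1 h2 (a := 1 - (q.1 : ℝ)) (b := (q.1 : ℝ))
      (by linarith [q.1.2.2]) q.1.2.1 (by ring)
    simpa using this
  · refine Continuous.subtype_mk ?_ _
    fun_prop
  · intro z
    refine Subtype.ext ?_
    simp [round, Complex.exp_log hα]
  · intro z
    refine Subtype.ext ?_
    simp [round, Complex.exp_log hβ]

end PuncturedDisc

/-! ### Small circles around a marked point -/

section circles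

variable {D : Finset S2}

/-- The part of the punctured disc with radius `ε` of an oriented disc in the punctured sphere. -/
def OrientedDisc.toPunctured (j : OrientedDisc) {ε : ℝ}
    (hj : ∀ z, z ≠ 0 → ‖z‖ < ε → j.toFun z ∉ D) : C(PuncturedDisc ε, Punctured D) where
  toFun w := ⟨j.toFun w, hj w w.2.1 w.2.2⟩
  continuous_toFun := Continuous.subtype_mk (j.smooth.continuous.comp continuous_subtype_val) _

/-- A positively oriented linear map of the plane is close to a complex linear map. -/
theorem exists_complex_linear (L : ℂ →L[ℝ] ℂ) (hL : 0 < cross (L 1) (L Complex.I)) :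
    ∃ α : ℂ, ∃ b : ℝ, 0 ≤ b ∧ b < ‖α‖ ∧ ∀ z, ‖L z - α * z‖ ≤ b * ‖z‖ := by
  -- The complex linear and antilinear parts of `L`, whose determinant is ‖α‖² - ‖β‖².
  let α := (L 1 - Complex.I * L Complex.I) / 2
  let β := (L 1 + Complex.I * L Complex.I) / 2
  refine ⟨α, ‖β‖, norm_nonneg _, ?_, fun z => ?_⟩
  · have h1 : Complex.normSq α - Complex.normSq β = cross (L 1) (L Complex.I) := by
      simp only [α, β, cross, Complex.normSq_apply, map_div₀, Complex.add_re, Complex.sub_re,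
        Complex.add_im, Complex.sub_im, Complex.mul_re, Complex.mul_im, Complex.I_re, Complex.I_im]
      norm_num
      ring
    rw [Complex.normSq_eq_norm_sq, Complex.normSq_eq_norm_sq] at h1
    nlinarith [norm_nonneg α, norm_nonneg β]
  · have h1 : L z = z.re * L 1 + z.im * L Complex.I := by
      have h1 : z = z.re • (1 : ℂ) + z.im • Complex.I := by
        apply Complex.ext <;> simp
      conv_lhs => rw [h1]
      rw [map_add, map_smul, map_smul]
      simp
    have h2 : L z - α * z = β * (starRingEnd ℂ) z := by
      rw [h1]
      apply Complex.ext <;> simp [α, β] <;> ring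
    rw [h2, norm_mul, Complex.norm_conj]

open PathClass in
/-- The circles of two oriented discs with the same centre are freely homotopic. -/
theorem conj_circlePath (j j₀ : OrientedDisc) (h0 : j.toFun 0 = j₀.toFun 0)
    (hj : ∀ z, z ≠ 0 → j.toFun z ∉ D) {ε : ℝ} (hj₀ : ∀ z, z ≠ 0 → ‖z‖ < ε → j₀.toFun z ∉ D)
    {r : ℂ} (hr : r ≠ 0) (hε : ‖r‖ < ε) :
    Conj (Path.Homotopic.Quotient.mk (circlePath j hj))
      (circ ((j₀.toPunctured hj₀).comp (PuncturedDisc.round r hr hε))) := by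
  have hεpos : 0 < ε := (norm_nonneg _).trans_lt hε
  obtain ⟨K, hK, hK1, hK2⟩ := j₀.exists_local_inverse 0
  -- The transition from `j` to the coordinate of `j₀` near the common centre. Its derivative at 0
  -- has positive determinant because both discs are oriented.
  let h : ℂ → ℂ := fun z => K (j.amb z)
  have hamb : j.amb 0 = j₀.amb 0 := congrArg Subtype.val h0
  have hh0 : h 0 = 0 := by
    change K (j.amb 0) = 0
    rw [hamb]
    exact hK2.self_of_nhds
  have hsmooth : ContDiffAt ℝ ∞ h 0 := by
    rw [← hamb] at hK
    exact hK.comp 0 j.contDiff_amb.contDiffAt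
  have hjh : ∀ᶠ z in nhds (0 : ℂ), j₀.toFun (h z) = j.toFun z := by
    rw [← h0] at hK1
    exact j.smooth.continuous.continuousAt.eventually hK1
  have hd : HasFDerivAt h (fderiv ℝ h 0) 0 := (hsmooth.differentiableAt (by simp)).hasFDerivAt
  have hpos : 0 < cross (fderiv ℝ h 0 1) (fderiv ℝ h 0 Complex.I) := by
    have h1 : j.jac 0 = cross (fderiv ℝ h 0 1) (fderiv ℝ h 0 Complex.I) * j₀.jac 0 := by
      have h2 : HasFDerivAt (fun z => j₀.amb (h z)) ((fderiv ℝ j₀.amb 0).comp (fderiv ℝ h 0)) 0 := by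
        refine HasFDerivAt.comp 0 (g := j₀.amb) ?_ hd
        rw [hh0]
        exact (j₀.contDiff_amb.differentiable (by simp) 0).hasFDerivAt
      have h3 : fderiv ℝ j.amb 0 = (fderiv ℝ j₀.amb 0).comp (fderiv ℝ h 0) := by
        rw [← h2.fderiv]
        refine Filter.EventuallyEq.fderiv_eq ?_
        filter_upwards [hjh] with z hz
        exact (congrArg Subtype.val hz).symm
      rw [OrientedDisc.jac, h3, hamb]
      exact det_linear (j₀.amb 0) (fderiv ℝ j₀.amb 0) _ _
    have h2 := j.jac_pos 0
    rw [h1] at h2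
    exact pos_of_mul_pos_left h2 (j₀.jac_pos 0).le
  obtain ⟨α, b, hb, hbα, hα⟩ := exists_complex_linear _ hpos
  have hα0 : 0 < ‖α‖ := hb.trans_lt hbα
  -- Half of the gap ‖α‖ - b absorbs the nonlinear part, so the total error stays below ‖α‖ ‖z‖.
  have hlin : ∀ᶠ z in nhds (0 : ℂ), ‖h z - α * z‖ ≤ (b + (‖α‖ - b) / 2) * ‖z‖ := by
    have h1 := hd.isLittleO.def (c := (‖α‖ - b) / 2) (by linarith)
    simp only [hh0, sub_zero] at h1
    filter_upwards [h1] with z hz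
    calc ‖h z - α * z‖ = ‖(h z - fderiv ℝ h 0 z) + (fderiv ℝ h 0 z - α * z)‖ := by ring_nf
      _ ≤ (‖α‖ - b) / 2 * ‖z‖ + b * ‖z‖ := (norm_add_le _ _).trans (add_le_add hz (hα z))
      _ = _ := by ring
  have hcont : ∀ᶠ z in nhds (0 : ℂ), ContinuousAt h z := by
    have := (hsmooth.of_le (m := 1) (by simp)).eventually (by simp)
    filter_upwards [this] with z hz
    exact hz.continuousAt
  have hsmall : ∀ᶠ z in nhds (0 : ℂ), ‖h z‖ < ε := by
    have : Filter.Tendsto (fun z => ‖h z‖) (nhds 0) (nhds ‖h 0‖) := hd.continuousAt.norm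
    rw [hh0, norm_zero] at this
    exact this.eventually_lt_const hεpos
  obtain ⟨δ, hδ, hall⟩ := Metric.eventually_nhds_iff.1 (hjh.and (hlin.and (hcont.and hsmall)))
  obtain ⟨ρ, hρ, hρδ, hρε⟩ : ∃ ρ : ℝ, 0 < ρ ∧ ρ < δ ∧ ‖α‖ * ρ < ε := by
    refine ⟨min (δ / 2) (ε / (2 * ‖α‖)), by positivity, ?_, ?_⟩
    · exact (min_le_left _ _).trans_lt (by linarith)
    · refine (mul_le_mul_of_nonneg_left (min_le_right _ _) hα0.le).trans_lt ?_
      have : ‖α‖ * (ε / (2 * ‖α‖)) = ε / 2 := by field_simp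
      rw [this]
      linarith
  have hball : ∀ z : Circle, dist ((ρ : ℂ) * z) 0 < δ := fun z => by
    rw [dist_zero_right, norm_mul, Circle.norm_coe, mul_one, Complex.norm_real, Real.norm_eq_abs,
      abs_of_pos hρ]
    exact hρδ
  have hnorm : ∀ z : Circle, ‖(ρ : ℂ) * z‖ = ρ := fun z => by
    rw [norm_mul, Circle.norm_coe, mul_one, Complex.norm_real, Real.norm_eq_abs, abs_of_pos hρ]
  have hαρ : α * ρ ≠ 0 := mul_ne_zero (norm_pos_iff.1 hα0) (by exact_mod_cast hρ.ne')
  have hnαρ : ‖α * ρ‖ = ‖α‖ * ρ := by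
    rw [norm_mul, Complex.norm_real, Real.norm_eq_abs, abs_of_pos hρ]
  have hclose : ∀ z : Circle, ‖h (ρ * z) - α * ρ * z‖ < ‖α * ρ‖ := fun z => by
    have h1 := (hall (hball z)).2.1
    rw [hnorm, ← mul_assoc] at h1
    refine h1.trans_lt ?_
    rw [hnαρ]
    exact mul_lt_mul_of_pos_right (by linarith) hρ
  let a : C(Circle, PuncturedDisc ε) :=
    { toFun := fun z => ⟨h (ρ * z), by
        intro h1
        have h2 := hclose z
        rw [h1, zero_sub, norm_neg, norm_mul, Circle.norm_coe, mul_one] at h2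
        exact lt_irrefl _ h2, (hall (hball z)).2.2.2⟩
      continuous_toFun := by
        refine Continuous.subtype_mk ?_ _
        rw [continuous_iff_continuousAt]
        intro z
        exact ContinuousAt.comp (f := fun z : Circle => (ρ : ℂ) * z) (g := h)
          (hall (hball z)).2.2.1 (by fun_prop) }
  let f₁ : C(Circle, Punctured D) :=
    ⟨fun z => ⟨j.toFun z, hj z z.coe_ne_zero⟩,
      Continuous.subtype_mk (j.smooth.continuous.comp (by fun_prop)) _⟩
  have hhom : f₁.Homotopic ((j₀.toPunctured hj₀).comp a) := by
    have hne : ∀ q : unitInterval, (((1 - (q : ℝ)) + q * ρ : ℝ) : ℂ) ≠ 0 := fun q => by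
      have h1 : 0 < (1 - (q : ℝ)) + q * ρ := by
        rcases eq_or_lt_of_le q.2.2 with h2 | h2
        · rw [h2]; linarith
        · nlinarith [mul_nonneg q.2.1 hρ.le]
      exact_mod_cast h1.ne'
    refine ⟨⟨⟨fun q => ⟨j.toFun ((((1 - (q.1 : ℝ)) + q.1 * ρ : ℝ) : ℂ) * q.2),
      hj _ (mul_ne_zero (hne _) q.2.coe_ne_zero)⟩, ?_⟩, ?_, ?_⟩⟩
    · refine Continuous.subtype_mk (j.smooth.continuous.comp ?_) _
      fun_prop
    · intro z
      refine Subtype.ext ?_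
      simp [f₁]
    · intro z
      refine Subtype.ext ?_
      have h1 : j₀.toFun (h (ρ * z)) = j.toFun (ρ * z) := (hall (hball z)).1
      refine Eq.trans ?_ h1.symm
      simp
  -- Shrink the circle to radius ρ, read it in the coordinate of `j₀`, straighten it to a round
  -- circle and change its radius.
  have key : f₁.Homotopic ((j₀.toPunctured hj₀).comp (PuncturedDisc.round r hr hε)) :=
    hhom.trans (ContinuousMap.Homotopic.comp (ContinuousMap.Homotopic.refl _)
      ((PuncturedDisc.homotopic_round hαρ (by rw [hnαρ]; exact hρε) a hclose).trans
        (PuncturedDisc.round_homotopic _ _ hr hε)))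
  exact conj_circ key

end circles

end

/-! ### Standard generators of the fundamental group of the punctured sphere -/

namespace Plane

open PathClass

/-- The circles with centre on the real line. -/
theorem conj_circ_of_im {n a c : ℕ} (g : C(Circle, Plane n)) (b : Bool) {r : ℝ} (hr : 0 ≤ r)
    (him : ∀ z : Circle, sgn b * (g z : ℂ).im = r * (z : ℂ).im) (ha : InStrip a (g 1))
    (hc : InStrip c (g (-1))) :
    Conj (circ g) (show Path.Homotopic.Quotient (base n) (base n) from
      bif b then (loop n c)⁻¹ * loop n a else (loop n a)⁻¹ * loop n c) := by
  have hstd : ∀ s : unitInterval, (stdLoop s : ℂ).im = Real.sin (2 * Real.pi * s) := fun s => by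
    change (Complex.exp (2 * Real.pi * (s : ℝ) * Complex.I)).im = _
    have : 2 * Real.pi * (s : ℝ) * Complex.I = ((2 * Real.pi * s : ℝ) : ℂ) * Complex.I := by
      push_cast; ring
    rw [this, Complex.exp_ofReal_mul_I_im]
  have hb : sgn (!b) = - sgn b := by cases b <;> simp [sgn]
  have hmid : (stdLoop.map g.continuous) ⟨1 / 2, by norm_num, by norm_num⟩ = g (-1) := by
    change g (stdLoop _) = _
    congr 1
    refine Subtype.ext ?_
    change Complex.exp (2 * Real.pi * ((1 / 2 : ℝ) : ℂ) * Complex.I) = -1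
    rw [← Complex.exp_pi_mul_I]
    congr 1
    push_cast
    ring
  -- Up to the sign `sgn b`, the imaginary part of `g` is a nonnegative multiple of that of the
  -- standard loop, so the two halves of the loop lie in different slit planes.
  have h := conj_eq_of_halves (stdLoop.map g.continuous) hmid ha hc b (fun s hs => ?_)
    (fun s hs => ?_)
  · refine ⟨(toPoint false (ha.mem false)).symm, ?_⟩
    rw [← h]
    change _ = (toPoint false (ha.mem false)).symm.trans
      (((toPoint false (ha.mem false)).trans ((circ g).trans
        (toPoint false (ha.mem false)).symm)).trans (toPoint false (ha.mem false)).symm.symm)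
    simp only [PathClass.symm_symm, Path.Homotopic.Quotient.trans_assoc, symm_trans_cancel,
      Path.Homotopic.Quotient.symm_trans, Path.Homotopic.Quotient.trans_refl]
  · refine mem_half_of_nonneg ?_
    refine le_of_le_of_eq ?_ (him (stdLoop s)).symm
    rw [hstd]
    refine mul_nonneg hr (Real.sin_nonneg_of_nonneg_of_le_pi ?_ ?_)
    · exact mul_nonneg Real.two_pi_pos.le s.2.1
    · nlinarith [Real.pi_pos]
  · refine mem_half_of_nonneg ?_
    rw [hb, neg_mul]
    refine le_of_le_of_eq ?_ (congrArg Neg.neg (him (stdLoop s))).symm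
    rw [hstd, ← mul_neg]
    refine mul_nonneg hr ?_
    rw [← Real.sin_sub_two_pi, ← Real.sin_neg]
    refine Real.sin_nonneg_of_nonneg_of_le_pi ?_ ?_
    · nlinarith [Real.pi_pos, s.2.2]
    · nlinarith [Real.pi_pos]

theorem inStrip_of_lt {n k : ℕ} {x : Plane n} (h1 : ∀ j < k, (j : ℝ) < (x : ℂ).re)
    (h2 : (x : ℂ).re < k) : InStrip k x := fun j _ => by
  rcases lt_or_ge j k with h | h
  · exact Or.inl ⟨h, h1 j h⟩
  · exact Or.inr ⟨h, h2.trans_le (by exact_mod_cast h)⟩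

/-- The small circles around the punctures. -/
theorem conj_circ_small {n k : ℕ} (g : C(Circle, Plane n)) {r : ℝ} (hr : 0 < r)
    (hr' : r < 1) (hg : ∀ z, (g z : ℂ) = r * z + k) :
    Conj (circ g) (show Path.Homotopic.Quotient (base n) (base n) from
      (show FundamentalGroup (Plane n) (base n) from (loop n k)⁻¹ * loop n (k + 1))) := by
  refine conj_circ_of_im g true (a := k + 1) (c := k) hr.le (fun z => by simp [hg, sgn]) ?_ ?_
  · refine inStrip_of_lt (fun j hj => ?_) ?_
    · have : (j : ℝ) ≤ k := by exact_mod_cast Nat.lt_succ_iff.1 hj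
      simp [hg]
      linarith
    · simp [hg]
      linarith
  · refine inStrip_of_lt (fun j hj => ?_) ?_
    · have : (j : ℝ) + 1 ≤ k := by exact_mod_cast hj
      simp [hg]
      linarith
    · simp [hg]
      linarith

/-- The large circle, traversed clockwise. -/
theorem conj_circ_large {n : ℕ} (g : C(Circle, Plane n)) {r : ℝ} (hr : (n : ℝ) < r)
    (hg : ∀ z, (g z : ℂ) = r * (z : ℂ)⁻¹) :
    Conj (circ g) (show Path.Homotopic.Quotient (base n) (base n) from
      (show FundamentalGroup (Plane n) (base n) from (loop n n)⁻¹)) := by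
  have hr0 : 0 < r := (Nat.cast_nonneg n).trans_lt hr
  -- Inversion reflects the circle in the real line, hence `false`. The loop starts to the right of
  -- all punctures, in strip n, and crosses back in strip 0.
  have h := conj_circ_of_im g false (a := n) (c := 0) hr0.le (fun z => by
    rw [hg, ← Circle.coe_inv, Circle.coe_inv_eq_conj]
    simp [sgn]) ?_ ?_
  · simpa [loop_zero] using h
  · intro j hj
    refine Or.inl ⟨hj, ?_⟩
    have : (j : ℝ) ≤ n := by exact_mod_cast hj.le
    simp [hg]
    linarith
  · refine inStrip_of_lt (fun j hj => absurd hj (Nat.not_lt_zero j)) ?_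
    simp [hg]
    linarith

end Plane

/-! ### Transfer of the loops from the plane to the punctured sphere. -/

noncomputable section

namespace PathClass

open Path

variable {X Y Z : Type} [TopologicalSpace X] [TopologicalSpace Y] [TopologicalSpace Z]

theorem mapTo_comp (f : C(X, Y)) (g : C(Y, Z)) (k : C(X, Z)) (hk : ∀ x, k x = g (f x)) {x y : X}
    {x' y' : Y} {x'' y'' : Z} (hx : f x = x') (hy : f y = y') (hx' : g x' = x'') (hy' : g y' = y'')
    (hx'' : k x = x'') (hy'' : k y = y'') (q : Homotopic.Quotient x y) :
    mapTo g hx' hy' (mapTo f hx hy q) = mapTo k hx'' hy'' q := by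
  obtain rfl : k = g.comp f := ContinuousMap.ext hk
  subst hx hy hx' hy'
  induction q using Homotopic.Quotient.ind with | _ q =>
  simp only [mapTo_rfl]
  rfl

theorem mapTo_id {x y : X} (k : C(X, X)) (hk : ∀ x, k x = x) (hx : k x = x) (hy : k y = y)
    (q : Homotopic.Quotient x y) : mapTo k hx hy q = q := by
  induction q using Homotopic.Quotient.ind with | _ q =>
  exact mapTo_mk k hx hy q q fun t => (hk _).symm

theorem mapTo_refl (f : C(X, Y)) {x : X} {x' : Y} (hx : f x = x') :
    mapTo f hx hx (Homotopic.Quotient.refl x) = Homotopic.Quotient.refl x' := by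
  subst hx
  rw [mapTo_rfl, map_refl]

/-- The isomorphism of fundamental groups given by a homeomorphism and a path. -/
def transport (h : X ≃ₜ Y) {x : X} {o : Y} (s : Homotopic.Quotient o (h x)) :
    FundamentalGroup X x ≃* FundamentalGroup Y o where
  toFun g := s.trans ((Homotopic.Quotient.map g (h : C(X, Y))).trans s.symm)
  invFun g := mapTo (h.symm : C(Y, X)) (h.symm_apply_apply x) (h.symm_apply_apply x)
    (s.symm.trans (Homotopic.Quotient.trans g s))
  left_inv g := by
    change mapTo _ _ _ (s.symm.trans ((s.trans
      ((Homotopic.Quotient.map g (h : C(X, Y))).trans s.symm)).trans s)) = g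
    simp only [Homotopic.Quotient.trans_assoc, symm_trans_cancel, Homotopic.Quotient.symm_trans,
      Homotopic.Quotient.trans_refl]
    rw [← mapTo_rfl]
    exact (mapTo_comp (h : C(X, Y)) (h.symm : C(Y, X)) (ContinuousMap.id X)
      (fun x => (h.symm_apply_apply x).symm) _ _ _ _ rfl rfl _).trans
      (mapTo_id _ (fun _ => rfl) _ _ g)
  right_inv g := by
    change s.trans ((Homotopic.Quotient.map (mapTo _ _ _ _) (h : C(X, Y))).trans s.symm) = g
    rw [← mapTo_rfl]
    refine (congrArg (fun t => s.trans (Homotopic.Quotient.trans t s.symm))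
      ((mapTo_comp (h.symm : C(Y, X)) (h : C(X, Y)) (ContinuousMap.id Y)
        (fun x => (h.apply_symm_apply x).symm) _ _ _ _ rfl rfl _).trans
        (mapTo_id _ (fun _ => rfl) _ _ _))).trans ?_
    simp only [Homotopic.Quotient.trans_assoc, trans_symm_cancel, Homotopic.Quotient.trans_symm,
      Homotopic.Quotient.trans_refl]
  map_mul' a b := by
    change s.trans ((Homotopic.Quotient.map (Homotopic.Quotient.trans b a) (h : C(X, Y))).trans
      s.symm) = (s.trans ((Homotopic.Quotient.map b (h : C(X, Y))).trans s.symm)).trans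
        (s.trans ((Homotopic.Quotient.map a (h : C(X, Y))).trans s.symm))
    simp only [map_trans, Homotopic.Quotient.trans_assoc, symm_trans_cancel]

theorem Conj.isConj {x : X} {p q : FundamentalGroup X x}
    (h : Conj (show Homotopic.Quotient x x from p) (show Homotopic.Quotient x x from q)) :
    IsConj p q := by
  obtain ⟨s, hs⟩ := h
  rw [isConj_iff]
  refine ⟨(show FundamentalGroup X x from s), ?_⟩
  change (Homotopic.Quotient.symm s).trans (Homotopic.Quotient.trans p s) = q
  rw [hs]
  simp only [Homotopic.Quotient.trans_assoc, symm_trans_cancel, Homotopic.Quotient.symm_trans,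
    Homotopic.Quotient.trans_refl]

theorem conj_transport (h : X ≃ₜ Y) {x : X} {o : Y} (s : Homotopic.Quotient o (h x))
    (g : FundamentalGroup X x) :
    Conj (show Homotopic.Quotient o o from transport h s g)
      (Homotopic.Quotient.map g (h : C(X, Y))) := ⟨s, rfl⟩

end PathClass

open PathClass

variable {D : Finset S2} {o : Punctured D}

theorem isSimpleLoop_iff {c : PiOne D o} : IsSimpleLoop c ↔
    ∃ (j : OrientedDisc) (hj : ∀ z, z ≠ 0 → j.toFun z ∉ D), j.toFun 0 ∈ D ∧
      Conj (show Path.Homotopic.Quotient o o from c)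
        (Path.Homotopic.Quotient.mk (circlePath j hj)) := Iff.rfl

/-- Coordinates on the punctured sphere. -/
def puncturedHomeo {n : ℕ} {v : S2} (J : OrientedDisc) (hr : Set.range J.toFun = {v}ᶜ) (hv : v ∈ D)
    (hJ : ∀ z, J.toFun z ∈ D ↔ ∃ k : ℕ, k < n ∧ z = k) : Plane n ≃ₜ Punctured D :=
  IsHomeomorph.homeomorph
    (fun z : Plane n => (⟨J.toFun z, fun h => by
      obtain ⟨k, hk, hz⟩ := (hJ z).1 h
      exact z.2 k hk hz⟩ : Punctured D)) (by
    rw [isHomeomorph_iff_isEmbedding_surjective]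
    constructor
    · refine Topology.IsEmbedding.of_comp ?_ continuous_subtype_val
        (J.isOpenEmbedding.isEmbedding.comp Topology.IsEmbedding.subtypeVal)
      exact Continuous.subtype_mk (J.smooth.continuous.comp continuous_subtype_val) _
    · rintro ⟨x, hx⟩
      have h1 : x ∈ Set.range J.toFun := by
        rw [hr]
        rintro rfl
        exact hx hv
      obtain ⟨z, rfl⟩ := h1
      exact ⟨⟨z, fun k hk hz => hx ((hJ z).2 ⟨k, hk, hz⟩)⟩, rfl⟩)

/-- The part of an oriented disc in the punctured sphere. -/
def puncturedMap {n : ℕ} (J : OrientedDisc) (hJ : ∀ z, J.toFun z ∈ D ↔ ∃ k : ℕ, k < n ∧ z = k) :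
    C(Plane n, Punctured D) where
  toFun z := ⟨J.toFun z, fun h => by
    obtain ⟨k, hk, hz⟩ := (hJ z).1 h
    exact z.2 k hk hz⟩
  continuous_toFun := Continuous.subtype_mk (J.smooth.continuous.comp continuous_subtype_val) _

/-- The translation of an oriented disc. -/
def OrientedDisc.translate (J : OrientedDisc) (p : ℂ) : OrientedDisc :=
  J.comp (S := fun z => z + p) (contDiff_id.add contDiff_const) (add_left_injective p) (fun z => by
    simp [cross])

/-- A disc that is centered at one of the marked points in the plane. -/
theorem conj_circlePath_map {n : ℕ} (J : OrientedDisc)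
    (hJ : ∀ z, J.toFun z ∈ D ↔ ∃ k : ℕ, k < n ∧ z = k) (j : OrientedDisc)
    (hj : ∀ z, z ≠ 0 → j.toFun z ∉ D) {k : ℕ} (hk : j.toFun 0 = J.toFun k) :
    Conj (Path.Homotopic.Quotient.mk (circlePath j hj))
      (Path.Homotopic.Quotient.map (show FundamentalGroup (Plane n) (Plane.base n) from
        (Plane.loop n k)⁻¹ * Plane.loop n (k + 1)) (puncturedMap J hJ)) := by
  have hball : ∀ z : ℂ, z ≠ 0 → ‖z‖ < 1 → ∀ i : ℕ, z + k ≠ i := by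
    intro z hz hz1 i hi
    have h1 : z = ((i - k : ℤ) : ℂ) := by push_cast; linear_combination hi
    rw [h1, Complex.norm_intCast] at hz1
    have h2 : ((i - k : ℤ)) = 0 := by
      rw [← Int.abs_lt_one_iff]
      exact_mod_cast hz1
    rw [h2] at h1
    exact hz (by simpa using h1)
  have h0 : ∀ z, z ≠ 0 → ‖z‖ < 1 → (J.translate k).toFun z ∉ D := fun z hz hz1 h => by
    obtain ⟨i, _, hi⟩ := (hJ (z + k)).1 h
    exact hball z hz hz1 i hi
  have hr0 : ((1 / 2 : ℝ) : ℂ) ≠ 0 := by norm_num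
  have hr1 : ‖((1 / 2 : ℝ) : ℂ)‖ < 1 := by rw [Complex.norm_real]; norm_num
  have h1 := conj_circlePath j (J.translate k) (by
    rw [hk]
    change _ = J.toFun (0 + k)
    rw [zero_add]) hj h0 hr0 hr1
  let g : C(Circle, Plane n) :=
    ⟨fun z => ⟨((1 / 2 : ℝ) : ℂ) * z + k, fun i _ => hball _ (mul_ne_zero hr0 z.coe_ne_zero)
      (by rw [norm_mul, Circle.norm_coe, mul_one]; exact hr1) i⟩,
      Continuous.subtype_mk (by fun_prop) _⟩
  have h2 := Plane.conj_circ_small g (k := k) (by norm_num) (by norm_num) fun z => rfl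
  exact h1.trans (h2.map (puncturedMap J hJ))

section

variable {n : ℕ} {v : S2} (J : OrientedDisc) (hr : Set.range J.toFun = {v}ᶜ)
    (hv : v ∈ D) (hJ : ∀ z, J.toFun z ∈ D ↔ ∃ k : ℕ, k < n ∧ z = k)

theorem conj_circlePath_finite (j : OrientedDisc) (hj : ∀ z, z ≠ 0 → j.toFun z ∉ D) {k : ℕ}
    (hk : j.toFun 0 = J.toFun k) (s : Path.Homotopic.Quotient o (puncturedHomeo J hr hv hJ (Plane.base n))) :
    Conj (Path.Homotopic.Quotient.mk (circlePath j hj)) (show Path.Homotopic.Quotient o o from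
      transport (puncturedHomeo J hr hv hJ) s ((Plane.loop n k)⁻¹ * Plane.loop n (k + 1))) :=
  (conj_circlePath_map J hJ j hj hk).trans (conj_transport (puncturedHomeo J hr hv hJ) s _).symm

/-- A disc that is centered at the marked point at infinity. -/
theorem conj_circlePath_infinite (Jinf : OrientedDisc) (hinf : Jinf.toFun 0 = v) {M : ℝ}
    (hM : ∀ z, z ≠ 0 → ∃ w, ‖w - z⁻¹‖ ≤ M ∧ Jinf.toFun z = J.toFun w)
    (j : OrientedDisc) (hj : ∀ z, z ≠ 0 → j.toFun z ∉ D)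
    (hk : j.toFun 0 = v) (s : Path.Homotopic.Quotient o (puncturedHomeo J hr hv hJ (Plane.base n))) :
    Conj (Path.Homotopic.Quotient.mk (circlePath j hj)) (show Path.Homotopic.Quotient o o from
      transport (puncturedHomeo J hr hv hJ) s (Plane.loop n n)⁻¹) := by
  have hM0 : 0 ≤ M := by
    obtain ⟨w, hw, _⟩ := hM 1 one_ne_zero
    exact (norm_nonneg _).trans hw
  -- With this radius the circle R / z stays farther than n + M from 0, so every curve within
  -- distance M of it avoids the punctures.
  let R : ℝ := n + M + 1
  have hR : 0 < R := by positivity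
  have hfar : ∀ w x : ℂ, (n : ℝ) + M < ‖x‖ → ‖w - x‖ ≤ M → ∀ i : ℕ, i < n → w ≠ i := by
    rintro w x hx hw i hi rfl
    have h1 : ‖x‖ ≤ ‖(i : ℂ)‖ + ‖(i : ℂ) - x‖ := by
      have := norm_sub_le (i : ℂ) (i - x)
      simpa using this
    rw [Complex.norm_natCast] at h1
    have h2 : (i : ℝ) < n := by exact_mod_cast hi
    linarith
  let ε : ℝ := (n + M + 1 / 2)⁻¹
  have hε0 : (0 : ℝ) < n + M + 1 / 2 := by positivity
  have hinvn : ∀ z : ℂ, z ≠ 0 → ‖z‖ < ε → (n : ℝ) + M < ‖z⁻¹‖ := fun z hz h => by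
    rw [norm_inv]
    have h1 := (lt_inv_comm₀ (norm_pos_iff.2 hz) hε0).1 h
    linarith
  have h0 : ∀ z, z ≠ 0 → ‖z‖ < ε → Jinf.toFun z ∉ D := fun z hz h h' => by
    obtain ⟨w, hw, hw'⟩ := hM z hz
    rw [hw'] at h'
    obtain ⟨i, hi, hi'⟩ := (hJ w).1 h'
    exact hfar w _ (hinvn z hz h) hw i hi hi'
  have hr0 : ((R⁻¹ : ℝ) : ℂ) ≠ 0 := by exact_mod_cast (inv_pos.2 hR).ne'
  have hr1 : ‖((R⁻¹ : ℝ) : ℂ)‖ < ε := by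
    rw [Complex.norm_real, Real.norm_eq_abs, abs_of_pos (inv_pos.2 hR)]
    exact inv_strictAnti₀ hε0 (by simp only [R]; linarith)
  have h1 := conj_circlePath j Jinf (hk.trans hinf.symm) hj h0 hr0 hr1
  let E := puncturedHomeo J hr hv hJ
  let f : C(Circle, Punctured D) := (Jinf.toPunctured h0).comp (PuncturedDisc.round _ hr0 hr1)
  let g : C(Circle, Plane n) := (E.symm : C(Punctured D, Plane n)).comp f
  have hfg : f = (E : C(Plane n, Punctured D)).comp g := by
    ext1 z
    exact (E.apply_symm_apply _).symm
  have hgz : ∀ z, ‖(g z : ℂ) - R * (z : ℂ)⁻¹‖ ≤ M := fun z => by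
    have hz : ((R⁻¹ : ℝ) : ℂ) * z ≠ 0 := mul_ne_zero hr0 z.coe_ne_zero
    obtain ⟨w, hw, hw'⟩ := hM _ hz
    have h2 : (g z : ℂ) = w := by
      refine J.injective ?_
      rw [← hw']
      exact congrArg Subtype.val (E.apply_symm_apply (f z))
    rw [h2]
    refine le_of_eq_of_le ?_ hw
    congr 2
    rw [mul_inv]
    push_cast
    rw [inv_inv]
  have hRz : ∀ z : Circle, ‖(R : ℂ) * (z : ℂ)⁻¹‖ = R := fun z => by
    rw [norm_mul, norm_inv, Circle.norm_coe, Complex.norm_real, Real.norm_eq_abs, abs_of_pos hR,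
      inv_one, mul_one]
  have hlarge : ∀ z : Circle, (n : ℝ) + M < ‖(R : ℂ) * (z : ℂ)⁻¹‖ := fun z => by
    rw [hRz]
    simp only [R]
    linarith
  let g' : C(Circle, Plane n) := ⟨fun z => ⟨R * (z : ℂ)⁻¹, hfar _ _ (hlarge z) (by simpa using hM0)⟩,
    Continuous.subtype_mk (continuous_const.mul (Continuous.inv₀ (by fun_prop) fun z => z.coe_ne_zero)) _⟩
  have hhom : g.Homotopic g' := by
    refine ⟨⟨⟨fun q => ⟨(1 - (q.1 : ℝ)) * g q.2 + (q.1 : ℝ) * (R * (q.2 : ℂ)⁻¹),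
      hfar _ _ (hlarge q.2) ?_⟩, ?_⟩, ?_, ?_⟩⟩
    · have h2 : (1 - ((q.1 : ℝ) : ℂ)) * g q.2 + (q.1 : ℝ) * (R * (q.2 : ℂ)⁻¹) - R * (q.2 : ℂ)⁻¹ =
          ((1 - q.1 : ℝ) : ℂ) * (g q.2 - R * (q.2 : ℂ)⁻¹) := by
        push_cast
        ring
      rw [h2, norm_mul, Complex.norm_real, Real.norm_eq_abs, abs_of_nonneg (by linarith [q.1.2.2])]
      have h3 := hgz q.2
      have h4 := norm_nonneg ((g q.2 : ℂ) - R * (q.2 : ℂ)⁻¹)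
      nlinarith [q.1.2.1]
    · refine Continuous.subtype_mk ?_ _
      have h2 : Continuous fun q : unitInterval × Circle => ((q.2 : ℂ))⁻¹ :=
        Continuous.inv₀ (by fun_prop) fun q => q.2.coe_ne_zero
      fun_prop
    · intro z
      refine Subtype.ext ?_
      simp
    · intro z
      refine Subtype.ext ?_
      simp [g']
  have h2 := (conj_circ hhom).trans (Plane.conj_circ_large g' (r := R)
    (by simp only [R]; linarith) fun z => rfl)
  have h3 := (h2.map (E : C(Plane n, Punctured D))).trans (conj_transport E s _).symm
  have h4 : ∀ f' : C(Circle, Punctured D), f' = (E : C(Plane n, Punctured D)).comp g →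
      Conj (circ f') (show Path.Homotopic.Quotient o o from
        transport E s (Plane.loop n n)⁻¹) := by
    rintro _ rfl
    exact h3
  exact h1.trans (h4 f hfg)

/-- The small discs around the marked points in the plane. -/
theorem exists_disc (hJ : ∀ z, J.toFun z ∈ D ↔ ∃ k : ℕ, k < n ∧ z = k) (k : ℕ) : ∃ j : OrientedDisc, (∀ z, z ≠ 0 → j.toFun z ∉ D) ∧
    j.toFun 0 = J.toFun k := by
  have hatan : ∀ t : ℝ, |Real.arctan t / Real.pi| < 1 / 2 := fun t => by
    rw [abs_div, abs_of_pos Real.pi_pos, div_lt_iff₀ Real.pi_pos, abs_lt]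
    constructor <;> linarith [Real.neg_pi_div_two_lt_arctan t, Real.arctan_lt_pi_div_two t]
  -- This squeezes the plane into the open unit square with centre 0, in which 0 is the only
  -- integer.
  let S : ℂ → ℂ := fun z => (Real.arctan z.re / Real.pi : ℝ) + (Real.arctan z.im / Real.pi : ℝ) * Complex.I
  have hre : ∀ z, (S z).re = Real.arctan z.re / Real.pi := fun z => by
    simp only [S, Complex.add_re, Complex.ofReal_re, Complex.re_ofReal_mul, Complex.I_re, mul_zero, add_zero]
  have him : ∀ z, (S z).im = Real.arctan z.im / Real.pi := fun z => by
    simp only [S, Complex.add_im, Complex.ofReal_im, Complex.im_ofReal_mul, Complex.I_im, mul_one, zero_add]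
  have hS : ContDiff ℝ ∞ S := by
    have h1 : ContDiff ℝ ∞ fun z : ℂ => Real.arctan z.re / Real.pi :=
      (Real.contDiff_arctan.comp contDiff_re).div_const _
    have h2 : ContDiff ℝ ∞ fun z : ℂ => Real.arctan z.im / Real.pi :=
      (Real.contDiff_arctan.comp contDiff_im).div_const _
    exact (Complex.ofRealCLM.contDiff.comp h1).add
      ((Complex.ofRealCLM.contDiff.comp h2).mul contDiff_const)
  have hinj : Function.Injective S := fun z w h => by
    have h1 := congrArg Complex.re h
    have h2 := congrArg Complex.im h
    rw [hre, hre, div_left_inj' Real.pi_pos.ne'] at h1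
    rw [him, him, div_left_inj' Real.pi_pos.ne'] at h2
    exact Complex.ext (Real.arctan_injective h1) (Real.arctan_injective h2)
  have hd : ∀ z a : ℂ, fderiv ℝ S z a = ((1 / (1 + z.re ^ 2) * a.re) / Real.pi : ℝ) +
      ((1 / (1 + z.im ^ 2) * a.im) / Real.pi : ℝ) * Complex.I := fun z a => by
    have h1 : HasFDerivAt (fun z : ℂ => Real.arctan z.re) _ z :=
      (Real.hasDerivAt_arctan z.re).comp_hasFDerivAt z (Complex.reCLM.hasFDerivAt (x := z))
    have h2 : HasFDerivAt (fun z : ℂ => Real.arctan z.im) _ z :=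
      (Real.hasDerivAt_arctan z.im).comp_hasFDerivAt z (Complex.imCLM.hasFDerivAt (x := z))
    have h3 := (Complex.ofRealCLM.hasFDerivAt.comp z (h1.mul_const Real.pi⁻¹)).add
      ((Complex.ofRealCLM.hasFDerivAt.comp z (h2.mul_const Real.pi⁻¹)).mul_const Complex.I)
    have hS' : S = ((fun t : ℝ => (t : ℂ)) ∘ fun y : ℂ => Real.arctan y.re * Real.pi⁻¹) + fun y =>
        ((fun t : ℝ => (t : ℂ)) ∘ fun y : ℂ => Real.arctan y.im * Real.pi⁻¹) y * Complex.I := by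
      funext z
      simp only [S, div_eq_mul_inv, Pi.add_apply, Function.comp_apply]
    have h4 : HasFDerivAt S _ z := hS' ▸ h3
    rw [h4.fderiv]
    simp
    ring
  have hpos : ∀ z, 0 < cross (fderiv ℝ S z 1) (fderiv ℝ S z Complex.I) := fun z => by
    rw [hd, hd]
    simp only [cross, Complex.add_re, Complex.add_im, Complex.ofReal_re, Complex.ofReal_im,
      Complex.re_ofReal_mul, Complex.im_ofReal_mul, Complex.one_re, Complex.one_im, Complex.I_re,
      Complex.I_im, mul_zero, mul_one, zero_add, add_zero, zero_div, sub_zero]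
    positivity
  have hS0 : S 0 = 0 := by simp only [S, Complex.zero_re, Complex.zero_im, Real.arctan_zero, zero_div, Complex.ofReal_zero, zero_mul, add_zero]
  refine ⟨(J.translate k).comp hS hinj hpos, fun z hz h => ?_, ?_⟩
  · obtain ⟨i, _, hi⟩ := (hJ (S z + k)).1 h
    have hr1 : (S z).re = (i - k : ℤ) := by
      have := congrArg Complex.re hi
      simp at this
      push_cast
      linarith
    have hi1 : (S z).im = 0 := by
      have := congrArg Complex.im hi
      simpa using this
    have h1 : |((i - k : ℤ) : ℝ)| < 1 := by
      rw [← hr1, hre]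
      linarith [hatan z.re]
    have h2 : ((i - k : ℤ)) = 0 := by
      rw [← Int.abs_lt_one_iff]
      exact_mod_cast h1
    rw [h2] at hr1
    refine hz (hinj ?_)
    rw [hS0]
    exact Complex.ext (by simpa using hr1) hi1
  · change J.toFun (S 0 + k) = _
    rw [hS0, zero_add]

end

end

/-- Standard generators of the fundamental group of the punctured sphere: it is free on the `n`
simple loops `(W k)⁻¹ * W (k + 1)`, and the half-turns act on these by the Hurwitz moves. -/
structure HurwitzGenerators (D : Finset S2) (o : Punctured D) (n : ℕ) where
  W : ℕ → PiOne D o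
  zero : W 0 = 1
  eq_top : ∀ H : Subgroup (PiOne D o), (∀ k ≤ n, W k ∈ H) → H = ⊤
  exists_hom : ∀ {G : Type} [Group G] (w : ℕ → G), w 0 = 1 →
    ∃ Φ : PiOne D o →* G, ∀ k ≤ n, Φ (W k) = w k
  isSimpleLoop : ∀ k < n, IsSimpleLoop ((W k)⁻¹ * W (k + 1))
  isConj : ∀ c, IsSimpleLoop c → (∃ k < n, IsConj c ((W k)⁻¹ * W (k + 1))) ∨ IsConj c (W n)⁻¹
  exists_push : ∀ k, k + 1 < n → ∃ (f : DiffPlus D) (p : Path.Homotopic.Quotient o (restr f o)),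
    (∀ i, i ≠ k + 1 → pushHom f p (W i) = W i) ∧
    pushHom f p (W (k + 1)) = W k * (W (k + 1))⁻¹ * W (k + 2)

open PathClass in
theorem exists_generators {D : Finset S2} {n : ℕ} (hD : D.card = n + 1) (o : Punctured D) :
    Nonempty (HurwitzGenerators D o n) := by
  obtain ⟨J, Jinf, hr, hv, hJ, M, hM⟩ := exists_discs hD
  let E := puncturedHomeo J hr hv hJ
  obtain ⟨s⟩ : Nonempty (Path.Homotopic.Quotient o (E (Plane.base n))) :=
    ⟨Path.Homotopic.Quotient.mk (PathConnectedSpace.somePath _ _)⟩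
  let τ := transport E s
  refine ⟨⟨fun k => τ (Plane.loop n k), ?_, ?_, ?_, ?_, ?_, ?_⟩⟩
  · simp only [Plane.loop_zero, map_one]
  · intro H hH
    have h1 : H.comap τ.toMonoidHom = ⊤ := Plane.eq_top_of_loop_mem _ hH
    rw [eq_top_iff]
    intro x _
    obtain ⟨y, rfl⟩ := τ.surjective x
    have : y ∈ H.comap τ.toMonoidHom := by rw [h1]; trivial
    exact this
  · intro G _ w hw
    obtain ⟨Φ, hΦ⟩ := Plane.exists_hom n w hw
    refine ⟨Φ.comp (τ.symm : PiOne D o →* _), fun k hk => ?_⟩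
    rw [← hΦ k hk]
    exact congrArg Φ (τ.symm_apply_apply _)
  · intro k hk
    obtain ⟨j, hj, hj0⟩ := exists_disc J hJ k
    refine isSimpleLoop_iff.2 ⟨j, hj, ?_, ?_⟩
    · rw [hj0]
      exact (hJ k).2 ⟨k, hk, rfl⟩
    · have := (conj_circlePath_finite J hr hv hJ j hj hj0 s).symm
      rwa [map_mul, map_inv] at this
  · intro c hc
    obtain ⟨j, hj, hj0, h⟩ := isSimpleLoop_iff.1 hc
    by_cases h1 : j.toFun 0 = Jinf.toFun 0
    · right
      have := (h.trans (conj_circlePath_infinite J hr hv hJ Jinf rfl hM j hj h1 s)).isConj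
      rwa [map_inv] at this
    · left
      have h2 : j.toFun 0 ∈ Set.range J.toFun := by
        rw [hr]
        exact h1
      obtain ⟨z, hz⟩ := h2
      rw [← hz] at hj0
      obtain ⟨k, hk, rfl⟩ := (hJ z).1 hj0
      refine ⟨k, hk, ?_⟩
      have := (h.trans (conj_circlePath_finite J hr hv hJ j hj hz.symm s)).isConj
      rwa [map_mul, map_inv] at this
  · intro k hk
    -- Both directions of the half-turn permute the marked integers; the inverse direction gives the
    -- converse inclusion in the preservation of `D`.
    have hpm : ∀ (s : ℝ), (s = 1 ∨ s = -1) → ∀ i : ℕ, i < n → ∃ i' : ℕ, i' < n ∧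
        halfTurn' s k i = i' := by
      intro s hs i hi
      have hexp : ∀ z : ℂ, ‖z‖ ≤ 1 → turn s z = -z := fun z hz => by
        rw [turn, Real.smoothTransition.one_of_one_le (by linarith), mul_one]
        rcases hs with rfl | rfl
        · rw [one_mul, Complex.exp_pi_mul_I, mul_neg_one]
        · have : ((-1 * Real.pi : ℝ) : ℂ) * Complex.I = -(Real.pi * Complex.I) := by
            push_cast; ring
          rw [this, Complex.exp_neg, Complex.exp_pi_mul_I]
          norm_num
      by_cases h1 : i = k
      · subst h1
        refine ⟨i + 1, hk, ?_⟩
        rw [halfTurn', hexp]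
        · push_cast; ring
        · have : (2 * ((i : ℂ) - (i + 1 / 2))) = -1 := by ring
          rw [this]; simp
      · by_cases h2 : i = k + 1
        · subst h2
          refine ⟨k, by omega, ?_⟩
          rw [halfTurn', hexp]
          · push_cast; ring
          · have : (2 * (((k + 1 : ℕ) : ℂ) - (k + 1 / 2))) = 1 := by push_cast; ring
            rw [this]; simp
        · refine ⟨i, hi, halfTurn'_eq_self ?_⟩
          have : ((i : ℂ) - (k + 1 / 2)) = ((i - (k + 1 / 2) : ℝ) : ℂ) := by push_cast; ring
          rw [this, Complex.norm_real, Real.norm_eq_abs]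
          rcases lt_or_gt_of_ne h1 with h3 | h3
          · have : (i : ℝ) + 1 ≤ k := by exact_mod_cast h3
            rw [abs_of_neg] <;> linarith
          · have : (k : ℝ) + 2 ≤ i := by exact_mod_cast (by omega : k + 2 ≤ i)
            rw [abs_of_pos] <;> linarith
    have hD' : ∀ z, J.toFun (halfTurn' 1 k z) ∈ D ↔ J.toFun z ∈ D := by
      intro z
      rw [hJ, hJ]
      constructor
      · rintro ⟨i, hi, h⟩
        obtain ⟨i', hi', h'⟩ := hpm (-1) (Or.inr rfl) i hi
        exact ⟨i', hi', by rw [← h', ← h, halfTurn'_halfTurn']⟩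
      · rintro ⟨i, hi, rfl⟩
        exact hpm 1 (Or.inl rfl) i hi
    have hinv' : ∀ z, halfTurn' 1 k (halfTurn' (-1) k z) = z := fun z => by
      simpa using halfTurn'_halfTurn' (-1) k z
    obtain ⟨f, hf⟩ := J.exists_diffPlus (D := D) (contDiff_halfTurn' 1 k) (contDiff_halfTurn' (-1) k)
      (halfTurn'_halfTurn' 1 k) hinv' (R := k + 2) (fun z hz => halfTurn'_eq_self_of_large hz) hD'
    let T : C(Plane n, Plane n) := ⟨fun z => ⟨Plane.halfTurn k z, fun i hi h => by
      rw [← halfTurn'_one] at h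
      have h1 := (hD' z).1 ((hJ _).2 ⟨i, hi, h⟩)
      obtain ⟨i', hi', h'⟩ := (hJ _).1 h1
      exact z.2 i' hi' h'⟩, by
      refine Continuous.subtype_mk ?_ _
      rw [← halfTurn'_one]
      exact (contDiff_halfTurn' 1 k).continuous.comp continuous_subtype_val⟩
    have hT : ∀ z : Plane n, (T z : ℂ) = Plane.halfTurn k z := fun z => rfl
    have hfE : ∀ z, restr f (E z) = E (T z) := fun z => Subtype.ext ((hf z).trans (by
      rw [halfTurn'_one]
      rfl))
    have hbase : restr f (E (Plane.base n)) = E (Plane.base n) := by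
      rw [hfE, Plane.apply_base hT]
    -- The half-turn fixes the base point of the plane. Going there along `s` and back along the
    -- image of `s` makes the push correspond to `T` under `τ`.
    let p : Path.Homotopic.Quotient o (restr f o) := s.trans (mapTo (restr f) rfl hbase s).symm
    have hp : ∀ g, pushHom f p (τ g) =
        τ (mapTo T (Plane.apply_base hT) (Plane.apply_base hT) g) := by
      intro g
      rw [pushHom_apply]
      have e1 : mapTo (restr f) rfl rfl (show Path.Homotopic.Quotient o o from τ g) =
          (mapTo (restr f) rfl hbase s).trans ((mapTo (restr f) hbase hbase
            (Path.Homotopic.Quotient.map g (E : C(Plane n, Punctured D)))).trans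
              (mapTo (restr f) rfl hbase s).symm) := by
        rw [← mapTo_symm, ← mapTo_trans, ← mapTo_trans]
        rfl
      have e2 : mapTo (restr f) hbase hbase
          (Path.Homotopic.Quotient.map g (E : C(Plane n, Punctured D))) =
          Path.Homotopic.Quotient.map (mapTo T (Plane.apply_base hT) (Plane.apply_base hT) g)
            (E : C(Plane n, Punctured D)) := by
        have h1 : restr f (E (Plane.base n)) = E (Plane.base n) := hbase
        have e3 := mapTo_comp (E : C(Plane n, Punctured D)) (restr f)
          ((restr f).comp (E : C(Plane n, Punctured D))) (fun _ => rfl) rfl rfl hbase hbase hbase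
            hbase g
        have e4 := mapTo_comp T (E : C(Plane n, Punctured D))
          ((restr f).comp (E : C(Plane n, Punctured D))) hfE (Plane.apply_base hT)
            (Plane.apply_base hT) rfl rfl hbase hbase g
        rw [mapTo_rfl] at e3 e4
        exact e3.trans e4.symm
      rw [mapTo_rfl] at e1
      change p.trans ((Path.Homotopic.Quotient.map (show Path.Homotopic.Quotient o o from τ g)
        (restr f)).trans p.symm) = s.trans ((Path.Homotopic.Quotient.map (mapTo T _ _ g)
          (E : C(Plane n, Punctured D))).trans s.symm)
      rw [e1, e2]
      simp only [p, symm_trans_rev, PathClass.symm_symm, Path.Homotopic.Quotient.trans_assoc,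
        symm_trans_cancel]
    refine ⟨f, p, fun i hi => ?_, ?_⟩
    · rw [hp, Plane.mapTo_loop hT hi]
    · rw [hp, Plane.mapTo_loop_succ hT, map_mul, map_mul, map_inv]

/-! ### The cubes of the simple braids -/

section complement

variable {D : Finset S2}

instance Plane.pathConnected (n : ℕ) : PathConnectedSpace (Plane n) := by
  have h1 : ({z : ℂ | ∃ k : ℕ, k < n ∧ z = k}).Finite := by
    refine ((Finset.range n).finite_toSet.image fun k : ℕ => (k : ℂ)).subset ?_
    rintro z ⟨k, hk, rfl⟩
    exact ⟨k, by simpa using hk, rfl⟩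
  have h2 := h1.countable.isPathConnected_compl_of_one_lt_rank (E := ℂ) (by
    rw [Complex.rank_real_complex]; norm_num)
  have h3 : {z : ℂ | ∃ k : ℕ, k < n ∧ z = k}ᶜ = {z : ℂ | ∀ k : ℕ, k < n → z ≠ k} := by
    ext z
    simp
  rw [h3, isPathConnected_iff_pathConnectedSpace] at h2
  exact h2

/-- This is the image of a half plane under the exponential map. -/
theorem isPathConnected_norm_gt {r : ℝ} (hr : 0 < r) : IsPathConnected {z : ℂ | r < ‖z‖} := by
  have h1 : IsPathConnected {z : ℂ | Real.log r < z.re} :=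
    (convex_halfSpace_re_gt _).isPathConnected ⟨(Real.log r + 1 : ℝ), by simp⟩
  have h2 : {z : ℂ | r < ‖z‖} = Complex.exp '' {z : ℂ | Real.log r < z.re} := by
    ext z
    constructor
    · intro hz
      have hz0 : z ≠ 0 := norm_pos_iff.1 (hr.trans hz)
      refine ⟨Complex.log z, ?_, Complex.exp_log hz0⟩
      change Real.log r < (Complex.log z).re
      rw [Complex.log_re]
      exact Real.log_lt_log hr hz
    · rintro ⟨w, hw, rfl⟩
      change r < ‖Complex.exp w‖
      rw [Complex.norm_exp]
      exact (Real.log_lt_iff_lt_exp hr).1 hw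
  rw [h2]
  exact h1.image Complex.continuous_exp

/-- The complement of a closed disc in the punctured sphere. -/
def OrientedDisc.outside (D : Finset S2) (j : OrientedDisc) (r : ℝ) : Set (Punctured D) :=
  {x | (x : S2) ∉ j.toFun '' Metric.closedBall 0 r}

theorem OrientedDisc.isOpen_outside (j : OrientedDisc) (r : ℝ) : IsOpen (j.outside D r) := by
  have h1 : IsClosed (j.toFun '' Metric.closedBall 0 r) :=
    ((isCompact_closedBall 0 r).image j.smooth.continuous).isClosed
  exact h1.isOpen_compl.preimage continuous_subtype_val

theorem OrientedDisc.isPathConnected_annulus (j : OrientedDisc) {r : ℝ} (hr : 0 < r)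
    (hj : ∀ z, r < ‖z‖ → j.toFun z ∉ D) :
    IsPathConnected ({x : Punctured D | (x : S2) ∈ Set.range j.toFun} ∩ j.outside D r) := by
  have h1 := isPathConnected_norm_gt hr
  rw [isPathConnected_iff_pathConnectedSpace] at h1
  have h2 : Continuous fun z : {z : ℂ | r < ‖z‖} => (⟨j.toFun z, hj z z.2⟩ : Punctured D) :=
    Continuous.subtype_mk (j.smooth.continuous.comp continuous_subtype_val) _
  have h3 := isPathConnected_range h2
  convert h3 using 1
  ext x
  constructor
  · rintro ⟨⟨z, hz⟩, hx⟩
    have h4 : r < ‖z‖ := by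
      by_contra h5
      exact hx ⟨z, by simpa using h5, hz⟩
    exact ⟨⟨z, h4⟩, Subtype.ext hz⟩
  · rintro ⟨z, rfl⟩
    refine ⟨⟨z, rfl⟩, ?_⟩
    rintro ⟨w, hw, h4⟩
    rw [j.injective h4, mem_closedBall_zero_iff] at hw
    exact absurd z.2 (not_lt.2 hw)

/-- Follow a path in the punctured sphere to a point of the annulus and stop when it first meets the
closed disc of radius r + 1: the path stays outside up to then, and the annulus is connected. -/
theorem OrientedDisc.isPathConnected_outside (j : OrientedDisc) {r : ℝ} (hr : 0 < r)
    (hj : ∀ z, r < ‖z‖ → j.toFun z ∉ D) : IsPathConnected (j.outside D r) := by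
  have hann := j.isPathConnected_annulus hr hj
  have hsub : {x : Punctured D | (x : S2) ∈ Set.range j.toFun} ∩ j.outside D r ⊆ j.outside D r :=
    Set.inter_subset_right
  have hr1 : r < ‖((r + 1 : ℝ) : ℂ)‖ := by
    rw [Complex.norm_real, Real.norm_eq_abs, abs_of_pos (by linarith)]
    linarith
  let y : Punctured D := ⟨j.toFun (r + 1 : ℝ), hj _ hr1⟩
  have hy : y ∈ {x : Punctured D | (x : S2) ∈ Set.range j.toFun} ∩ j.outside D r := by
    refine ⟨⟨_, rfl⟩, ?_⟩
    rintro ⟨w, hw, h4⟩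
    rw [j.injective h4, mem_closedBall_zero_iff] at hw
    exact absurd hr1 (not_lt.2 hw)
  refine ⟨y, hy.2, fun {x} hx => ?_⟩
  by_cases hx' : (x : S2) ∈ j.toFun '' Metric.closedBall 0 (r + 1)
  · obtain ⟨z, _, hz⟩ := hx'
    exact (hann.joinedIn y hy x ⟨⟨z, hz⟩, hx⟩).mono hsub
  · obtain ⟨γ⟩ := PathConnectedSpace.joined x y
    let K : Set ℝ := {t | t ∈ Set.Icc (0 : ℝ) 1 ∧
      ((γ.extend t : Punctured D) : S2) ∈ j.toFun '' Metric.closedBall 0 (r + 1)}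
    have hclosed : IsClosed (j.toFun '' Metric.closedBall 0 (r + 1)) :=
      ((isCompact_closedBall 0 (r + 1)).image j.smooth.continuous).isClosed
    have hcont : Continuous fun t => ((γ.extend t : Punctured D) : S2) :=
      continuous_subtype_val.comp γ.continuous_extend
    have hK : IsCompact K := isCompact_Icc.inter_right (hclosed.preimage hcont)
    have hKne : K.Nonempty := by
      refine ⟨1, ⟨zero_le_one, le_rfl⟩, ?_⟩
      rw [γ.extend_one]
      refine ⟨(r + 1 : ℝ), ?_, rfl⟩
      rw [mem_closedBall_zero_iff, Complex.norm_real, Real.norm_eq_abs, abs_of_pos (by linarith)]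
    obtain ⟨t₀, ⟨ht₀, ht₁⟩, hleast⟩ := hK.exists_isLeast hKne
    have hbefore : ∀ t, 0 ≤ t → t < t₀ →
        ((γ.extend t : Punctured D) : S2) ∉ j.toFun '' Metric.closedBall 0 (r + 1) :=
      fun t h0 h1 h2 => not_le.2 h1 (hleast ⟨⟨h0, h1.le.trans ht₀.2⟩, h2⟩)
    have hpos : 0 < t₀ := by
      refine lt_of_le_of_ne ht₀.1 fun h => hx' ?_
      rw [← h, γ.extend_zero] at ht₁
      exact ht₁
    have hout : ∀ t ∈ Set.Icc 0 t₀, γ.extend t ∈ j.outside D r := by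
      rintro t ⟨h0, h1⟩
      rcases lt_or_eq_of_le h1 with h1 | rfl
      · exact fun h => hbefore t h0 h1 (Set.image_mono (Metric.closedBall_subset_closedBall (by linarith)) h)
      -- A point of the disc of radius `r` lies in the open disc of radius r + 1, which would have
      -- been met earlier.
      · intro h
        have hop : IsOpen (j.toFun '' Metric.ball 0 (r + 1)) := j.isOpenMap _ Metric.isOpen_ball
        have hmem : ((γ.extend t : Punctured D) : S2) ∈ j.toFun '' Metric.ball 0 (r + 1) :=
          Set.image_mono (Metric.closedBall_subset_ball (by linarith)) h
        have hnear := hcont.continuousAt.eventually (hop.mem_nhds hmem)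
        have hleft : ∀ᶠ u in nhdsWithin t (Set.Iio t), u ∈ Set.Ioo 0 t := Ioo_mem_nhdsLT hpos
        obtain ⟨u, hu, hu'⟩ := (hleft.and (hnear.filter_mono nhdsWithin_le_nhds)).exists
        exact hbefore u hu.1.le hu.2 (Set.image_mono Metric.ball_subset_closedBall hu')
    have hpath : IsPathConnected (γ.extend '' Set.Icc 0 t₀) :=
      ((convex_Icc 0 t₀).isPathConnected ⟨0, le_rfl, hpos.le⟩).image γ.continuous_extend
    have h1 : JoinedIn (j.outside D r) (γ.extend t₀) x := by
      refine (hpath.joinedIn _ ⟨t₀, ⟨hpos.le, le_rfl⟩, rfl⟩ _ ⟨0, ⟨le_rfl, hpos.le⟩, γ.extend_zero⟩).mono ?_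
      rintro _ ⟨t, ht, rfl⟩
      exact hout t ht
    have h2 : γ.extend t₀ ∈ {x : Punctured D | (x : S2) ∈ Set.range j.toFun} ∩ j.outside D r := by
      obtain ⟨z, _, hz⟩ := ht₁
      exact ⟨⟨z, hz⟩, hout t₀ ⟨hpos.le, le_rfl⟩⟩
    exact ((hann.joinedIn y hy _ h2).mono hsub).trans h1

end complement

noncomputable section

open PathClass

/-- The homomorphism of fundamental groups given by a map with prescribed image of the base
point. -/
def mapHom {X Y : Type} [TopologicalSpace X] [TopologicalSpace Y] (f : C(X, Y)) {x : X} {y : Y}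
    (h : f x = y) : FundamentalGroup X x →* FundamentalGroup Y y where
  toFun g := mapTo f h h g
  map_one' := mapTo_refl f h
  map_mul' a b := mapTo_trans f h h h b a

variable {D : Finset S2} {o : Punctured D}

theorem transport_refl {X : Type} [TopologicalSpace X] {x o : X} (s : Path.Homotopic.Quotient o x)
    (g : FundamentalGroup X x) :
    (show Path.Homotopic.Quotient o o from transport (Homeomorph.refl X) s g) =
      s.trans (Path.Homotopic.Quotient.trans g s.symm) := by
  induction g using Path.Homotopic.Quotient.ind with | _ g => rfl

/-- The action of a diffeomorphism on the fundamental group at a fixed point. -/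
theorem pushHom_transport (f : DiffPlus D) {x : Punctured D} (h : restr f x = x)
    (s : Path.Homotopic.Quotient o x) (g : FundamentalGroup (Punctured D) x) :
    pushHom f (s.trans (mapTo (restr f) rfl h s).symm) (transport (Homeomorph.refl _) s g) =
      transport (Homeomorph.refl _) s (mapHom (restr f) h g) := by
  have e1 := transport_refl s (mapHom (restr f) h g)
  have e2 := transport_refl s g
  refine Eq.trans ?_ e1.symm
  rw [pushHom_apply]
  refine (congrArg (fun t => (s.trans (mapTo (restr f) rfl h s).symm).trans
    ((Path.Homotopic.Quotient.map t (restr f)).trans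
      (s.trans (mapTo (restr f) rfl h s).symm).symm)) e2).trans ?_
  have e3 : (s.trans (Path.Homotopic.Quotient.trans g s.symm)).map (restr f) =
      (mapTo (restr f) rfl h s).trans ((mapTo (restr f) h h g).trans
        (mapTo (restr f) rfl h s).symm) := by
    rw [← mapTo_symm, ← mapTo_trans, ← mapTo_trans]
    exact (mapTo_rfl _ _).symm
  change (s.trans (mapTo (restr f) rfl h s).symm).trans
    (((s.trans (Path.Homotopic.Quotient.trans g s.symm)).map (restr f)).trans
      (s.trans (mapTo (restr f) rfl h s).symm).symm) =
      s.trans (Path.Homotopic.Quotient.trans (mapTo (restr f) h h g) s.symm)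
  rw [e3]
  simp only [symm_trans_rev, PathClass.symm_symm, Path.Homotopic.Quotient.trans_assoc,
    symm_trans_cancel]

/-- If a = b this says a⁻¹ = a; otherwise a b is a 3-cycle that a inverts by conjugation. The left
side is the effect of three half-turns on the first transposition of a pair. -/
theorem swap_relation {a b : Equiv.Perm (Fin 3)} (ha : a.IsSwap) (hb : b.IsSwap) :
    (a * b)⁻¹ * a⁻¹ * (a * b) * (a * b) = a := by
  obtain ⟨x, y, hxy, rfl⟩ := ha
  obtain ⟨z, w, hzw, rfl⟩ := hb
  revert x y z w
  decide

/-- The image of a simple loop in a disc. -/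
theorem isSimpleLoop_transport {n : ℕ} (J : OrientedDisc)
    (hJ : ∀ z, J.toFun z ∈ D ↔ ∃ k : ℕ, k < n ∧ z = k)
    (s : Path.Homotopic.Quotient o (puncturedMap J hJ (Plane.base n))) {k : ℕ} (hk : k < n) :
    IsSimpleLoop (show PiOne D o from transport (Homeomorph.refl (Punctured D)) s
      (mapHom (puncturedMap J hJ) rfl ((Plane.loop n k)⁻¹ * Plane.loop n (k + 1)))) := by
  obtain ⟨j, hj, hj0⟩ := exists_disc J hJ k
  refine isSimpleLoop_iff.2 ⟨j, hj, ?_, ?_⟩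
  · rw [hj0]
    exact (hJ k).2 ⟨k, hk, rfl⟩
  · refine Conj.trans ?_ (conj_circlePath_map J hJ j hj hj0).symm
    refine ⟨s, ?_⟩
    refine (transport_refl s _).trans ?_
    have h (l : Path.Homotopic.Quotient (Plane.base n) (Plane.base n)) :
        mapTo (puncturedMap J hJ) rfl rfl l = l.map (puncturedMap J hJ) := mapTo_rfl _ _
    exact congrArg (fun q => s.trans (Path.Homotopic.Quotient.trans q s.symm))
      (h (show FundamentalGroup (Plane n) (Plane.base n) from
        (Plane.loop n k)⁻¹ * Plane.loop n (k + 1)))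

/-- The half-turn fixes W₂ and takes W₁ to W₁⁻¹ W₂, so three of them take W₁ to W₂⁻¹ W₁⁻¹ W₂². After
applying σ, `swap_relation` identifies this with the image of W₁. -/
theorem halfTurn_cube {T : C(Plane 2, Plane 2)} (hT : ∀ z : Plane 2, (T z : ℂ) = Plane.halfTurn 0 z)
    (σ : FundamentalGroup (Plane 2) (Plane.base 2) →* Equiv.Perm (Fin 3))
    (hσ : ∀ k < 2, (σ ((Plane.loop 2 k)⁻¹ * Plane.loop 2 (k + 1))).IsSwap)
    (g : FundamentalGroup (Plane 2) (Plane.base 2)) :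
    σ (mapHom T (Plane.apply_base hT) (mapHom T (Plane.apply_base hT)
      (mapHom T (Plane.apply_base hT) g))) = σ g := by
  let t := mapHom T (Plane.apply_base hT)
  have ht0 : t (Plane.loop 2 1) = (Plane.loop 2 1)⁻¹ * Plane.loop 2 2 := by
    refine (Plane.mapTo_loop_succ hT).trans ?_
    rw [Plane.loop_zero, one_mul]
  have ht2 : t (Plane.loop 2 2) = Plane.loop 2 2 := Plane.mapTo_loop hT (by norm_num)
  have key : (σ.comp (t.comp (t.comp t))).eqLocus σ = ⊤ := by
    refine Plane.eq_top_of_loop_mem _ fun k hk => ?_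
    refine (?_ : σ (t (t (t (Plane.loop 2 k)))) = σ (Plane.loop 2 k))
    interval_cases k
    · rw [Plane.loop_zero, map_one, map_one, map_one]
    · have h0 := hσ 0 (by norm_num)
      have h1 := hσ 1 (by norm_num)
      rw [zero_add, Plane.loop_zero, inv_one, one_mul] at h0
      have h2 := swap_relation h0 h1
      rw [← map_mul, mul_inv_cancel_left] at h2
      simp only [ht0, ht2, map_mul, map_inv, mul_inv_rev, inv_inv] at h2 ⊢
      refine Eq.trans ?_ h2
      group
    · rw [ht2, ht2, ht2]
  have : g ∈ (σ.comp (t.comp (t.comp t))).eqLocus σ := by rw [key]; trivial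
  exact this

/-- A half-turn acts with order three on the homomorphisms to the symmetric group. -/
theorem exists_pushHom_cube (j : OrientedDisc) (f : DiffPlus D)
    (hj : ∀ z, j.toFun z ∈ D ↔ z = 1 ∨ z = -1) (hf : IsHalfTwist j (f : Equiv.Perm S2)) :
    ∃ p : Path.Homotopic.Quotient o (restr f o), ∀ ρ : EpiPrime D o, ∀ g,
      ρ.1 (pushHom f p (pushHom f p (pushHom f p g))) = ρ.1 g := by
  have hpos : ∀ z : ℂ, 0 < cross (fderiv ℝ (fun z : ℂ => 2 * z - 1) z 1)
      (fderiv ℝ (fun z : ℂ => 2 * z - 1) z Complex.I) := fun z => by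
    have h1 : HasFDerivAt (fun z : ℂ => 2 * z - 1) ((2 : ℂ) • ContinuousLinearMap.id ℝ ℂ) z :=
      ((hasFDerivAt_id z).const_mul (2 : ℂ)).sub_const 1
    rw [h1.fderiv]
    simp [cross]
  -- The substitution z ↦ 2 z - 1 takes 0 and 1 to the ends -1 and 1 of the arc, so that `f` becomes
  -- the standard half-turn of the plane with two punctures.
  let J : OrientedDisc := j.comp (S := fun z => 2 * z - 1)
    ((contDiff_const.mul contDiff_id).sub contDiff_const) (fun z w h => by simpa using h) hpos
  have hJ : ∀ z, J.toFun z ∈ D ↔ ∃ k : ℕ, k < 2 ∧ z = k := fun z => by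
    refine (hj (2 * z - 1)).trans ⟨?_, ?_⟩
    · rintro (h | h)
      · exact ⟨1, by norm_num, by push_cast; linear_combination h / 2⟩
      · exact ⟨0, by norm_num, by push_cast; linear_combination h / 2⟩
    · rintro ⟨k, hk, rfl⟩
      interval_cases k
      · right; norm_num
      · left; norm_num
  let e := puncturedMap J hJ
  let x₀ := e (Plane.base 2)
  have hfJ : ∀ z, (f : Equiv.Perm S2) (J.toFun z) = J.toFun (Plane.halfTurn 0 z) := fun z => by
    refine (hf.1 (2 * z - 1)).trans (congrArg j.toFun ?_)
    have h1 : 2 * (z - ((0 : ℕ) + 1 / 2)) = 2 * z - 1 := by push_cast; ring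
    rw [Plane.halfTurn, h1]
    push_cast
    ring
  let T : C(Plane 2, Plane 2) := ⟨fun z => ⟨Plane.halfTurn 0 z, fun i hi h => by
    have h1 : J.toFun (Plane.halfTurn 0 z) ∈ D := (hJ _).2 ⟨i, hi, h⟩
    rw [← hfJ] at h1
    obtain ⟨i', hi', h'⟩ := (hJ _).1 ((f.2.2.2.2 _).1 h1)
    exact z.2 i' hi' h'⟩, by
    refine Continuous.subtype_mk ?_ _
    rw [← halfTurn'_one]
    exact (contDiff_halfTurn' 1 0).continuous.comp continuous_subtype_val⟩
  have hT : ∀ z : Plane 2, (T z : ℂ) = Plane.halfTurn 0 z := fun z => rfl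
  have hfe : ∀ z, restr f (e z) = e (T z) := fun z => Subtype.ext (hfJ z)
  have hx₀ : restr f x₀ = x₀ := by
    change restr f (e (Plane.base 2)) = e (Plane.base 2)
    rw [hfe, Plane.apply_base hT]
  obtain ⟨s⟩ : Nonempty (Path.Homotopic.Quotient o x₀) :=
    ⟨Path.Homotopic.Quotient.mk (PathConnectedSpace.somePath _ _)⟩
  let τ := transport (Homeomorph.refl (Punctured D)) s
  refine ⟨s.trans (mapTo (restr f) rfl hx₀ s).symm, fun ρ g => ?_⟩
  let φ := mapHom (restr f) hx₀
  let σ : FundamentalGroup (Punctured D) x₀ →* Equiv.Perm (Fin 3) := ρ.1.comp τ.toMonoidHom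
  have hφ : ∀ g, pushHom f (s.trans (mapTo (restr f) rfl hx₀ s).symm) (τ g) = τ (φ g) :=
    fun g => pushHom_transport f hx₀ s g
  suffices h : (σ.comp (φ.comp (φ.comp φ))).eqLocus σ = ⊤ by
    obtain ⟨g, rfl⟩ := τ.surjective g
    refine (congrArg ρ.1 ((congrArg _ ((congrArg _ (hφ g)).trans (hφ _))).trans (hφ _))).trans ?_
    have : g ∈ (σ.comp (φ.comp (φ.comp φ))).eqLocus σ := by rw [h]; trivial
    exact this
  have houtside : ∀ z, 2 < ‖z‖ → j.toFun z ∉ D := fun z hz h => by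
    rcases (hj z).1 h with rfl | rfl <;> norm_num at hz
  have hU : {x : Punctured D | (x : S2) ∈ Set.range j.toFun} = Set.range e := by
    ext x
    constructor
    · rintro ⟨z, hz⟩
      refine ⟨⟨(z + 1) / 2, fun k hk h => x.2 ?_⟩, Subtype.ext ?_⟩
      · have h1 := (hJ ((z + 1) / 2)).2 ⟨k, hk, h⟩
        have h2 : J.toFun ((z + 1) / 2) = x := by
          rw [← hz]
          exact congrArg j.toFun (by ring)
        rwa [h2] at h1
      · exact (congrArg j.toFun (by ring)).trans hz
    · rintro ⟨z, rfl⟩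
      exact ⟨_, rfl⟩
  have hUopen : IsOpen {x : Punctured D | (x : S2) ∈ Set.range j.toFun} :=
    j.isOpenMap.isOpen_range.preimage continuous_subtype_val
  -- The cover consists of the whole disc and of the complement of the closed disc of radius 2,
  -- where `f` is the identity. The base point has the coordinate -2 - 4i in `j`, so it lies in
  -- both.
  refine eq_top_of_union hUopen (j.isOpen_outside 2) ?_ ⟨?_, ?_⟩ ?_
    (j.isPathConnected_outside two_pos houtside) (j.isPathConnected_annulus two_pos houtside) _ ?_ ?_
  · rw [Set.eq_univ_iff_forall]
    intro x
    by_cases hx : (x : S2) ∈ j.toFun '' Metric.closedBall 0 2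
    · obtain ⟨z, _, hz⟩ := hx
      exact Or.inl ⟨z, hz⟩
    · exact Or.inr hx
  · exact ⟨_, rfl⟩
  · rintro ⟨w, hw, h⟩
    have h1 := j.injective h
    rw [h1, mem_closedBall_zero_iff] at hw
    have h2 := (Complex.abs_im_le_norm (2 * (Plane.base 2 : ℂ) - 1)).trans hw
    simp [Plane.base, Plane.pt, Plane.sgn] at h2
  · rw [hU]
    exact isPathConnected_range e.continuous
  · intro γ hγ
    have hemb : Topology.IsEmbedding e := Topology.IsEmbedding.of_comp e.continuous
      continuous_subtype_val (J.isOpenEmbedding.isEmbedding.comp Topology.IsEmbedding.subtypeVal)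
    have hlift : ∀ t, ∃ z, e z = γ t := fun t => by
      have := hγ t
      rw [hU] at this
      exact this
    choose δ hδ using hlift
    let δ' : Path (Plane.base 2) (Plane.base 2) :=
      { toFun := δ
        continuous_toFun := by
          rw [hemb.isInducing.continuous_iff]
          exact γ.continuous.congr fun t => (hδ t).symm
        source' := hemb.injective ((hδ 0).trans γ.source)
        target' := hemb.injective ((hδ 1).trans γ.target) }
    let ε := mapHom (x := Plane.base 2) (y := x₀) e rfl
    have hγε : (show FundamentalGroup (Punctured D) x₀ from Path.Homotopic.Quotient.mk γ) =
        ε (show FundamentalGroup _ _ from Path.Homotopic.Quotient.mk δ') :=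
      (mapTo_mk e rfl rfl δ' γ fun t => (hδ t).symm).symm
    let t := mapHom T (Plane.apply_base hT)
    have hφε : ∀ g, φ (ε g) = ε (t g) := fun g => by
      have e3 := mapTo_comp e (restr f) ((restr f).comp e) (fun _ => rfl) rfl rfl hx₀ hx₀ hx₀ hx₀ g
      have e4 := mapTo_comp T e ((restr f).comp e) hfe (Plane.apply_base hT) (Plane.apply_base hT)
        rfl rfl hx₀ hx₀ g
      exact e3.trans e4.symm
    let σ' := σ.comp ε
    have hswap : ∀ k < 2, (σ' ((Plane.loop 2 k)⁻¹ * Plane.loop 2 (k + 1))).IsSwap := fun k hk =>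
      ρ.2.2 _ (isSimpleLoop_transport J hJ s hk)
    let d : FundamentalGroup (Plane 2) (Plane.base 2) := Path.Homotopic.Quotient.mk δ'
    have h3 : σ (φ (φ (φ (ε d)))) = σ (ε d) := by
      rw [hφε, hφε, hφε]
      exact halfTurn_cube hT σ' hswap d
    rw [hγε]
    exact h3
  · intro γ hγ
    let d : FundamentalGroup (Punctured D) x₀ := Path.Homotopic.Quotient.mk γ
    have h1 : φ d = d := by
      refine mapTo_mk (restr f) hx₀ hx₀ γ γ fun t => Subtype.ext ?_
      change (γ t : S2) = (f : Equiv.Perm S2) (γ t)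
      by_cases h2 : (γ t : S2) ∈ Set.range j.toFun
      · obtain ⟨z, hz⟩ := h2
        have h3 : 2 < ‖z‖ := by
          by_contra h4
          exact hγ t ⟨z, by simpa using h4, hz⟩
        rw [← hz, hf.1, Real.smoothTransition.zero_of_nonpos (by linarith)]
        simp
      · exact (hf.2 _ h2).symm
    refine (?_ : σ (φ (φ (φ d))) = σ d)
    rw [h1, h1, h1]

theorem IsSimpleBraid.pow_three_smul {T : ModGroup D} (hT : IsSimpleBraid T) (r : RSet D o) :
    T ^ 3 • r = r := by
  obtain ⟨j, f, hj, hf, rfl⟩ := hT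
  obtain ⟨p, hp⟩ := exists_pushHom_cube (o := o) j f hj hf
  rw [pow_succ, pow_two, mul_smul, mul_smul, modAction_mk f p, modAction_mk f p, modAction_mk f p]
  induction r using Quotient.ind with | _ ρ =>
  refine Quotient.sound ⟨1, fun g => ?_⟩
  let a := pushAut f p
  have h1 : ∀ g, a.1 (((a⁻¹ : simpleAut D o) : MulAut (PiOne D o)) g) = g := fun g =>
    MulAut.apply_inv_self _ a.1 g
  have h2 := hp ρ ((a⁻¹ : simpleAut D o).1 ((a⁻¹ : simpleAut D o).1 ((a⁻¹ : simpleAut D o).1 g)))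
  rw [one_mul, inv_one, mul_one]
  refine Eq.trans ?_ h2
  refine congrArg ρ.1 ?_
  change g = a.1 (a.1 (a.1 _))
  rw [h1, h1, h1]

end

/-! ### Transpositions of three letters -/

section transpositions

/-- The transpositions of three letters are the reflections `x ↦ u - x`. -/
def refl3 (u : Fin 3) : Equiv.Perm (Fin 3) := Equiv.subLeft u

theorem refl3_injective : Function.Injective refl3 := fun u v h => by
  have : refl3 u 0 = refl3 v 0 := by rw [h]
  simpa [refl3] using this

theorem isSwap_iff_sign {g : Equiv.Perm (Fin 3)} : g.IsSwap ↔ Equiv.Perm.sign g = -1 := by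
  unfold Equiv.Perm.IsSwap
  revert g
  decide

theorem isSwap_iff_exists {g : Equiv.Perm (Fin 3)} : g.IsSwap ↔ ∃ u, g = refl3 u := by
  unfold Equiv.Perm.IsSwap
  revert g
  decide

theorem isSwap_refl3 (u : Fin 3) : (refl3 u).IsSwap := isSwap_iff_exists.2 ⟨u, rfl⟩

theorem refl3_conj (a b : Fin 3) : (refl3 b)⁻¹ * refl3 a * refl3 b = refl3 (-a - b) := by
  revert a b
  decide

theorem subgroup_eq_top {H : Subgroup (Equiv.Perm (Fin 3))} {u v : Fin 3} (huv : u ≠ v)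
    (hu : refl3 u ∈ H) (hv : refl3 v ∈ H) : H = ⊤ := by
  have key : ∀ u v : Fin 3, u ≠ v → ∀ g : Equiv.Perm (Fin 3), g = 1 ∨ g = refl3 u ∨ g = refl3 v ∨
      g = refl3 u * refl3 v ∨ g = refl3 v * refl3 u ∨ g = refl3 u * refl3 v * refl3 u := by decide
  rw [eq_top_iff]
  intro g _
  rcases key u v huv g with rfl | rfl | rfl | rfl | rfl | rfl
  · exact H.one_mem
  · exact hu
  · exact hv
  · exact H.mul_mem hu hv
  · exact H.mul_mem hv hu
  · exact H.mul_mem (H.mul_mem hu hv) hu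

theorem exists_not_commute (u : Fin 3) : ∃ g : Equiv.Perm (Fin 3), g * refl3 u ≠ refl3 u * g := by
  revert u
  decide

theorem eq_one_of_commute {g : Equiv.Perm (Fin 3)} (h : ∀ s, g * s = s * g) : g = 1 := by
  revert g
  decide

theorem exists_conj_refl3 {v c : Fin 3} (h : v ≠ c) :
    ∃ s : Equiv.Perm (Fin 3), s * refl3 v * s⁻¹ = refl3 1 ∧ s * refl3 c * s⁻¹ = refl3 0 := by
  revert v c
  decide

/-- The equivalence of lists of transpositions under Hurwitz moves. -/
inductive Hurwitz : List (Fin 3) → List (Fin 3) → Prop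
  | swap (a b : Fin 3) (l : List (Fin 3)) : Hurwitz (a :: b :: l) (b :: (-a - b) :: l)
  | cons (x : Fin 3) {l l' : List (Fin 3)} : Hurwitz l l' → Hurwitz (x :: l) (x :: l')
  | refl (l : List (Fin 3)) : Hurwitz l l
  | trans {l l' l'' : List (Fin 3)} : Hurwitz l l' → Hurwitz l' l'' → Hurwitz l l''

namespace Hurwitz

/-- The move has order three: (a, b), (b, -a - b), (-a - b, a), (a, b). Its square is therefore its
inverse. -/
theorem symm {l l' : List (Fin 3)} (h : Hurwitz l l') : Hurwitz l' l := by
  induction h with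
  | swap a b l =>
    have h1 := (swap b (-a - b) l).trans (swap (-a - b) (-b - (-a - b)) l)
    have e1 : -b - (-a - b) = a := by abel
    have e2 : -(-a - b) - (-b - (-a - b)) = b := by abel
    rwa [e1, show -(-a - b) - a = b by abel] at h1
  | cons x _ ih => exact ih.cons x
  | refl l => exact refl l
  | trans _ _ ih1 ih2 => exact ih2.trans ih1

theorem length_eq {l l' : List (Fin 3)} (h : Hurwitz l l') : l.length = l'.length := by
  induction h with
  | swap a b l => rfl
  | cons x _ ih => simp [ih]
  | refl l => rfl
  | trans _ _ ih1 ih2 => exact ih1.trans ih2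

/-- A pair of equal letters commutes with all letters. -/
theorem pair_comm (x a : Fin 3) (l : List (Fin 3)) :
    Hurwitz (x :: a :: a :: l) (a :: a :: x :: l) := by
  have h1 := (swap x a (a :: l)).trans ((swap (-x - a) a l).cons a)
  rwa [show -(-x - a) - a = x by abel] at h1

/-- A pair of equal letters can be reflected in a different letter. -/
theorem pair_toggle (x a : Fin 3) (l : List (Fin 3)) :
    Hurwitz (x :: a :: a :: l) (x :: (-a - x) :: (-a - x) :: l) := by
  have h1 := (pair_comm x a l).trans (((swap a x l).cons a).trans (swap a x ((-a - x) :: l)))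
  exact h1

theorem pair_pair_comm (a b : Fin 3) (l : List (Fin 3)) :
    Hurwitz (a :: a :: b :: b :: l) (b :: b :: a :: a :: l) :=
  ((pair_comm a b l).cons a).trans (pair_comm a b (a :: l))

/-- The list in which every letter is repeated. -/
def double : List (Fin 3) → List (Fin 3)
  | [] => []
  | a :: l => a :: a :: double l

/-- Among three letters x, y, v either two are equal or -x - y = v. In each case moves yield a
single letter and a pair, and a pair can be moved past any letter. -/
theorem exists_double (m : ℕ) : ∀ l : List (Fin 3), l.length = 2 * m + 1 →
    ∃ v P, P.length = m ∧ Hurwitz l (v :: double P) := by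
  induction m with
  | zero =>
    intro l hl
    obtain ⟨v, rfl⟩ := List.length_eq_one_iff.1 hl
    exact ⟨v, [], rfl, refl _⟩
  | succ m ih =>
    intro l hl
    match l, hl with
    | x :: y :: l, hl =>
      obtain ⟨v, P, hP, h⟩ := ih l (by simp at hl; omega)
      have h1 := (h.cons y).cons x
      have key : ∀ x y v : Fin 3, x = y ∨ y = v ∨ (x ≠ y ∧ x = v) ∨ -x - y = v := by decide
      rcases key x y v with rfl | rfl | ⟨hxy, rfl⟩ | rfl
      · exact ⟨v, x :: P, by simp [hP], h1.trans (pair_comm v x _).symm⟩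
      · exact ⟨x, y :: P, by simp [hP], h1⟩
      · refine ⟨-x - y, x :: P, by simp [hP], h1.trans ?_⟩
        have h2 := (swap x y (x :: double P)).trans (swap y (-x - y) (x :: double P))
        rwa [show -y - (-x - y) = x by abel] at h2
      · exact ⟨y, (-x - y) :: P, by simp [hP], h1.trans (swap x y _)⟩

/-- A pair that is not at the distinguished letter can be used to change all pairs. -/
theorem double_normalize (v : Fin 3) (P : List (Fin 3)) :
    Hurwitz (v :: (v - 1) :: (v - 1) :: double P)
      (v :: (v - 1) :: (v - 1) :: double (List.replicate P.length (v + 1))) := by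
  induction P with
  | nil => exact refl _
  | cons q P ih =>
    have hstep : Hurwitz (v :: (v - 1) :: (v - 1) :: q :: q :: double P)
        (v :: (v - 1) :: (v - 1) :: (v + 1) :: (v + 1) :: double P) := by
      -- A pair v - 1 is reflected in v and a pair v is reflected in v - 1; both become v + 1, and a
      -- pair v - 1 is still available afterwards.
      have key : ∀ v q : Fin 3, q = v + 1 ∨ q = v - 1 ∨ q = v := by decide
      rcases key v q with rfl | rfl | rfl
      · exact refl _
      · have h1 := pair_toggle v (v - 1) ((v - 1) :: (v - 1) :: double P)
        have e : ∀ v : Fin 3, -(v - 1) - v = v + 1 := by decide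
        rw [e] at h1
        exact h1.trans ((pair_pair_comm (v + 1) (v - 1) _).cons v)
      · have h1 := ((pair_toggle (q - 1) q (double P)).cons (q - 1)).cons q
        have e : ∀ v : Fin 3, -v - (v - 1) = v + 1 := by decide
        rwa [e] at h1
    have hmove : ∀ l, Hurwitz (v :: (v - 1) :: (v - 1) :: (v + 1) :: (v + 1) :: l)
        ((v + 1) :: (v + 1) :: v :: (v - 1) :: (v - 1) :: l) := fun l =>
      ((pair_pair_comm (v - 1) (v + 1) l).cons v).trans (pair_comm v (v + 1) _)
    exact hstep.trans ((hmove _).trans (((ih.cons _).cons _).trans (hmove _).symm))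

theorem double_replicate (m : ℕ) (c : Fin 3) :
    double (List.replicate m c) = List.replicate (2 * m) c := by
  induction m with
  | zero => rfl
  | succ m ih =>
    rw [List.replicate_succ, double, ih, show 2 * (m + 1) = 2 * m + 1 + 1 by ring,
      List.replicate_succ, List.replicate_succ]

theorem double_perm {P Q : List (Fin 3)} (h : P.Perm Q) : Hurwitz (double P) (double Q) := by
  induction h with
  | nil => exact refl _
  | cons x _ ih => exact (ih.cons x).cons x
  | swap x y l => exact pair_pair_comm y x _
  | trans _ _ ih1 ih2 => exact ih1.trans ih2

/-- The constant lists are the lists that are Hurwitz equivalent to a constant list. -/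
theorem constant {l l' : List (Fin 3)} (h : Hurwitz l l') (c : Fin 3) :
    (∀ x ∈ l, x = c) ↔ ∀ x ∈ l', x = c := by
  induction h with
  | swap a b l =>
    have key : ∀ a b c : Fin 3, a = c → b = c → -a - b = c := by decide
    have key' : ∀ a b c : Fin 3, b = c → -a - b = c → a = c := by decide
    simp only [List.mem_cons, forall_eq_or_imp]
    constructor
    · rintro ⟨h1, h2, h3⟩
      exact ⟨h2, key _ _ _ h1 h2, h3⟩
    · rintro ⟨h1, h2, h3⟩
      exact ⟨key' _ _ _ h1 h2, h1, h3⟩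
  | cons x _ ih => simp only [List.mem_cons, forall_eq_or_imp, ih]
  | refl l => rfl
  | trans _ _ ih1 ih2 => exact ih1.trans ih2

theorem mem_double {P : List (Fin 3)} {x : Fin 3} : x ∈ double P ↔ x ∈ P := by
  induction P with
  | nil => rfl
  | cons a P ih => simp [double, ih]

/-- The normal form of a non-constant list of odd length. -/
theorem exists_normal {m : ℕ} {l : List (Fin 3)} (hl : l.length = 2 * m + 1)
    (hne : ∀ c, ¬ ∀ x ∈ l, x = c) :
    ∃ v, Hurwitz l (v :: List.replicate (2 * m) (v + 1)) := by
  obtain ⟨v, P, hP, h⟩ := exists_double m l hl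
  refine ⟨v, h.trans ?_⟩
  -- Being constant is invariant under the moves, so some pair differs from the single letter `v`.
  -- It becomes the auxiliary pair v - 1, which is itself turned into v + 1 at the very end.
  have h1 : ∃ p ∈ P, p ≠ v := by
    by_contra hcon
    push Not at hcon
    refine hne v ((h.constant v).2 fun x hx => ?_)
    rcases List.mem_cons.1 hx with rfl | hx
    · rfl
    · exact hcon x (mem_double.1 hx)
  obtain ⟨p, hp, hpv⟩ := h1
  have h2 := (double_perm (List.perm_cons_erase hp)).cons v
  have e : ∀ v : Fin 3, -(v + 1) - v = v - 1 ∧ -(v - 1) - v = v + 1 := by decide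
  have h3 : ∀ l, Hurwitz (v :: p :: p :: l) (v :: (v - 1) :: (v - 1) :: l) := fun l => by
    have key : ∀ p v : Fin 3, p ≠ v → p = v + 1 ∨ p = v - 1 := by decide
    rcases key p v hpv with rfl | rfl
    · have := pair_toggle v (v + 1) l
      rwa [(e v).1] at this
    · exact refl _
  have h4 := double_normalize v (P.erase p)
  have h5 := pair_toggle v (v - 1) (double (List.replicate (P.erase p).length (v + 1)))
  rw [(e v).2] at h5
  have h6 : (v + 1) :: (v + 1) :: double (List.replicate (P.erase p).length (v + 1)) =
      List.replicate (2 * m) (v + 1) := by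
    rw [← double_replicate]
    have : m = (P.erase p).length + 1 := by
      have := (List.perm_cons_erase hp).length_eq
      simp at this
      omega
    rw [this, List.replicate_succ, double]
  rw [h6] at h5
  exact h2.trans ((h3 _).trans (h4.trans h5))

end Hurwitz

end transpositions

/-! ### The set `R(S,D)` -/

namespace HurwitzGenerators

variable {D : Finset S2} {o : Punctured D} {n : ℕ} (g : HurwitzGenerators D o n)

/-- The free generators. -/
noncomputable def c (k : ℕ) : PiOne D o := (g.W k)⁻¹ * g.W (k + 1)

theorem W_succ (k : ℕ) : g.W (k + 1) = g.W k * g.c k := by rw [c, mul_inv_cancel_left]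

theorem closure_c {H : Subgroup (PiOne D o)} (h : ∀ k < n, g.c k ∈ H) : H = ⊤ := by
  refine g.eq_top H fun k hk => ?_
  induction k with
  | zero => rw [g.zero]; exact H.one_mem
  | succ k ih => rw [W_succ]; exact H.mul_mem (ih (by omega)) (h k (by omega))

theorem hom_ext {G : Type} [Group G] {φ ψ : PiOne D o →* G} (h : ∀ k < n, φ (g.c k) = ψ (g.c k)) :
    φ = ψ := by
  have h1 : φ.eqLocus ψ = ⊤ := g.closure_c h
  ext x
  have h2 : x ∈ φ.eqLocus ψ := by rw [h1]; trivial
  exact h2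

theorem exists_hom_c {G : Type} [Group G] (u : ℕ → G) :
    ∃ Φ : PiOne D o →* G, ∀ k < n, Φ (g.c k) = u k := by
  -- Since `W k` is the product of the first k free generators, partial products are prescribed for
  -- it.
  obtain ⟨Φ, hΦ⟩ := g.exists_hom (fun k => ((List.range k).map u).prod) rfl
  refine ⟨Φ, fun k hk => ?_⟩
  rw [c, map_mul, map_inv, hΦ k hk.le, hΦ (k + 1) hk, List.range_succ, List.map_append,
    List.prod_append]
  simp

/-- Simple loops go to transpositions if the free generators do, for odd `n`. -/
theorem isSwap_of_forall (hn : Odd n) {ρ : PiOne D o →* Equiv.Perm (Fin 3)}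
    (h : ∀ k < n, (ρ (g.c k)).IsSwap) {x : PiOne D o} (hx : IsSimpleLoop x) : (ρ x).IsSwap := by
  simp only [isSwap_iff_sign] at h ⊢
  let s : PiOne D o →* ℤˣ := Equiv.Perm.sign.comp ρ
  have hW : ∀ k ≤ n, s (g.W k) = (-1) ^ k := by
    intro k hk
    induction k with
    | zero => rw [g.zero, map_one, pow_zero]
    | succ k ih => rw [W_succ, map_mul, ih (by omega), pow_succ]; exact congrArg _ (h k (by omega))
  have hc : ∀ {x y}, IsConj x y → s x = s y := fun {x y} hxy => by
    obtain ⟨b, rfl⟩ := isConj_iff.1 hxy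
    rw [map_mul, map_mul, map_inv, mul_comm, inv_mul_cancel_left]
  change s x = -1
  rcases g.isConj x hx with ⟨k, hk, h1⟩ | h1
  · rw [hc h1]
    exact h k hk
  · rw [hc h1, map_inv, hW n le_rfl, hn.neg_one_pow]
    rfl

/-- The homomorphism `ρ` takes the free generators to the transpositions in the list `u`. -/
def HasValues (ρ : EpiPrime D o) (u : ℕ → Fin 3) : Prop := ∀ k < n, ρ.1 (g.c k) = refl3 (u k)

theorem exists_values (ρ : EpiPrime D o) : ∃ u : ℕ → Fin 3, g.HasValues ρ u := by
  have h : ∀ k, ∃ u, k < n → ρ.1 (g.c k) = refl3 u := fun k => by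
    by_cases hk : k < n
    · obtain ⟨u, hu⟩ := isSwap_iff_exists.1 (ρ.2.2 _ (g.isSimpleLoop k hk))
      exact ⟨u, fun _ => hu⟩
    · exact ⟨0, fun h => absurd h hk⟩
  choose u hu using h
  exact ⟨u, hu⟩

/-- For a constant sequence the image would lie in the centralizer of one transposition, which is a
proper subgroup. -/
theorem not_constant {ρ : EpiPrime D o} {u : ℕ → Fin 3} (h : g.HasValues ρ u) (a : Fin 3) :
    ¬ ∀ k < n, u k = a := by
  intro hc
  have h1 : (Subgroup.centralizer {refl3 a}).comap ρ.1 = ⊤ := by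
    refine g.closure_c fun k hk => ?_
    rw [Subgroup.mem_comap, h k hk, hc k hk, Subgroup.mem_centralizer_singleton_iff]
  obtain ⟨s, hs⟩ := exists_not_commute a
  obtain ⟨x, rfl⟩ := ρ.2.1 s
  have h2 : x ∈ (Subgroup.centralizer {refl3 a}).comap ρ.1 := by rw [h1]; trivial
  rw [Subgroup.mem_comap, Subgroup.mem_centralizer_singleton_iff] at h2
  exact hs h2

/-- Surjectivity holds because two different transpositions generate 𝔖₃; the parity of `n` takes
care of the loops around the point at infinity. -/
theorem exists_epi (hn : Odd n) {u : ℕ → Fin 3} (hu : ∀ a, ¬ ∀ k < n, u k = a) :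
    ∃ ρ : EpiPrime D o, g.HasValues ρ u := by
  obtain ⟨Φ, hΦ⟩ := g.exists_hom_c fun k => refl3 (u k)
  refine ⟨⟨Φ, ?_, fun x hx => g.isSwap_of_forall hn (fun k hk => ?_) hx⟩, hΦ⟩
  · have h1 := hu (u 0)
    push Not at h1
    obtain ⟨k, hk, hne⟩ := h1
    rw [← MonoidHom.range_eq_top]
    exact subgroup_eq_top hne ⟨_, hΦ k hk⟩ ⟨_, hΦ 0 (by omega)⟩
  · rw [hΦ k hk]
    exact isSwap_refl3 _

theorem epi_ext {ρ σ : EpiPrime D o} (h : ∀ k < n, ρ.1 (g.c k) = σ.1 (g.c k)) : ρ = σ :=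
  Subtype.ext (g.hom_ext h)

/-- The conjugate of a homomorphism. -/
noncomputable def _root_.EpiPrime.conj (s : Equiv.Perm (Fin 3)) (ρ : EpiPrime D o) : EpiPrime D o :=
  ⟨(MulAut.conj s).toMonoidHom.comp ρ.1, (MulAut.conj s).surjective.comp ρ.2.1, fun c hc => by
    have h := ρ.2.2 c hc
    rw [isSwap_iff_sign] at h ⊢
    simp [MulAut.conj_apply, h]⟩

theorem _root_.EpiPrime.conj_apply (s : Equiv.Perm (Fin 3)) (ρ : EpiPrime D o) (x : PiOne D o) :
    (ρ.conj s).1 x = s * ρ.1 x * s⁻¹ := rfl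

theorem _root_.EpiPrime.mk_conj (s : Equiv.Perm (Fin 3)) (ρ : EpiPrime D o) :
    (Quotient.mk (epiPrimeSetoid D o) (ρ.conj s)) = Quotient.mk _ ρ :=
  (Quotient.sound ⟨s, fun _ => rfl⟩ : Quotient.mk (epiPrimeSetoid D o) ρ = _).symm

/-- Conjugation acts freely. -/
theorem _root_.RSet.prod_bijective : Function.Bijective fun q : RSet D o × Equiv.Perm (Fin 3) =>
    (Quotient.out q.1 : EpiPrime D o).conj q.2 := by
  constructor
  · rintro ⟨r, s⟩ ⟨r', s'⟩ h
    simp only at h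
    have hr : r = r' := by
      have h1 := congrArg (Quotient.mk (epiPrimeSetoid D o)) h
      rw [EpiPrime.mk_conj, EpiPrime.mk_conj] at h1
      exact (Quotient.out_eq r).symm.trans (h1.trans (Quotient.out_eq r'))
    subst hr
    refine Prod.ext rfl ?_
    -- By surjectivity this element commutes with all of 𝔖₃, whose centre is trivial.
    have h1 : s'⁻¹ * s = 1 := by
      refine eq_one_of_commute fun t => ?_
      obtain ⟨x, rfl⟩ := (Quotient.out r : EpiPrime D o).2.1 t
      have h2 := congrArg (fun ρ : EpiPrime D o => ρ.1 x) h
      simp only [EpiPrime.conj_apply] at h2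
      have h3 := congrArg (fun t => s'⁻¹ * t * s) h2
      simp only [mul_assoc, inv_mul_cancel, mul_one, inv_mul_cancel_left] at h3
      rw [mul_assoc, h3]
    exact (inv_mul_eq_one.1 h1).symm
  · intro ρ
    have h : Quotient.mk (epiPrimeSetoid D o) (Quotient.out (Quotient.mk (epiPrimeSetoid D o) ρ)) =
      Quotient.mk _ ρ := Quotient.out_eq _
    obtain ⟨s, hs⟩ := Quotient.exact h
    exact ⟨(Quotient.mk _ ρ, s), Subtype.ext (MonoidHom.ext fun x => (hs x).symm)⟩

/-- By freeness the values on the generators can be chosen at will, except that the three constant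
sequences are excluded. -/
theorem card_epiPrime (g : HurwitzGenerators D o n) (hn : Odd n) : Nat.card (EpiPrime D o) = 3 ^ n - 3 := by
  have hn0 : 0 < n := hn.pos
  let e : EpiPrime D o → {u : Fin n → Fin 3 // u ∉ Set.range (Function.const (Fin n))} := fun ρ =>
    ⟨fun k => (g.exists_values ρ).choose k, by
      rintro ⟨a, ha⟩
      exact g.not_constant (g.exists_values ρ).choose_spec a fun k hk =>
        (congrFun ha ⟨k, hk⟩).symm⟩
  have he : Function.Bijective e := by
    constructor
    · intro ρ σ h
      refine g.epi_ext fun k hk => ?_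
      rw [(g.exists_values ρ).choose_spec k hk, (g.exists_values σ).choose_spec k hk]
      exact congrArg refl3 (congrFun (congrArg Subtype.val h) ⟨k, hk⟩)
    · rintro ⟨u, hu⟩
      obtain ⟨ρ, hρ⟩ := g.exists_epi hn (u := fun k => if h : k < n then u ⟨k, h⟩ else 0) (by
        intro a h
        refine hu ⟨a, funext fun k => ?_⟩
        have := h k k.2
        rw [dif_pos k.2] at this
        exact this.symm)
      refine ⟨ρ, Subtype.ext (funext fun k => refl3_injective ?_)⟩
      have h1 := (hρ k k.2).trans (congrArg refl3 (dif_pos k.2))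
      exact ((g.exists_values ρ).choose_spec k k.2).symm.trans h1
  rw [Nat.card_congr (Equiv.ofBijective e he)]
  have : Nonempty (Fin n) := ⟨⟨0, hn0⟩⟩
  classical
  rw [Nat.card_eq_fintype_card]
  have h1 := Fintype.card_subtype_compl (fun u : Fin n → Fin 3 => u ∈ Set.range (Function.const (Fin n)))
  refine h1.trans ?_
  congr 1
  · simp
  · rw [← Nat.card_eq_fintype_card]
    have := Nat.card_range_of_injective (f := Function.const (Fin n) (α := Fin 3))
      (Function.const_injective)
    exact this.trans (by simp)

theorem card_RSet (g : HurwitzGenerators D o n) (hn : Odd n) : Nat.card (RSet D o) * 6 = 3 ^ n - 3 := by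
  rw [← g.card_epiPrime hn, ← Nat.card_congr (Equiv.ofBijective _ (RSet.prod_bijective (D := D) (o := o))),
    Nat.card_prod]
  congr 1
  rw [Nat.card_eq_fintype_card, Fintype.card_perm]
  rfl

end HurwitzGenerators

/-! ### Transitivity -/

namespace HurwitzGenerators

variable {D : Finset S2} {o : Punctured D} {n : ℕ} (g : HurwitzGenerators D o n)

/-- The half-turns act by the Hurwitz moves. -/
theorem exists_push_c {k : ℕ} (hk : k + 1 < n) :
    ∃ (f : DiffPlus D) (p : Path.Homotopic.Quotient o (restr f o)),
      (∀ i, i ≠ k → i ≠ k + 1 → pushHom f p (g.c i) = g.c i) ∧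
      pushHom f p (g.c k) = g.c (k + 1) ∧
      pushHom f p (g.c (k + 1)) = (g.c (k + 1))⁻¹ * g.c k * g.c (k + 1) := by
  obtain ⟨f, p, h1, h2⟩ := g.exists_push k hk
  refine ⟨f, p, fun i hi hi' => ?_, ?_, ?_⟩
  · rw [c, map_mul, map_inv, h1 i hi', h1 (i + 1) (by omega)]
  · rw [c, c, map_mul, map_inv, h1 k (by omega), h2]
    group
  · rw [c, c, map_mul, map_inv, h1 (k + 1 + 1) (by omega), h2]
    group

/-- The class `r` is represented by a homomorphism with the values `l`. -/
def Represents (l : List (Fin 3)) (r : RSet D o) : Prop :=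
  ∃ ρ : EpiPrime D o, r = Quotient.mk _ ρ ∧ g.HasValues ρ fun k => l.getD k 0

/-- An automorphism a acts by ρ ↦ ρ ∘ a⁻¹, so the inverse of the class of the half-turn is used: it
gives ρ ∘ f_*, whose values at the two positions after `pre` are b and b⁻¹ a b. -/
theorem Represents.swap {pre l : List (Fin 3)} {a b : Fin 3} {r : RSet D o}
    (hl : (pre ++ a :: b :: l).length = n) (h : g.Represents (pre ++ a :: b :: l) r) :
    ∃ m : ModGroup D, g.Represents (pre ++ b :: (-a - b) :: l) (m • r) := by
  obtain ⟨ρ, rfl, hρ⟩ := h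
  have hn : pre.length + 1 < n := by
    rw [← hl]
    simp
  obtain ⟨f, p, h1, h2, h3⟩ := g.exists_push_c hn
  refine ⟨(QuotientGroup.mk f)⁻¹, ρ.twist (pushAut f p)⁻¹, ?_, ?_⟩
  · refine inv_smul_eq_iff.2 (Eq.trans ?_ (modAction_mk f p _).symm)
    change _ = Quotient.mk _ (EpiPrime.twist (pushAut f p) (ρ.twist (pushAut f p)⁻¹))
    refine congrArg (Quotient.mk _) (Subtype.ext (MonoidHom.ext fun x => congrArg ρ.1 ?_))
    change x = (((pushAut f p)⁻¹)⁻¹ : simpleAut D o).1 (((pushAut f p)⁻¹ : simpleAut D o).1 x)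
    rw [inv_inv]
    exact (MulAut.apply_inv_self _ (pushAut f p).1 x).symm
  · have hval : ∀ x, (ρ.twist (pushAut f p)⁻¹).1 x = ρ.1 (pushHom f p x) := fun x => by
      change ρ.1 ((((pushAut f p)⁻¹)⁻¹ : simpleAut D o).1 x) = _
      rw [inv_inv]
      rfl
    intro k hk
    rw [hval]
    have ha := hρ pre.length (by omega)
    have hb := hρ (pre.length + 1) hn
    simp only [List.getD_eq_getElem?_getD, List.getElem?_append_right le_rfl, Nat.sub_self,
      List.getElem?_append_right (Nat.le_succ _), List.getElem?_cons_zero, Option.getD_some] at ha hb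
    rcases lt_trichotomy k pre.length with h4 | rfl | h4
    · rw [h1 k (by omega) (by omega), hρ k hk]
      simp only [List.getD_eq_getElem?_getD, List.getElem?_append_left h4]
    · rw [h2, hb]
      simp [List.getD_eq_getElem?_getD]
    · obtain ⟨i, rfl⟩ := Nat.exists_eq_add_of_lt h4
      cases i with
      | zero =>
        rw [add_zero, h3, map_mul, map_mul, map_inv, ha, hb, refl3_conj]
        simp [List.getD_eq_getElem?_getD]
      | succ i =>
        rw [h1 _ (by omega) (by omega), hρ _ hk]
        have e : pre.length + (i + 1) + 1 = pre.length + (i + 2) := by ring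
        simp only [e, List.getD_eq_getElem?_getD, List.getElem?_append_right (Nat.le_add_right _ _),
          Nat.add_sub_cancel_left, List.getElem?_cons_succ]

/-- The prefix is kept general in the induction, because a move behind the head of a list is a move
with a longer prefix. -/
theorem Represents.hurwitz {l l' : List (Fin 3)} (h : Hurwitz l l') :
    ∀ (pre : List (Fin 3)) (r : RSet D o), (pre ++ l).length = n → g.Represents (pre ++ l) r →
      ∃ m : ModGroup D, g.Represents (pre ++ l') (m • r) := by
  induction h with
  | swap a b l => exact fun pre r hl hr => Represents.swap g hl hr
  | cons x _ ih =>
    intro pre r hl hr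
    have e : ∀ l : List (Fin 3), pre ++ x :: l = (pre ++ [x]) ++ l := fun l => by simp
    rw [e] at hl hr ⊢
    exact ih _ r hl hr
  | refl l => exact fun pre r _ hr => ⟨1, by rwa [one_smul]⟩
  | trans h1 _ ih1 ih2 =>
    intro pre r hl hr
    obtain ⟨m, hm⟩ := ih1 pre r hl hr
    obtain ⟨m', hm'⟩ := ih2 pre (m • r) (by
      rw [← hl, List.length_append, List.length_append, h1.length_eq]) hm
    exact ⟨m' * m, by rwa [mul_smul]⟩

/-- Every class is equivalent to the same class. -/
theorem exists_smul_represents {m : ℕ} (hn : n = 2 * m + 1) (r : RSet D o) :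
    ∃ t : ModGroup D, g.Represents (1 :: List.replicate (2 * m) 0) (t • r) := by
  obtain ⟨ρ, rfl⟩ := Quotient.exists_rep r
  obtain ⟨u, hu⟩ := g.exists_values ρ
  let l := (List.range n).map u
  have hl : l.length = n := by simp [l]
  have hlu : ∀ k < n, l.getD k 0 = u k := fun k hk => by
    simp [l, List.getD_eq_getElem?_getD, hk]
  have hrep : g.Represents ([] ++ l) (Quotient.mk _ ρ) := ⟨ρ, rfl, fun k hk => by
    rw [hu k hk]
    exact congrArg refl3 (hlu k hk).symm⟩
  obtain ⟨v, hv⟩ := Hurwitz.exists_normal (m := m) (l := l) (by rw [hl, hn]) fun c hc =>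
    g.not_constant hu c fun k hk => hc _ (List.mem_map.2 ⟨k, List.mem_range.2 hk, rfl⟩)
  obtain ⟨t, σ, hσ, hσv⟩ := Represents.hurwitz g hv [] _ hl hrep
  have hne : ∀ v : Fin 3, v ≠ v + 1 := by decide
  -- Conjugation does not change the class and normalizes the two letters v and v + 1 to 1 and 0.
  obtain ⟨s, hs1, hs2⟩ := exists_conj_refl3 (hne v)
  refine ⟨t, σ.conj s, ?_, fun k hk => ?_⟩
  · rw [EpiPrime.mk_conj]
    exact hσ
  · rw [EpiPrime.conj_apply, hσv k hk]
    cases k with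
    | zero => simpa using hs1
    | succ k =>
      have hk' : k < 2 * m := by omega
      simpa [List.getD_eq_getElem?_getD, hk'] using hs2

theorem isPretransitive (g : HurwitzGenerators D o n) {m : ℕ} (hn : n = 2 * m + 1) :
    MulAction.IsPretransitive (ModGroup D) (RSet D o) where
  exists_smul_eq r r' := by
    obtain ⟨t, ρ, hρ, hρv⟩ := g.exists_smul_represents hn r
    obtain ⟨t', σ, hσ, hσv⟩ := g.exists_smul_represents hn r'
    have h : ρ = σ := g.epi_ext fun k hk => (hρv k hk).trans (hσv k hk).symm
    refine ⟨t'⁻¹ * t, ?_⟩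
    rw [mul_smul, inv_smul_eq_iff, hρ, hσ, h]

end HurwitzGenerators

/-! ### Eisenstein integers -/

/-- The ring of Eisenstein integers, generated by a primitive sixth root of unity. -/
abbrev Eisenstein : Type := QuadraticAlgebra ℤ (-1) 1

namespace Eisenstein

/-- The primitive sixth root of unity. -/
def zeta : Eisensteinˣ where
  val := ⟨0, 1⟩
  inv := ⟨1, -1⟩
  val_inv := by ext <;> simp [QuadraticAlgebra.re_one, QuadraticAlgebra.im_one]
  inv_val := by ext <;> simp [QuadraticAlgebra.re_one, QuadraticAlgebra.im_one]

theorem zeta_mul_zeta : (zeta : Eisenstein) * zeta = zeta - 1 := by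
  ext <;> simp [zeta, QuadraticAlgebra.re_one, QuadraticAlgebra.im_one]

theorem zeta_pow_six : zeta ^ 6 = 1 := by
  have h := zeta_mul_zeta
  ext1
  push_cast
  linear_combination ((zeta : Eisenstein) ^ 4 + (zeta : Eisenstein) ^ 3 - zeta - 1) * h

theorem _root_.tau_eq : tau = 1 / 2 + (Real.sqrt 3 / 2 : ℝ) * Complex.I := by
  have h : (Real.pi / 3 : ℂ) = ((Real.pi / 3 : ℝ) : ℂ) := by push_cast; rfl
  rw [tau, Complex.exp_mul_I, h, ← Complex.ofReal_cos, ← Complex.ofReal_sin, Real.cos_pi_div_three,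
    Real.sin_pi_div_three]
  push_cast
  rfl

theorem _root_.tau_mul_tau : tau * tau = tau - 1 := by
  rw [tau_eq]
  have h : ((Real.sqrt 3 : ℝ) : ℂ) ^ 2 = 3 := by
    rw [← Complex.ofReal_pow, Real.sq_sqrt (by norm_num)]
    norm_num
  push_cast
  linear_combination (Complex.I ^ 2 / 4) * h + (3 / 4) * Complex.I_sq

/-- The embedding in the complex numbers. -/
noncomputable def toComplex : Eisenstein →+* ℂ :=
  (QuadraticAlgebra.lift ⟨tau, by rw [tau_mul_tau]; simp; ring⟩ : Eisenstein →ₐ[ℤ] ℂ).toRingHom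

theorem toComplex_apply (x : Eisenstein) : toComplex x = x.re + x.im * tau := by
  simp [toComplex, QuadraticAlgebra.lift]

theorem toComplex_zeta : toComplex zeta = tau := by
  rw [toComplex_apply]
  simp [zeta]

theorem toComplex_injective : Function.Injective toComplex := by
  refine (injective_iff_map_eq_zero _).2 fun x hx => ?_
  rw [toComplex_apply, tau_eq] at hx
  have h1 := congrArg Complex.im hx
  have h2 := congrArg Complex.re hx
  simp at h1 h2
  rw [h1] at h2
  ext
  · simpa using h2
  · exact h1

/-- The reduction modulo the prime above three. -/
def toZMod : Eisenstein →+* ZMod 3 :=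
  (QuadraticAlgebra.lift ⟨-1, by decide⟩ : Eisenstein →ₐ[ℤ] ZMod 3).toRingHom

theorem toZMod_zeta : toZMod zeta = -1 := by
  simp [toZMod, QuadraticAlgebra.lift, zeta]

end Eisenstein

/-! ### Affine actions on the Eisenstein integers and their cohomology classes. -/

open Eisenstein

theorem perm_apply_inv {X : Type} (s : Equiv.Perm X) (x : X) : s (s⁻¹ x) = x := s.apply_symm_apply x

variable {D : Finset S2} {o : Punctured D}

/-- An action of the fundamental group on the Eisenstein integers by affine transformations, for
which the linear part of a simple loop is the primitive sixth root of unity. -/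
structure AffineRep (D : Finset S2) (o : Punctured D) where
  linear : PiOne D o →* Eisensteinˣ
  toHom : PiOne D o →* Equiv.Perm Eisenstein
  apply : ∀ g x, toHom g x = linear g * x + toHom g 0
  linear_simple : ∀ c, IsSimpleLoop c → linear c = zeta

theorem HurwitzGenerators.isSimpleLoop_c {n : ℕ} (g : HurwitzGenerators D o n) {k : ℕ} (hk : k < n) :
    IsSimpleLoop (g.c k) := g.isSimpleLoop k hk

/-- By freeness c_k may act as x ↦ ζ x + u_k. A loop around the last point has linear part ζ⁻¹¹,
which is ζ since ζ¹² = 1: here the number of points fits the order of the cover. -/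
theorem HurwitzGenerators.exists_affineRep (g : HurwitzGenerators D o 11) (u : ℕ → Eisenstein) :
    ∃ A : AffineRep D o, ∀ k < 11, A.toHom (g.c k) 0 = u k := by
  obtain ⟨L, hL⟩ := g.exists_hom_c fun _ => zeta
  obtain ⟨Φ, hΦ⟩ := g.exists_hom_c fun k => (MulAction.toPerm zeta).trans (Equiv.addRight (u k))
  have hΦ' : ∀ k < 11, ∀ x, Φ (g.c k) x = zeta * x + u k := fun k hk x => by rw [hΦ k hk]; rfl
  have hW : ∀ k ≤ 11, L (g.W k) = zeta ^ k := by
    intro k hk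
    induction k with
    | zero => rw [g.zero, map_one, pow_zero]
    | succ k ih => rw [g.W_succ, map_mul, ih (by omega), hL k (by omega), pow_succ]
  have hc : ∀ {x y}, IsConj x y → L x = L y := fun {x y} hxy => by
    obtain ⟨b, rfl⟩ := isConj_iff.1 hxy
    rw [map_mul, map_mul, map_inv, mul_comm, inv_mul_cancel_left]
  let H : Subgroup (PiOne D o) :=
    { carrier := {b | ∀ x y, Φ b x - Φ b y = L b * (x - y)}
      one_mem' := fun x y => by rw [map_one, map_one, Units.val_one, one_mul]; rfl
      mul_mem' := fun {a b} ha hb x y => by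
        rw [map_mul, map_mul, Equiv.Perm.mul_apply, Equiv.Perm.mul_apply, ha, hb, Units.val_mul,
          mul_assoc]
      inv_mem' := fun {a} ha x y => by
        have h := ha (Φ a⁻¹ x) (Φ a⁻¹ y)
        rw [map_inv, perm_apply_inv, perm_apply_inv] at h
        rw [map_inv, map_inv, h, Units.inv_mul_cancel_left] }
  have hH : H = ⊤ := g.closure_c fun k hk x y => by
    rw [hΦ' k hk, hΦ' k hk, hL k hk]
    ring
  refine ⟨⟨L, Φ, fun b x => ?_, fun c h => ?_⟩, fun k hk => ?_⟩
  · have h : b ∈ H := by rw [hH]; trivial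
    have h1 := h x 0
    rw [sub_zero] at h1
    rw [← h1, sub_add_cancel]
  · rcases g.isConj c h with ⟨k, hk, h1⟩ | h1
    · exact (hc h1).trans (hL k hk)
    · rw [hc h1, map_inv, hW 11 le_rfl, inv_eq_iff_mul_eq_one, ← pow_succ,
        show zeta ^ 12 = (zeta ^ 6) ^ 2 by rw [← pow_mul], zeta_pow_six, one_pow]
  · exact (hΦ' k hk 0).trans (by rw [mul_zero, zero_add])

namespace AffineRep

variable (A : AffineRep D o)

theorem linear_cover {k : PiOne D o} (hk : k ∈ coverGroup D o) : A.linear k = 1 := by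
  refine (Subgroup.normalClosure_le_normal (N := A.linear.ker) ?_ hk : k ∈ A.linear.ker)
  rintro g (⟨c, c', hc, hc', rfl⟩ | ⟨c, hc, rfl⟩)
  · change A.linear (c * c'⁻¹) = 1
    rw [map_mul, map_inv, A.linear_simple c hc, A.linear_simple c' hc', mul_inv_cancel]
  · change A.linear (c ^ 6) = 1
    rw [map_pow, A.linear_simple c hc, zeta_pow_six]

theorem apply_cover {k : PiOne D o} (hk : k ∈ coverGroup D o) (x : Eisenstein) :
    A.toHom k x = x + A.toHom k 0 := by
  rw [A.apply, A.linear_cover hk, Units.val_one, one_mul]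

theorem apply_simple {c : PiOne D o} (hc : IsSimpleLoop c) (x : Eisenstein) :
    A.toHom c x = zeta * x + A.toHom c 0 := by
  rw [A.apply, A.linear_simple c hc]

/-- Since (1 - ζ)⁻¹ = ζ, a simple loop fixes ζ times its translation part. Its sixth power is a
translation with a fixed point. -/
theorem apply_pow_six {c : PiOne D o} (hc : IsSimpleLoop c) : A.toHom (c ^ 6) 0 = 0 := by
  have h1 : A.toHom c (zeta * A.toHom c 0) = zeta * A.toHom c 0 := by
    rw [A.apply_simple hc]
    linear_combination (A.toHom c 0) * zeta_mul_zeta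
  have h2 : A.toHom (c ^ 6) (zeta * A.toHom c 0) = zeta * A.toHom c 0 := by
    rw [map_pow]
    exact Function.iterate_fixed h1 6
  rw [A.apply_cover (pow_mem_coverGroup hc)] at h2
  exact left_eq_add.1 h2.symm

/-- Conjugating a translation by an affine map applies the linear part to it; this puts the class in
the χ-eigenspace. -/
theorem apply_conj {c k : PiOne D o} (hc : IsSimpleLoop c) (hk : k ∈ coverGroup D o) :
    A.toHom (c * k * c⁻¹) 0 = zeta * A.toHom k 0 := by
  have h1 : A.toHom c (A.toHom c⁻¹ 0) = 0 := by rw [map_inv, perm_apply_inv]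
  rw [A.apply_simple hc] at h1
  rw [map_mul, map_mul, Equiv.Perm.mul_apply, Equiv.Perm.mul_apply, A.apply_cover hk,
    A.apply_simple hc]
  linear_combination h1

theorem apply_mul_inv {c c' : PiOne D o} (hc : IsSimpleLoop c) (hc' : IsSimpleLoop c') :
    A.toHom (c * c'⁻¹) 0 = A.toHom c 0 - A.toHom c' 0 := by
  have h1 : A.toHom c' (A.toHom c'⁻¹ 0) = 0 := by rw [map_inv, perm_apply_inv]
  rw [A.apply_simple hc'] at h1
  rw [map_mul, Equiv.Perm.mul_apply, A.apply_simple hc]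
  linear_combination h1

end AffineRep

theorem smul_val_apply (a : simpleAut D o) (φ : H1chi D o) (k : coverGroup D o) :
    (a • φ).1 (Additive.ofMul k) = φ.1 (Additive.ofMul
      ⟨(a⁻¹ : simpleAut D o).1 k, simpleAut_mem_coverGroup a⁻¹ k.2⟩) := rfl

namespace AffineRep

variable (A : AffineRep D o)

/-- The cohomology class of an affine action: the translation parts of the elements of
`coverGroup`. -/
noncomputable def cls : H1chi D o :=
  ⟨{ toFun := fun k => toComplex (A.toHom k.toMul 0)
     map_zero' := (congrArg (fun s : Equiv.Perm Eisenstein => toComplex (s 0)) (map_one A.toHom)).trans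
      (map_zero _)
     map_add' := fun k k' => by
      rw [← map_add]
      refine congrArg _ ?_
      change A.toHom (k.toMul.1 * k'.toMul.1) 0 = _
      rw [map_mul, Equiv.Perm.mul_apply, A.apply_cover k.toMul.2, add_comm] },
    fun c hc => (congrArg toComplex (A.apply_pow_six hc)).trans (map_zero _),
    fun c hc k => by
      refine (congrArg toComplex (A.apply_conj hc k.2)).trans ?_
      rw [map_mul, toComplex_zeta]
      rfl⟩

theorem cls_smul {a : simpleAut D o} {z : ℂ} (h : a • A.cls = z • A.cls) {k : PiOne D o}
    (hk : k ∈ coverGroup D o) :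
    toComplex (A.toHom ((a⁻¹ : simpleAut D o).1 k) 0) = z * toComplex (A.toHom k 0) := by
  have h1 := congrArg (fun φ : H1chi D o => φ.1 (Additive.ofMul ⟨k, hk⟩)) h
  have h2 : (z • A.cls).1 (Additive.ofMul ⟨k, hk⟩) = z * A.cls.1 (Additive.ofMul ⟨k, hk⟩) := rfl
  exact (smul_val_apply a A.cls ⟨k, hk⟩).symm.trans (h1.trans h2)

end AffineRep

theorem mul_inv_mem_coverGroup {c c' : PiOne D o} (hc : IsSimpleLoop c) (hc' : IsSimpleLoop c') :
    c * c'⁻¹ ∈ coverGroup D o :=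
  Subgroup.subset_normalClosure (Or.inl ⟨c, c', hc, hc', rfl⟩)

/-- If a scalar is the action of an automorphism that preserves the simple loops, it is a unit of
the ring of Eisenstein integers. -/
theorem HurwitzGenerators.exists_eisenstein_unit (g : HurwitzGenerators D o 11) {a : simpleAut D o}
    {z : ℂ} (h : ∀ φ : H1chi D o, a • φ = z • φ) : ∃ l : Eisensteinˣ, z = toComplex l := by
  -- The class of this action has the value 1 on c₀ c₁⁻¹, so the scalar is itself a value of the
  -- class and hence an Eisenstein integer. The same applies to the inverse scalar.
  obtain ⟨A, hA⟩ := g.exists_affineRep fun k => if k = 0 then 1 else 0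
  have h0 := g.isSimpleLoop_c (k := 0) (by norm_num)
  have h1 := g.isSimpleLoop_c (k := 1) (by norm_num)
  have hk := mul_inv_mem_coverGroup h0 h1
  have hone : A.toHom (g.c 0 * (g.c 1)⁻¹) 0 = 1 := by
    rw [A.apply_mul_inv h0 h1, hA 0 (by norm_num), hA 1 (by norm_num)]
    simp
  have key : ∀ {a : simpleAut D o} {z : ℂ}, a • A.cls = z • A.cls → ∃ l, z = toComplex l :=
    fun {a z} h => ⟨_, by rw [A.cls_smul h hk, hone, map_one, mul_one]⟩
  have hne : A.cls ≠ 0 := fun h => by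
    have h2 : toComplex (A.toHom (g.c 0 * (g.c 1)⁻¹) 0) = 0 :=
      congrArg (fun φ : H1chi D o => φ.1 (Additive.ofMul ⟨_, hk⟩)) h
    rw [hone, map_one] at h2
    exact one_ne_zero h2
  have hz : z ≠ 0 := by
    rintro rfl
    have h2 := h A.cls
    rw [zero_smul, smul_eq_zero_iff_eq] at h2
    exact hne h2
  obtain ⟨l, hl⟩ := key (h A.cls)
  obtain ⟨l', hl'⟩ := key (a := a⁻¹) (z := z⁻¹) (by
    rw [inv_smul_eq_iff, smul_comm, h, inv_smul_smul₀ hz])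
  have hll : l * l' = 1 := toComplex_injective (by
    rw [map_mul, ← hl, ← hl', mul_inv_cancel₀ hz, map_one])
  exact ⟨Units.mkOfMulEqOne l l' hll, hl⟩

/-- 𝔖₃ is the group of affine transformations of 𝔽₃, and conjugation by such a transformation
changes the parameter of a reflection affinely. -/
theorem exists_conj_affine {e : Fin 3} (he : e ≠ 0) (t : Fin 3) :
    ∃ s : Equiv.Perm (Fin 3), ∀ u, s * refl3 u * s⁻¹ = refl3 (e * u + t) := by
  revert e t
  decide

/-- An affine action lifts every element of `EpiPrime`. -/
theorem HurwitzGenerators.exists_lift (g : HurwitzGenerators D o 11) {ρ : EpiPrime D o}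
    {u : ℕ → Fin 3} (hu : g.HasValues ρ u) :
    ∃ A : AffineRep D o, (∀ k < 11, toZMod (A.toHom (g.c k) 0) = u k) ∧
      ∀ b x, toZMod (A.toHom b x) = ρ.1 b (toZMod x) := by
  obtain ⟨A, hA⟩ := g.exists_affineRep fun k => ((u k).val : Eisenstein)
  have hA' : ∀ k < 11, toZMod (A.toHom (g.c k) 0) = u k := fun k hk => by
    rw [hA k hk, map_natCast]
    exact ZMod.natCast_zmod_val (n := 3) (u k)
  refine ⟨A, hA', ?_⟩
  let H : Subgroup (PiOne D o) :=
    { carrier := {b | ∀ x, toZMod (A.toHom b x) = ρ.1 b (toZMod x)}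
      one_mem' := fun x => by rw [map_one, map_one]; rfl
      mul_mem' := fun {a b} ha hb x => by
        rw [map_mul, map_mul, Equiv.Perm.mul_apply, ha, hb]
        rfl
      inv_mem' := fun {a} ha x => by
        have h := ha (A.toHom a⁻¹ x)
        rw [map_inv, perm_apply_inv] at h
        rw [map_inv, map_inv, h]
        exact ((ρ.1 a).symm_apply_apply _).symm }
  -- Modulo the prime above three ζ is -1, so x ↦ ζ x + u_k becomes the reflection x ↦ u_k - x.
  have hH : H = ⊤ := g.closure_c fun k hk x => by
    rw [A.apply_simple (g.isSimpleLoop_c hk), map_add, map_mul, hA' k hk, toZMod_zeta, hu k hk,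
      neg_one_mul]
    exact neg_add_eq_sub (toZMod x) (show ZMod 3 from u k)
  intro b
  have h : b ∈ H := by rw [hH]; trivial
  exact h

/-- An automorphism that acts on the cohomology by a scalar acts trivially on `R(S,D)`. -/
theorem HurwitzGenerators.smul_eq_of_scalar (g : HurwitzGenerators D o 11) {a : simpleAut D o}
    {z : ℂ} (h : ∀ φ : H1chi D o, a • φ = z • φ) (r : RSet D o) : a • r = r := by
  obtain ⟨l, rfl⟩ := g.exists_eisenstein_unit h
  induction r using Quotient.ind with | _ ρ =>
  obtain ⟨u, hu⟩ := g.exists_values ρ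
  obtain ⟨v, hv⟩ := g.exists_values (ρ.twist a)
  obtain ⟨A, hA, hρ⟩ := g.exists_lift hu
  let e : Fin 3 := toZMod l
  have he : e ≠ 0 := (l.isUnit.map toZMod).ne_zero
  -- The scalar relation is applied to c_k c_0⁻¹ and reduced modulo the prime above three, which
  -- gives v_k - v_0 = e (u_k - u_0).
  have hdiff : ∀ k < 11, v k = e * u k + (v 0 - e * u 0) := by
    intro k hk
    have hk' := g.isSimpleLoop_c hk
    have h0 := g.isSimpleLoop_c (k := 0) (by norm_num)
    have hm := mul_inv_mem_coverGroup hk' h0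
    have h1 := A.cls_smul (h A.cls) hm
    rw [← map_mul] at h1
    have h2 := congrArg toZMod (toComplex_injective h1)
    rw [hρ, map_mul toZMod, map_zero] at h2
    have h3 : toZMod (A.toHom (g.c k * (g.c 0)⁻¹) 0) = u k - u 0 := by
      refine (congrArg toZMod (A.apply_mul_inv hk' h0)).trans ?_
      exact (map_sub toZMod _ _).trans (congrArg₂ (· - ·) (hA k hk) (hA 0 (by norm_num)))
    have h4 : ρ.1 ((a⁻¹ : simpleAut D o).1 (g.c k * (g.c 0)⁻¹)) 0 = v k - v 0 := by
      have h5 : (ρ.twist a).1 (g.c k * (g.c 0)⁻¹) = refl3 (v k) * (refl3 (v 0))⁻¹ := by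
        rw [map_mul, map_inv, hv k hk, hv 0 (by norm_num)]
      refine (congrArg (fun s : Equiv.Perm (Fin 3) => s 0) h5).trans ?_
      generalize v k = x
      generalize v 0 = y
      revert x y
      decide
    have h6 : v k - v 0 = e * (u k - u 0) := h4.symm.trans (h2.trans (congrArg (toZMod l * ·) h3))
    generalize v k = x at h6 ⊢
    generalize v 0 = y at h6 ⊢
    generalize u k = x' at h6 ⊢
    generalize u 0 = y' at h6 ⊢
    clear_value e
    revert e x y x' y'
    decide
  obtain ⟨s, hs⟩ := exists_conj_affine he (v 0 - e * u 0)
  have h7 : ρ.twist a = ρ.conj s := g.epi_ext fun k hk => by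
    rw [EpiPrime.conj_apply, hu k hk, hs, hv k hk, ← hdiff k hk]
  exact (congrArg (Quotient.mk _) h7).trans (EpiPrime.mk_conj s ρ)

/-! ### The group `Γ` -/

variable {D : Finset S2} {o : Punctured D}

theorem smul_mk_eq (a : simpleAut D o) {φ : H1chi D o} (hφ : φ ≠ 0) :
    a • Projectivization.mk ℂ φ hφ =
      Projectivization.mk ℂ (a • φ) ((smul_ne_zero_iff_ne a).2 hφ) := rfl

/-- A covering transformation acts on `H¹(Σ; ℂ)_χ` by a scalar. -/
theorem HurwitzGenerators.exists_scalar {n : ℕ} (g : HurwitzGenerators D o n) (b : PiOne D o) :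
    ∃ z : ℂˣ, ∀ (φ : H1chi D o) (k : coverGroup D o),
      φ.1 (Additive.ofMul (conjCover b k)) = z * φ.1 (Additive.ofMul k) := by
  have htau : tau ≠ 0 := Complex.exp_ne_zero _
  let H : Subgroup (PiOne D o) :=
    { carrier := {b | ∃ z : ℂˣ, ∀ (φ : H1chi D o) (k : coverGroup D o),
        φ.1 (Additive.ofMul (conjCover b k)) = z * φ.1 (Additive.ofMul k)}
      one_mem' := ⟨1, fun φ k => by
        rw [Units.val_one, one_mul]
        refine congrArg φ.1 (congrArg Additive.ofMul (Subtype.ext ?_))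
        exact (mul_inv_eq_iff_eq_mul.2 (by rw [one_mul, mul_one]))⟩
      mul_mem' := fun {a b} ⟨z, hz⟩ ⟨w, hw⟩ => ⟨z * w, fun φ k => by
        rw [Units.val_mul, mul_assoc, ← hw, ← hz]
        refine congrArg φ.1 (congrArg Additive.ofMul (Subtype.ext ?_))
        change a * b * k * (a * b)⁻¹ = a * (b * k * b⁻¹) * a⁻¹
        simp only [mul_inv_rev, mul_assoc]⟩
      inv_mem' := fun {a} ⟨z, hz⟩ => ⟨z⁻¹, fun φ k => by
        rw [Units.eq_inv_mul_iff_mul_eq, ← hz]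
        refine congrArg φ.1 (congrArg Additive.ofMul (Subtype.ext ?_))
        change a * (a⁻¹ * k * a⁻¹⁻¹) * a⁻¹ = k
        simp only [inv_inv, mul_assoc, mul_inv_cancel_left, mul_inv_cancel, mul_one]⟩ }
  have hH : H = ⊤ := g.closure_c fun k hk =>
    ⟨Units.mk0 tau htau, fun φ => φ.2.2 _ (g.isSimpleLoop_c hk)⟩
  have h : b ∈ H := by rw [hH]; trivial
  exact h

/-- Inner automorphisms act trivially on `ℙ(S,D)`. -/
theorem HurwitzGenerators.smul_eq_of_conj {n : ℕ} (g : HurwitzGenerators D o n)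
    {a a' : simpleAut D o} {b : PiOne D o}
    (h : (a' : MulAut (PiOne D o)) = MulAut.conj b * (a : MulAut (PiOne D o)))
    (x : ℙ ℂ (H1chi D o)) : a' • x = a • x := by
  induction x using Projectivization.ind with | _ φ hφ =>
  rw [smul_mk_eq, smul_mk_eq, Projectivization.mk_eq_mk_iff']
  -- Composing `a` with conjugation by b turns `a⁻¹` into conjugation by `a⁻¹ b⁻¹` after `a⁻¹`, and
  -- conjugation is a scalar on the eigenspace.
  obtain ⟨z, hz⟩ := g.exists_scalar ((a⁻¹ : simpleAut D o).1 b⁻¹)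
  refine ⟨z, Subtype.ext (AddMonoidHom.ext fun k => ?_)⟩
  refine (hz φ (⟨(a⁻¹ : simpleAut D o).1 k.toMul, simpleAut_mem_coverGroup a⁻¹ k.toMul.2⟩)).symm.trans
    (congrArg φ.1 (congrArg Additive.ofMul (Subtype.ext ?_)))
  change (a.1)⁻¹ b⁻¹ * (a.1)⁻¹ k.toMul * ((a.1)⁻¹ b⁻¹)⁻¹ = (a'.1)⁻¹ k.toMul
  rw [h, mul_inv_rev, MulAut.mul_apply, MulAut.conj_inv_apply, map_mul, map_mul, ← map_inv _ b⁻¹,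
    inv_inv]

/-- An automorphism that acts trivially on `ℙ(S,D)` acts on `H¹(Σ; ℂ)_χ` by a scalar. -/
theorem exists_scalar_of_smul_eq {a : simpleAut D o} (h : ∀ x : ℙ ℂ (H1chi D o), a • x = x) :
    ∃ z : ℂ, ∀ φ : H1chi D o, a • φ = z • φ := by
  -- Every nonzero vector is proportional to its image, and a linear map with this property is a
  -- scalar.
  obtain ⟨z, hz⟩ := LinearMap.exists_eq_smul_id_of_forall_notLinearIndependent
    (f := DistribSMul.toLinearMap ℂ (H1chi D o) a) (fun φ => by
      by_cases hφ : φ = 0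
      · simp [linearIndependent_fin2, hφ]
      · have h1 := h (Projectivization.mk ℂ φ hφ)
        rw [smul_mk_eq, Projectivization.mk_eq_mk_iff'] at h1
        simpa [LinearIndependent.pair_iff' hφ] using h1)
  exact ⟨z, fun φ => LinearMap.congr_fun hz φ⟩

/-- The transformation of `ℙ(S,D)` induced by a diffeomorphism. -/
noncomputable def gammaOf (o : Punctured D) (f : DiffPlus D) : Gamma D o :=
  ⟨MulAction.toPermHom (simpleAut D o) (ℙ ℂ (H1chi D o)) (pushAut f (somePathClass o f)), f, _, rfl⟩

theorem HurwitzGenerators.gammaOf_apply {n : ℕ} (g : HurwitzGenerators D o n) (f : DiffPlus D)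
    (p : Path.Homotopic.Quotient o (restr f o)) (x : ℙ ℂ (H1chi D o)) :
    (gammaOf o f : Equiv.Perm (ℙ ℂ (H1chi D o))) x = pushAut f p • x := by
  obtain ⟨b, hb⟩ := pushAut_eq_conj f p (somePathClass o f)
  exact g.smul_eq_of_conj hb x

theorem HurwitzGenerators.gammaOf_mul {n : ℕ} (g : HurwitzGenerators D o n) (f f' : DiffPlus D) :
    gammaOf o (f * f') = gammaOf o f * gammaOf o f' := by
  refine Subtype.ext (Equiv.ext fun x => ?_)
  rw [g.gammaOf_apply _ ((somePathClass o f).trans ((somePathClass o f').map (restr f))),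
    pushAut_mul, mul_smul]
  rfl

theorem HurwitzGenerators.gammaOf_eq_one {n : ℕ} (g : HurwitzGenerators D o n) {f : DiffPlus D}
    (hf : f ∈ isotopicToOne D) : gammaOf o f = 1 := by
  obtain ⟨p, hp⟩ := pushAut_of_isotopicToOne (o := o) f hf
  refine Subtype.ext (Equiv.ext fun x => ?_)
  rw [g.gammaOf_apply f p, hp, one_smul]
  rfl

/-- The action of the mapping class group on `ℙ(S,D)`, as a homomorphism to `Γ`. -/
noncomputable def HurwitzGenerators.toGamma {n : ℕ} (g : HurwitzGenerators D o n) :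
    ModGroup D →* Gamma D o :=
  QuotientGroup.lift (isotopicToOne D) (MonoidHom.mk' (gammaOf o) g.gammaOf_mul)
    fun _ => g.gammaOf_eq_one

theorem HurwitzGenerators.toGamma_mk {n : ℕ} (g : HurwitzGenerators D o n) (f : DiffPlus D)
    (p : Path.Homotopic.Quotient o (restr f o)) (x : ℙ ℂ (H1chi D o)) :
    (g.toGamma (QuotientGroup.mk f) : Equiv.Perm (ℙ ℂ (H1chi D o))) x = pushAut f p • x :=
  g.gammaOf_apply f p x

theorem HurwitzGenerators.toGamma_surjective {n : ℕ} (g : HurwitzGenerators D o n) :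
    Function.Surjective g.toGamma := by
  rintro ⟨σ, f, p, rfl⟩
  exact ⟨QuotientGroup.mk f, Subtype.ext (Equiv.ext fun x => g.toGamma_mk f p x)⟩

/-- This is the factorization: acting trivially on the projective space means acting by a scalar on
the eigenspace, and such automorphisms fix every class of homomorphisms. -/
theorem HurwitzGenerators.ker_toGamma_le (g : HurwitzGenerators D o 11) :
    g.toGamma.ker ≤ (MulAction.toPermHom (ModGroup D) (RSet D o)).ker := by
  intro m hm
  obtain ⟨f, rfl⟩ := QuotientGroup.mk_surjective m
  refine Equiv.ext fun r => (modAction_mk f (somePathClass o f) r).trans ?_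
  obtain ⟨z, hz⟩ := exists_scalar_of_smul_eq (a := pushAut f (somePathClass o f)) fun x => by
    rw [← g.toGamma_mk f, MonoidHom.mem_ker.1 hm]
    rfl
  exact g.smul_eq_of_scalar hz r

theorem HurwitzGenerators.exists_action (g : HurwitzGenerators D o 11) :
    ∃ act : Gamma D o →* Equiv.Perm (RSet D o),
      ∀ (m : ModGroup D) (r : RSet D o), m • r = act (g.toGamma m) r := by
  refine ⟨g.toGamma.liftOfSurjective g.toGamma_surjective ⟨_, g.ker_toGamma_le⟩, fun m r => ?_⟩
  have h := MonoidHom.liftOfRightInverse_comp_apply g.toGamma _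
    (Function.rightInverse_surjInv g.toGamma_surjective) ⟨_, g.ker_toGamma_le⟩ m
  exact (Equiv.congr_fun h r).symm

theorem mainTheorem7 (D : Finset S2) (hD : D.card = 12) (o : Punctured D) :
    (∃ q : ModGroup D →* Gamma D o,
      Function.Surjective q ∧
      (∀ (f : DiffPlus D) (p : Path.Homotopic.Quotient o (restr f o)) (x : ℙ ℂ (H1chi D o)),
        (q (QuotientGroup.mk f) : Equiv.Perm (ℙ ℂ (H1chi D o))) x = pushAut f p • x) ∧
      ∃ act : Gamma D o →* Equiv.Perm (RSet D o),
        ∀ (m : ModGroup D) (r : RSet D o), m • r = act (q m) r) ∧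
    (∀ T : ModGroup D, IsSimpleBraid T → ∀ r : RSet D o, T ^ 3 • r = r) ∧
    MulAction.IsPretransitive (ModGroup D) (RSet D o) ∧
    Nat.card (RSet D o) = (3 ^ 11 - 3) / 6 ∧
    Nat.card (RSet D o) = (3 ^ 10 - 1) / 2 := by
  have g : HurwitzGenerators D o 11 := (exists_generators hD o).some
  have hcard := g.card_RSet (by decide)
  refine ⟨⟨g.toGamma, g.toGamma_surjective, g.toGamma_mk, g.exists_action⟩,
    fun T hT r => hT.pow_three_smul r, g.isPretransitive (m := 5) (by norm_num), ?_, ?_⟩ <;>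
  norm_num at hcard ⊢ <;> omega
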